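/- **Setting.** Let $A(m)\in\mathbb{C}$ ($m\ge 1$) be the coefficients of an $L$-function $L(s)$ of degree $d\ge 1$ without poles, in the following sense. (i) $L(s)=\sum_{m\ge1}A(m)m^{-s}$, absolutely convergent for $\Re(s)>1$. (ii) For $\Re(s)>1$, $L(s)=\prod_p L_p(s)$ with $L_p(s)=\sum_{k\ge0}A(p^k)p^{-ks}$, and for every prime $p$ there are $\alpha_1(p),\dots,\alpha_d(p)\in\mathbb{C}$ (possibly zero) with $L_p(s)=\prod_{i=1}^d(1-\alpha_i(p)p^{-s})^{-1}$. (iii) $L$ extends to an entire function of finite order, and for some $Q>0$, $\mu_1,\dots,\mu_d\in\mathbb{C}$ and $|\varepsilon(L)|=1$, putting $\gamma(s)=Q^s\prod_{j=1}^d\Gamma\left(\frac{s+\mu_j}{2}\right)$, one has $\gamma(s)L(s)=\varepsilon(L)\,\gamma(1-s)L(1-s)$ as meromorphic functions. (iv) For every $\varepsilon>0$, $\sum_{m\le X}|A(m)|^2\ll_\varepsilon X^{1+\varepsilon}$ for all $X\ge1$. Let $\theta\ge0$ be such that $L(\tfrac12+it)\ll_\varepsilon(1+|t|)^{\theta+\varepsilon}$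 for all $t\in\mathbb{R}$ and every $\varepsilon>0$. Let $0<\delta<1$ and $M=X^\delta$, and put $$\Sigma(x)=\sum_{\substack{mk\in[x,x+H]\\ M<m\le 2M\\ (m,k)=1}}A(mk),$$ the sum running over pairs of positive integers $m,k$. **Second moment bound.** For all constants $c_1,c_2>0$ there is a constant $K$, depending only on the $L$-function, $\theta$, $\delta$, $c_1$ and $c_2$, such that for all $X\ge1$ and all $H$ with $c_1X^{6\delta}\le H\le c_2X^{1-6\delta}$, $$\int_X^{2X}|\Sigma(x)|^2\,dx\le K\left(H^2X^{1-\delta^2}+X^{2\theta(1+\delta)+6\delta}H^{2-2\theta}\right).$$ **Consequence.** Let $h=1+\delta-\frac1{2\theta}+\frac{6\delta+2\delta^2}{2\theta}$ if $\theta\ge\frac12$ and $h=6\delta$ if $\theta<\frac12$, and suppose that $h\le1-6\delta$. Then there is $X_0$, depending only on the $L$-function, $\theta$ and $\delta$, such that for all $X\ge X_0$ and all $C\ge1$, with $H=X^h$, the inequality $|\Sigma(x)|<CHX^{-\delta^2/2}$ holds for a set of $x\in[X,2X]$ of Lebesgue measure at least $(1-C^{-2})X$. -/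

import Mathlib

/-- The local factor `L_p(s) = ∑_{k ≥ 0} A(p^k) p^{-ks}` at `p`. -/
noncomputable def localFactor (A : ℕ → ℂ) (p : ℕ) (s : ℂ) : ℂ :=
  ∑' k : ℕ, A (p ^ k) / ((p ^ k : ℕ) : ℂ) ^ s

/-- The gamma factor `Q^s ∏_j Γ((s + μ_j)/2)` of a functional equation. -/
noncomputable def gammaFactor {d : ℕ} (Q : ℝ) (μ : Fin d → ℂ) (s : ℂ) : ℂ :=
  (Q : ℂ) ^ s * ∏ j, Complex.Gamma ((s + μ j) / 2)

/-- `s` is not a pole of `∏_j Γ((s + μ_j)/2)`. -/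
def GammaRegular {d : ℕ} (μ : Fin d → ℂ) (s : ℂ) : Prop :=
  ∀ (j : Fin d) (n : ℕ), (s + μ j) / 2 ≠ -(n : ℂ)

/-- `L` is an `L`-function of degree `d` without poles, with coefficients `A(m)`, `m ≥ 1`
(the value `A 0` plays no role). -/
structure IsLFunction (A : ℕ → ℂ) (L : ℂ → ℂ) (d : ℕ) : Prop where
  /-- the degree is positive -/
  degree_pos : 1 ≤ d
  /-- Dirichlet series: `L(s) = ∑_{m ≥ 1} A(m) m^{-s}` for `Re s > 1`, absolutely convergent -/
  dirichlet_series : ∀ s : ℂ, 1 < s.re → LSeriesHasSum A s (L s)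
  /-- Euler product: `L(s) = ∏_p L_p(s)` for `Re s > 1` -/
  euler_product : ∀ s : ℂ, 1 < s.re →
    HasProd (fun p : Nat.Primes => localFactor A (p : ℕ) s) (L s)
  /-- each local factor is the inverse of a polynomial in `p^{-s}` of degree at most `d`
  with constant term `1`: `L_p(s) = ∏_{i ≤ d} (1 - α_i(p) p^{-s})^{-1}` -/
  local_polynomial : ∀ p : ℕ, p.Prime → ∃ α : Fin d → ℂ, ∀ s : ℂ, 1 < s.re →
    (∏ i, (1 - α i * (p : ℂ) ^ (-s))) * localFactor A p s = 1
  /-- analytic continuation to the whole plane, without poles -/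
  entire : Differentiable ℂ L
  /-- the continuation has finite order -/
  finite_order : ∃ a C : ℝ, ∀ s : ℂ, ‖L s‖ ≤ C * Real.exp (‖s‖ ^ a)
  /-- functional equation, an identity of meromorphic functions -/
  functional_equation : ∃ (Q : ℝ) (μ : Fin d → ℂ) (w : ℂ), 0 < Q ∧ ‖w‖ = 1 ∧
    ∀ s : ℂ, GammaRegular μ s → GammaRegular μ (1 - s) →
      gammaFactor Q μ s * L s = w * gammaFactor Q μ (1 - s) * L (1 - s)
  /-- Rankin-Selberg bound: `∑_{m ≤ X} |A(m)|² ≪_ε X^{1+ε}` -/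
  rankin_selberg : ∀ ε : ℝ, 0 < ε → ∃ C : ℝ, ∀ X : ℝ, 1 ≤ X →
    ∑ m ∈ Finset.Icc 1 ⌊X⌋₊, ‖A m‖ ^ 2 ≤ C * X ^ (1 + ε)

/-- `θ ≥ 0` is a (sub)convexity exponent of `L`: `L(1/2 + it) ≪_ε (1 + |t|)^{θ+ε}`. -/
def IsSubconvexityExponent (L : ℂ → ℂ) (θ : ℝ) : Prop :=
  0 ≤ θ ∧ ∀ ε : ℝ, 0 < ε → ∃ C : ℝ, ∀ t : ℝ,
    ‖L (1 / 2 + (t : ℂ) * Complex.I)‖ ≤ C * (1 + |t|) ^ (θ + ε)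

/-- The short sum of `A(mk)` over pairs of coprime positive integers `m`, `k` with
`M < m ≤ 2M` and `x ≤ mk ≤ x + H` (for `M ≥ 0` and `x > 0`). -/
noncomputable def shortSum (A : ℕ → ℂ) (M H x : ℝ) : ℂ :=
  ∑ m ∈ Finset.Ioc ⌊M⌋₊ ⌊2 * M⌋₊,
    ∑ k ∈ (Finset.Icc 1 ⌊x + H⌋₊).filter (fun k : ℕ =>
      x ≤ (m : ℝ) * (k : ℝ) ∧ (m : ℝ) * (k : ℝ) ≤ x + H ∧ Nat.Coprime m k), A (m * k)

/-- The exponent `h` of the interval length `H = X^h` that balances the second moment bound. -/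
noncomputable def lengthExponent (θ δ : ℝ) : ℝ :=
  if 1 / 2 ≤ θ then 1 + δ - 1 / (2 * θ) + (6 * δ + 2 * δ ^ 2) / (2 * θ) else 6 * δ

/-! ### Divisor bound and the multiplicative extension -/

section

/-! For coprime m, k one has A(mk) = A(m)A(k), so Σ(x) is a short-interval sum of the coefficients
of D(t) = Σ A(m)A(k)(mk)^{-1/2-it}, summed over coprime pairs with M < m ≤ 2M. A Plancherel identity
(`integral_normSq_windowSum_le`) bounds the second moment by a constant times X² ∫ |D(t)|² / ((X/H +
1/2)² + t²) dt, so the effective range is |t| ≤ X/H.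

Möbius inversion and Cauchy-Schwarz (`norm_sum_coprime_sq_le`) separate the variables: |D|² ≤ Σ_e
|B_e|² · Σ_e |C_e|², where B_e and C_e are the polynomials over the m, respectively k, divisible by
e. The trivial bound X^{δ+ε} for Σ_e |B_e|², with the mean value theorem for the C_e, gives H²
X^{1+ε} for the second moment and just fails. A factor X^{-ρ}, with ρ slightly above δ², is saved
unless |B_e(t)|² > X^{δ-2ρ} for some e < X^ρ. The moment of order 2k with k = ⌈1/δ⌉, for which X ≤
M^k ≤ X^{1+δ}, shows that the exceptional t with |t| ≤ T = X^{1+δ}/H form a set of measure X^{O(δ)}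
(`volume_large_values_le`).

On that set D is bounded pointwise. After smoothing, the sum over k coprime to m is an integral on
the critical line of L times the inverse local factors at the primes dividing m, hence ≪ m^ε T^{θ+ε}
(`exists_norm_coprime_smooth_sum_le`). This produces the term with θ. The range |t| > T is
negligible by the decay of the weight. The pieces are assembled in
`integral_norm_bilinear_sq_div_le` and `exists_mean_square_bound`.

The arithmetic input, namely A(1) = 1, multiplicativity and |α_i(p)| ≤ √p, is extracted from the
Euler product and the Rankin-Selberg bound.

The consequence is Chebyshev's inequality, but it rests on the sharper form in
`exists_mean_square_bound`: exponent 4δ in place of 6δ, which matters for θ just below 1/2, and an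
extra factor X^{-δ²/100}, which absorbs all constants. -/

theorem exists_card_divisors_le_mul_rpow {ε : ℝ} (hε : 0 < ε) :
    ∃ C : ℝ, 1 ≤ C ∧ ∀ n : ℕ, n ≠ 0 → (n.divisors.card : ℝ) ≤ C * (n : ℝ) ^ ε := by
  have hl : 0 < Real.log 2 := Real.log_pos one_lt_two
  set C₁ : ℝ := max 1 (1 / (ε * Real.log 2)) with hC₁
  have h1C : 1 ≤ C₁ := le_max_left _ _
  obtain ⟨P, hP⟩ := exists_nat_ge ((2 : ℝ) ^ (1 / ε))
  -- Prime by prime: once p^ε ≥ 2 the factor a + 1 ≤ 2^a needs no constant. Each of the fewer than P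
  -- + 1 smaller primes costs at most C₁, whence the final constant C₁^P.
  have key : ∀ p a : ℕ, 2 ≤ p →
      (a + 1 : ℝ) ≤ (if p < P then C₁ else 1) * ((p : ℝ) ^ a) ^ ε := by
    intro p a hp
    have hp' : (2 : ℝ) ≤ p := by exact_mod_cast hp
    have hswap : ∀ x : ℝ, 0 ≤ x → (x ^ a) ^ ε = (x ^ ε) ^ a := fun x hx => by
      rw [← Real.rpow_natCast, ← Real.rpow_mul hx, mul_comm, Real.rpow_mul hx, Real.rpow_natCast]
    split_ifs with h
    · have h1 : 1 + (a * (ε * Real.log 2)) ≤ ((p : ℝ) ^ a) ^ ε := by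
        calc 1 + (a * (ε * Real.log 2)) ≤ Real.exp (a * (ε * Real.log 2)) := by
              linarith [Real.add_one_le_exp (a * (ε * Real.log 2))]
          _ = ((2 : ℝ) ^ a) ^ ε := by
              rw [Real.rpow_def_of_pos (by positivity), Real.log_pow]; ring_nf
          _ ≤ _ := by gcongr
      have h2 : 1 ≤ C₁ * (ε * Real.log 2) := by
        calc (1 : ℝ) = 1 / (ε * Real.log 2) * (ε * Real.log 2) := by field_simp
          _ ≤ _ := by gcongr; exact le_max_right _ _
      calc (a + 1 : ℝ) ≤ C₁ * (1 + (a * (ε * Real.log 2))) := by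
            nlinarith [(Nat.cast_nonneg a : (0 : ℝ) ≤ a)]
        _ ≤ _ := by gcongr
    · have h1 : (2 : ℝ) ≤ (p : ℝ) ^ ε := by
        have hPp : (P : ℝ) ≤ p := by exact_mod_cast not_lt.mp h
        calc (2 : ℝ) = ((2 : ℝ) ^ (1 / ε)) ^ ε := by
              rw [← Real.rpow_mul (by norm_num)]; field_simp; simp
          _ ≤ _ := by gcongr; exact hP.trans hPp
      rw [one_mul, hswap _ (by positivity)]
      calc (a + 1 : ℝ) ≤ 2 ^ a := by exact_mod_cast Nat.lt_two_pow_self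
        _ ≤ _ := by gcongr
  refine ⟨C₁ ^ P, one_le_pow₀ h1C, fun n hn => ?_⟩
  rw [Nat.card_divisors hn]
  push_cast
  calc (∏ p ∈ n.primeFactors, ((n.factorization p : ℝ) + 1))
      ≤ ∏ p ∈ n.primeFactors, ((if p < P then C₁ else 1) *
          ((p : ℝ) ^ n.factorization p) ^ ε) :=
        Finset.prod_le_prod (fun _ _ => by positivity)
          fun p hp => key p _ (Nat.prime_of_mem_primeFactors hp).two_le
    _ = (∏ p ∈ n.primeFactors, (if p < P then C₁ else 1)) * (n : ℝ) ^ ε := by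
        rw [Finset.prod_mul_distrib, Real.finsetProd_rpow _ _ (fun _ _ => by positivity)]
        congr 2
        have := Nat.prod_factorization_pow_eq_self hn
        conv_rhs => rw [← this]
        rw [Finsupp.prod, Nat.support_factorization]; push_cast; rfl
    _ ≤ _ := by
        gcongr
        rw [Finset.prod_ite, Finset.prod_const_one, mul_one, Finset.prod_const]
        apply pow_le_pow_right₀ h1C
        calc _ ≤ (Finset.range P).card := Finset.card_le_card fun x hx => by
              simpa using (Finset.mem_filter.mp hx).2
          _ = P := Finset.card_range P

/-- The multiplicative function with prescribed values at the prime powers. -/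
noncomputable def multExtension (A : ℕ → ℂ) (n : ℕ) : ℂ :=
  n.factorization.prod fun p k => A (p ^ k)

section EulerProduct

variable {A : ℕ → ℂ}

theorem multExtension_one : multExtension A 1 = 1 := by simp [multExtension]

theorem multExtension_prime_pow (h1 : A 1 = 1) {p : ℕ} (hp : p.Prime) (k : ℕ) :
    multExtension A (p ^ k) = A (p ^ k) := by
  rw [multExtension, hp.factorization_pow, Finsupp.prod_single_index (by simpa using h1)]

theorem multExtension_mul {m n : ℕ} (h : m.Coprime n) :
    multExtension A (m * n) = multExtension A m * multExtension A n := by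
  rw [multExtension, Nat.factorization_mul_of_coprime h,
    Finsupp.prod_add_index_of_disjoint h.disjoint_primeFactors]
  rfl

theorem term_multExtension_mul (s : ℂ) {m n : ℕ} (h : m.Coprime n) :
    LSeries.term (multExtension A) s (m * n) =
      LSeries.term (multExtension A) s m * LSeries.term (multExtension A) s n := by
  rcases eq_or_ne m 0 with rfl | hm
  · simp
  rcases eq_or_ne n 0 with rfl | hn
  · simp
  rw [LSeries.term_of_ne_zero (by positivity), LSeries.term_of_ne_zero hm,
    LSeries.term_of_ne_zero hn, multExtension_mul h, Nat.cast_mul,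
    Complex.natCast_mul_natCast_cpow]
  ring

theorem term_multExtension_prime_pow (h1 : A 1 = 1) (s : ℂ) {p : ℕ} (hp : p.Prime) (k : ℕ) :
    LSeries.term (multExtension A) s (p ^ k) = LSeries.term A s (p ^ k) := by
  rw [LSeries.term_of_ne_zero (pow_ne_zero _ hp.ne_zero),
    LSeries.term_of_ne_zero (pow_ne_zero _ hp.ne_zero), multExtension_prime_pow h1 hp]

/-- The local sums of absolute values are at most the exponentials of their tails k ≥ 1. Distinct
pairs (p, k) give distinct prime powers, so the tails together are at most T, the absolute sum of
the series of A. Hence every finite Euler product, and with it every partial sum, is at most exp T.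
Absolute convergence is what permits the Euler product expansion in `eq_multExtension`. -/
theorem lseriesSummable_multExtension (h1 : A 1 = 1) {s : ℂ} (hs : LSeriesSummable A s) :
    LSeriesSummable (multExtension A) s := by
  set h : ℕ → ℝ := fun n => ‖LSeries.term (multExtension A) s n‖ with hh
  have hs' : Summable fun n => ‖LSeries.term A s n‖ := hs.norm
  have hpp : ∀ {p : ℕ}, p.Prime → ∀ k, h (p ^ k) = ‖LSeries.term A s (p ^ k)‖ := fun hp k => by
    rw [hh]; simp only; rw [term_multExtension_prime_pow h1 s hp]
  have hsum : ∀ {p : ℕ}, p.Prime → Summable (fun n : ℕ ↦ ‖h (p ^ n)‖) := fun {p} hp => by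
    simp only [hpp hp, norm_norm]
    exact hs'.comp_injective (Nat.pow_right_injective hp.two_le)
  have hone : h 1 = 1 := by simp [hh, LSeries.term, multExtension_one]
  have hmul : ∀ {m n}, Nat.Coprime m n → h (m * n) = h m * h n := fun hmn => by
    simp [hh, term_multExtension_mul s hmn]
  set T : ℝ := ∑' n, ‖LSeries.term A s n‖
  have hpr : Summable fun x : Nat.Primes × ℕ => ‖LSeries.term A s ((x.1 : ℕ) ^ (x.2 + 1))‖ := by
    have hi : Function.Injective fun x : Nat.Primes × ℕ => (x.1 : ℕ) ^ (x.2 + 1) := by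
      rintro ⟨p, k⟩ ⟨q, l⟩ hxy
      have := Nat.Primes.prodNatEquiv.injective (a₁ := (p, k)) (a₂ := (q, l)) (Subtype.ext hxy)
      exact this
    exact hs'.comp_injective hi
  have hT : ∑' x : Nat.Primes × ℕ, ‖LSeries.term A s ((x.1 : ℕ) ^ (x.2 + 1))‖ ≤ T := by
    have hi : Function.Injective fun x : Nat.Primes × ℕ => (x.1 : ℕ) ^ (x.2 + 1) := by
      rintro ⟨p, k⟩ ⟨q, l⟩ hxy
      have := Nat.Primes.prodNatEquiv.injective (a₁ := (p, k)) (a₂ := (q, l)) (Subtype.ext hxy)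
      exact this
    exact tsum_comp_le_tsum_of_inj hs' (fun _ => norm_nonneg _) hi
  have hprod : ∀ S : Finset ℕ, ∏ p ∈ S with p.Prime, ∑' n : ℕ, h (p ^ n) ≤ Real.exp T := by
    intro S
    have hloc : ∀ p : Nat.Primes, ∑' n : ℕ, h (p ^ n) ≤
        Real.exp (∑' k : ℕ, ‖LSeries.term A s ((p : ℕ) ^ (k + 1))‖) := by
      intro p
      have := hsum p.2
      simp only [hh, norm_norm] at this
      rw [Summable.tsum_eq_zero_add this]
      simp only [pow_zero]
      change h 1 + ∑' b : ℕ, h (p ^ (b + 1)) ≤ _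
      rw [hone]
      simp only [hpp p.2]
      linarith [Real.add_one_le_exp (∑' b : ℕ, ‖LSeries.term A s ((p : ℕ) ^ (b + 1))‖)]
    have e1 : ∏ p ∈ S with p.Prime, ∑' n : ℕ, h (p ^ n) =
        ∏ p ∈ S.subtype Nat.Prime, ∑' n : ℕ, h ((p : ℕ) ^ n) := by
      rw [← Finset.subtype_map, Finset.prod_map]; rfl
    rw [e1]
    calc _ ≤ ∏ p ∈ S.subtype Nat.Prime,
          Real.exp (∑' k : ℕ, ‖LSeries.term A s ((p : ℕ) ^ (k + 1))‖) :=
          Finset.prod_le_prod (fun _ _ => tsum_nonneg fun _ => norm_nonneg _)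
            fun p _ => hloc p
      _ = Real.exp (∑ p ∈ S.subtype Nat.Prime,
          ∑' k : ℕ, ‖LSeries.term A s ((p : ℕ) ^ (k + 1))‖) := (Real.exp_sum _ _).symm
      _ ≤ _ := by
        apply Real.exp_le_exp.mpr
        refine le_trans ?_ hT
        rw [hpr.tsum_prod]
        have hp1 := hpr.prod
        exact Summable.sum_le_tsum (f := fun p : Nat.Primes => ∑' k : ℕ, ‖LSeries.term A s ((p : ℕ) ^ (k + 1))‖) (S.subtype Nat.Prime) (fun _ _ => tsum_nonneg fun _ => norm_nonneg _) hp1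
  rw [LSeriesSummable, ← summable_norm_iff]
  refine summable_of_sum_le (c := Real.exp T) (fun _ => norm_nonneg _) fun u => ?_
  change ∑ n ∈ u, h n ≤ _
  obtain ⟨N, hN⟩ : ∃ N, ∀ n ∈ u, n < N := ⟨u.sup id + 1, fun n hn =>
    Nat.lt_succ_of_le (Finset.le_sup (f := id) hn)⟩
  -- Every nonzero element of u is below N, hence has all its prime factors in `Finset.range N`, so
  -- the finite product dominates the partial sum over u.
  obtain ⟨hs1, hs2⟩ := EulerProduct.summable_and_hasSum_factoredNumbers_prod_filter_prime_tsum
    hone hmul hsum (Finset.range N)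
  refine le_trans ?_ (hprod (Finset.range N))
  rw [← hs2.tsum_eq]
  have h0 : h 0 = 0 := by simp [hh]
  have hu : ∑ n ∈ u, h n = ∑ n ∈ u.erase 0, h n := by
    by_cases h0u : 0 ∈ u
    · rw [← Finset.add_sum_erase u h h0u, h0, zero_add]
    · rw [Finset.erase_eq_of_notMem h0u]
  have hmem : ∀ n ∈ u.erase 0, n ∈ Nat.factoredNumbers (Finset.range N) := fun n hn => by
    rw [Finset.mem_erase] at hn
    refine ⟨hn.1, fun p hp => Finset.mem_range.mpr ?_⟩
    exact (Nat.le_of_mem_primeFactorsList hp).trans_lt (hN n hn.2)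
  rw [hu]
  rw [← Finset.sum_subtype_of_mem h (p := (· ∈ Nat.factoredNumbers (Finset.range N))) hmem]
  exact Summable.sum_le_tsum _ (fun _ _ => norm_nonneg _) hs2.summable

end EulerProduct

end

/-! ### Local factors, multiplicativity and the coprime Dirichlet series -/

section

open Filter Topology

namespace IsLFunction

variable {A : ℕ → ℂ} {L : ℂ → ℂ} {d : ℕ}

theorem norm_coeff_sq_le (hL : IsLFunction A L d) {ε : ℝ} (hε : 0 < ε) :
    ∃ C : ℝ, 0 < C ∧ ∀ n : ℕ, n ≠ 0 → ‖A n‖ ^ 2 ≤ C * (n : ℝ) ^ (1 + ε) := by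
  obtain ⟨C, hC⟩ := hL.rankin_selberg ε hε
  refine ⟨max C 1, by positivity, fun n hn => ?_⟩
  have h1n : (1 : ℝ) ≤ n := by exact_mod_cast Nat.one_le_iff_ne_zero.mpr hn
  have h := hC n h1n
  rw [Nat.floor_natCast] at h
  calc ‖A n‖ ^ 2 ≤ ∑ m ∈ Finset.Icc 1 n, ‖A m‖ ^ 2 :=
        Finset.single_le_sum (f := fun m => ‖A m‖ ^ 2) (fun _ _ => by positivity)
          (Finset.mem_Icc.mpr ⟨Nat.one_le_iff_ne_zero.mpr hn, le_rfl⟩)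
    _ ≤ C * (n : ℝ) ^ (1 + ε) := h
    _ ≤ _ := by gcongr; exact le_max_left _ _

/-- A single term of the Rankin-Selberg sum gives A(p^k) ≪ p^{k(1+ε)/2}. So the local power series
has radius of convergence at least p^{-1/2}, far beyond the disc |z| < 1/p that corresponds to Re s
> 1. -/
theorem exists_summable_prime_pow (hL : IsLFunction A L d) {p : ℕ} (hp : p.Prime) {r : ℝ}
    (hr0 : 0 ≤ r) (hr : r * √p < 1) : Summable fun k : ℕ => ‖A (p ^ k)‖ * r ^ k := by
  have hp0 : (0 : ℝ) < p := by exact_mod_cast hp.pos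
  have hp1 : (1 : ℝ) < p := by exact_mod_cast hp.one_lt
  obtain ⟨ε, hε, hlt⟩ : ∃ ε : ℝ, 0 < ε ∧ r * (p : ℝ) ^ ((1 + ε) / 2) < 1 := by
    have hc : Tendsto (fun ε : ℝ => r * (p : ℝ) ^ ((1 + ε) / 2)) (𝓝[>] 0) (𝓝 (r * √p)) := by
      have : ContinuousAt (fun ε : ℝ => r * (p : ℝ) ^ ((1 + ε) / 2)) 0 := by
        refine ContinuousAt.mul continuousAt_const ?_
        exact ContinuousAt.rpow continuousAt_const (by fun_prop) (Or.inl hp0.ne')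
      have h2 := this.tendsto.mono_left (nhdsWithin_le_nhds (s := Set.Ioi 0))
      simpa [Real.sqrt_eq_rpow] using h2
    obtain ⟨ε, h1, h2⟩ := ((hc.eventually_lt_const hr).and self_mem_nhdsWithin).exists
    exact ⟨ε, h2, h1⟩
  obtain ⟨C, hC, hA⟩ := hL.norm_coeff_sq_le hε
  refine Summable.of_nonneg_of_le (fun k => by positivity) (fun k => ?_)
    ((summable_geometric_of_lt_one (by positivity) hlt).mul_left (√C))
  have h := hA (p ^ k) (pow_ne_zero _ hp.ne_zero)
  have h3 : ‖A (p ^ k)‖ ≤ √C * ((p : ℝ) ^ ((1 + ε) / 2)) ^ k := by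
    rw [← sq_le_sq₀ (norm_nonneg _) (by positivity), mul_pow, Real.sq_sqrt hC.le]
    refine h.trans_eq ?_
    congr 1
    push_cast
    rw [← Real.rpow_natCast, ← Real.rpow_natCast, ← Real.rpow_natCast, ← Real.rpow_mul hp0.le,
      ← Real.rpow_mul hp0.le, ← Real.rpow_mul hp0.le]
    congr 1; push_cast; ring
  calc ‖A (p ^ k)‖ * r ^ k ≤ √C * ((p : ℝ) ^ ((1 + ε) / 2)) ^ k * r ^ k := by gcongr
    _ = _ := by rw [mul_pow]; ring

theorem localFactor_eq_tsum_pow (A : ℕ → ℂ) (p : ℕ) (s : ℂ) :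
    localFactor A p s = ∑' k : ℕ, A (p ^ k) * ((p : ℂ) ^ (-s)) ^ k := by
  refine tsum_congr fun k => ?_
  rw [Nat.cast_pow, Complex.cpow_neg, inv_pow, div_eq_mul_inv, ← Complex.natCast_cpow_natCast_mul]
  congr 2
  rw [mul_comm, Complex.cpow_mul_nat]


/-- In z = p^{-s} the local identity reads Q(z)P(z) = 1 for 0 < |z| < 1/p, and it extends by the
identity theorem to the disc |z| < p^{-1/2} where P is holomorphic. At z = 0 it says A(1) = 1, and a
zero of Q in the disc is impossible. -/
theorem exists_roots (hL : IsLFunction A L d) {p : ℕ} (hp : p.Prime) :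
    A 1 = 1 ∧ ∃ α : Fin d → ℂ, (∀ i, ‖α i‖ ≤ √p) ∧ ∀ s : ℂ, 1 < s.re →
      (∏ i, (1 - α i * (p : ℂ) ^ (-s))) * localFactor A p s = 1 := by
  obtain ⟨α, hα⟩ := hL.local_polynomial p hp
  have hp0 : (0 : ℝ) < p := by exact_mod_cast hp.pos
  have hp1 : (1 : ℝ) < p := by exact_mod_cast hp.one_lt
  have hpc : (p : ℂ) ≠ 0 := by exact_mod_cast hp.ne_zero
  set ρ : ℝ := 1 / √p with hρ
  have hsq : 0 < √(p : ℝ) := Real.sqrt_pos.mpr hp0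
  have hρ0 : 0 < ρ := by positivity
  set P : ℂ → ℂ := fun z => ∑' k : ℕ, A (p ^ k) * z ^ k with hP
  set Q : ℂ → ℂ := fun z => ∏ i, (1 - α i * z) with hQ
  have hPd : DifferentiableOn ℂ P (Metric.ball 0 ρ) := by
    intro z hz
    obtain ⟨r, hzr, hrρ⟩ := exists_between (mem_ball_zero_iff.mp hz)
    have hr0 : 0 ≤ r := (norm_nonneg z).trans hzr.le
    have hs := hL.exists_summable_prime_pow hp hr0 (by
      calc r * √p < ρ * √p := by gcongr
        _ = 1 := by rw [hρ]; field_simp)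
    have h := Complex.differentiableOn_tsum_of_summable_norm (u := fun k : ℕ => ‖A (p ^ k)‖ * r ^ k)
      (F := fun k z => A (p ^ k) * z ^ k) (U := Metric.ball 0 r) hs (fun k => by fun_prop)
      Metric.isOpen_ball (fun k w hw => by
        rw [norm_mul, norm_pow]
        have := (mem_ball_zero_iff.mp hw).le
        gcongr)
    exact ((h z (mem_ball_zero_iff.mpr hzr)).differentiableAt
      (Metric.isOpen_ball.mem_nhds (mem_ball_zero_iff.mpr hzr))).differentiableWithinAt
  have hQd : Differentiable ℂ Q := by
    rw [hQ]; fun_prop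
  -- Any such z is p^{-s} with s = -log z / log p, and |z| < 1/p is exactly Re s > 1.
  have hone : ∀ z : ℂ, z ≠ 0 → ‖z‖ < 1 / p → Q z * P z = 1 := by
    intro z hz0 hz
    set s : ℂ := -(Complex.log z / Real.log p) with hs
    have hlp : 0 < Real.log p := Real.log_pos hp1
    have hzs : (p : ℂ) ^ (-s) = z := by
      rw [hs, neg_neg, Complex.cpow_def_of_ne_zero hpc, ← Complex.natCast_log,
        mul_div_cancel₀ _ (by exact_mod_cast hlp.ne'), Complex.exp_log hz0]
    have hsre : 1 < s.re := by
      rw [hs, Complex.neg_re, Complex.div_ofReal_re, Complex.log_re]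
      rw [lt_neg, div_lt_iff₀ hlp]
      calc Real.log ‖z‖ < Real.log (1 / p) := Real.log_lt_log (norm_pos_iff.mpr hz0) hz
        _ = _ := by rw [one_div, Real.log_inv]; ring
    have := hα s hsre
    rw [localFactor_eq_tsum_pow, hzs] at this
    exact this
  have hball : Set.EqOn (fun z => Q z * P z) (fun _ => 1) (Metric.ball 0 ρ) := by
    have hA : AnalyticOnNhd ℂ (fun z => Q z * P z) (Metric.ball 0 ρ) :=
      (hQd.differentiableOn.mul hPd).analyticOnNhd Metric.isOpen_ball
    refine hA.eqOn_of_preconnected_of_frequently_eq analyticOnNhd_const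
      (convex_ball _ _).isPreconnected (Metric.mem_ball_self hρ0) ?_
    apply Filter.Eventually.frequently
    have hm : Metric.ball (0 : ℂ) (1 / p) ∈ 𝓝[≠] (0 : ℂ) :=
      nhdsWithin_le_nhds (Metric.ball_mem_nhds _ (by positivity))
    filter_upwards [hm, self_mem_nhdsWithin] with z hz hz0
    exact hone z hz0 (mem_ball_zero_iff.mp hz)
  refine ⟨?_, α, fun i => ?_, hα⟩
  · have := hball (Metric.mem_ball_self hρ0)
    simp only [hQ, hP, mul_zero, sub_zero, Finset.prod_const_one, one_mul] at this
    rw [tsum_eq_single 0 (fun k hk => by simp [hk])] at this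
    simpa using this
  -- If |α_i| > √p then 1/α_i lies in the disc and is a zero of Q, contradicting QP = 1.
  · by_contra! hlt
    have hα0 : α i ≠ 0 := by
      intro h; rw [h, norm_zero] at hlt; linarith
    have := hball (x := (α i)⁻¹) (by
      rw [mem_ball_zero_iff, norm_inv, hρ, one_div]
      gcongr)
    have hz : Q (α i)⁻¹ = 0 := Finset.prod_eq_zero (Finset.mem_univ i) (by
      rw [mul_inv_cancel₀ hα0, sub_self])
    simp [hz] at this

theorem map_one (hL : IsLFunction A L d) : A 1 = 1 := (hL.exists_roots Nat.prime_two).1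

theorem lseriesSummable (hL : IsLFunction A L d) {s : ℂ} (hs : 1 < s.re) : LSeriesSummable A s :=
  (hL.dirichlet_series s hs).LSeriesSummable

theorem tsum_term_prime_pow (A : ℕ → ℂ) {p : ℕ} (hp : p.Prime) (s : ℂ) :
    ∑' k : ℕ, LSeries.term A s (p ^ k) = localFactor A p s :=
  tsum_congr fun k => by rw [LSeries.term_of_ne_zero (pow_ne_zero _ hp.ne_zero)]

/-- Both Dirichlet series have the same Euler product for Re s > 1, since only the values at prime
powers enter it. They therefore agree, and the coefficients of a convergent Dirichlet series are
unique. -/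
theorem eq_multExtension (hL : IsLFunction A L d) {n : ℕ} (hn : n ≠ 0) :
    A n = multExtension A n := by
  have hs : ∀ s : ℂ, 1 < s.re → LSeries A s = LSeries (multExtension A) s := by
    intro s hs
    have h := lseriesSummable_multExtension hL.map_one (hL.lseriesSummable hs)
    have hp := EulerProduct.eulerProduct_hasProd (f := LSeries.term (multExtension A) s)
      (by simp [LSeries.term, multExtension_one])
      (fun h => term_multExtension_mul s h) (summable_norm_iff.mpr h) (by simp)
    have he : (fun p : Nat.Primes => ∑' e, LSeries.term (multExtension A) s (p ^ e)) =
        fun p : Nat.Primes => localFactor A (p : ℕ) s := by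
      funext p
      rw [← tsum_term_prime_pow A p.2]
      exact tsum_congr fun k => term_multExtension_prime_pow hL.map_one s p.2 k
    rw [he] at hp
    rw [(hL.dirichlet_series s hs).LSeries_eq]
    exact (hL.euler_product s hs).unique hp
  have h2 : (1 : ℝ) < (2 : ℂ).re := by norm_num
  have hA := hL.lseriesSummable h2
  have hB := lseriesSummable_multExtension hL.map_one hA
  refine LSeries.eq_of_LSeries_eventually_eq ?_ ?_ ?_ hn
  · exact hA.abscissaOfAbsConv_le.trans_lt (EReal.coe_lt_top _)
  · exact hB.abscissaOfAbsConv_le.trans_lt (EReal.coe_lt_top _)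
  · filter_upwards [eventually_gt_atTop 1] with x hx
    exact hs x (by simpa using hx)

theorem map_mul_of_coprime (hL : IsLFunction A L d) {m n : ℕ} (h : m.Coprime n) (hm : m ≠ 0)
    (hn : n ≠ 0) : A (m * n) = A m * A n := by
  rw [hL.eq_multExtension (mul_ne_zero hm hn), hL.eq_multExtension hm, hL.eq_multExtension hn,
    multExtension_mul h]

/-- The Dirichlet series of `A` over integers coprime to `m` is `L` times finitely many inverse
local factors, which are bounded in `Re s ≥ 1/2`. -/
theorem exists_coprime_lseries (hL : IsLFunction A L d) {m : ℕ} (hm : m ≠ 0) :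
    ∃ g : ℂ → ℂ, Differentiable ℂ g ∧
      (∀ s : ℂ, 1 / 2 ≤ s.re → ‖g s‖ ≤ (2 : ℝ) ^ (d * m.primeFactors.card)) ∧
      ∀ s : ℂ, 1 < s.re →
        LSeriesHasSum (fun k => if k.Coprime m then A k else 0) s (L s * g s) := by
  choose! α hαb hα using fun (p : ℕ) (hp : p.Prime) => (hL.exists_roots hp).2
  set q : ℕ → ℂ → ℂ := fun p s => ∏ i, (1 - α p i * (p : ℂ) ^ (-s)) with hq
  have hprime : ∀ p ∈ m.primeFactors, p.Prime := fun p hp => Nat.prime_of_mem_primeFactors hp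
  refine ⟨fun s => ∏ p ∈ m.primeFactors, q p s, ?_, ?_, ?_⟩
  · refine Differentiable.fun_finsetProd fun p hp => ?_
    have hp0 : (p : ℂ) ≠ 0 := by exact_mod_cast (hprime p hp).ne_zero
    refine Differentiable.fun_finsetProd fun i _ => ?_
    refine (differentiable_const _).sub ((differentiable_const _).mul ?_)
    exact (differentiable_neg).const_cpow (Or.inl hp0)
  · intro s hs
    rw [norm_prod, pow_mul]
    calc ∏ p ∈ m.primeFactors, ‖q p s‖ ≤ ∏ p ∈ m.primeFactors, (2 : ℝ) ^ d := by
          refine Finset.prod_le_prod (fun _ _ => norm_nonneg _) fun p hp => ?_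
          have hp0 : 0 < p := (hprime p hp).pos
          have hp1 : (1 : ℝ) ≤ p := by exact_mod_cast hp0
          rw [hq, norm_prod]
          calc ∏ i, ‖1 - α p i * (p : ℂ) ^ (-s)‖ ≤ ∏ i : Fin d, (2 : ℝ) := by
                refine Finset.prod_le_prod (fun _ _ => norm_nonneg _) fun i _ => ?_
                -- On Re s ≥ 1/2 the factor p^{-1/2} compensates |α_i| ≤ √p, so each linear factor
                -- has modulus at most 2.
                have h1 : ‖(p : ℂ) ^ (-s)‖ ≤ (√p)⁻¹ := by
                  rw [Complex.norm_natCast_cpow_of_pos hp0, Real.sqrt_eq_rpow, ← Real.rpow_neg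
                    (by positivity)]
                  exact Real.rpow_le_rpow_of_exponent_le hp1 (by simpa using hs)
                have h2 : ‖α p i * (p : ℂ) ^ (-s)‖ ≤ 1 := by
                  rw [norm_mul]
                  calc _ ≤ √(p : ℝ) * (√(p : ℝ))⁻¹ := by
                        gcongr
                        exact hαb p (hprime p hp) i
                    _ = 1 := mul_inv_cancel₀ (by positivity)
                calc _ ≤ ‖(1 : ℂ)‖ + ‖α p i * (p : ℂ) ^ (-s)‖ := norm_sub_le _ _
                  _ ≤ 2 := by rw [norm_one]; linarith
            _ = 2 ^ d := by simp
      _ = _ := by rw [Finset.prod_const]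
  · intro s hs
    set f : ℕ → ℂ := fun k => if k.Coprime m then A k else 0 with hf
    have hsum : LSeriesSummable f s := by
      refine Summable.of_norm_bounded (hL.lseriesSummable hs).norm fun k => ?_
      apply LSeries.norm_term_le
      rw [hf]; simp only
      split_ifs <;> simp
    have hmul : ∀ {a b : ℕ}, a.Coprime b →
        LSeries.term f s (a * b) = LSeries.term f s a * LSeries.term f s b := by
      intro a b hab
      rcases eq_or_ne a 0 with rfl | ha
      · simp
      rcases eq_or_ne b 0 with rfl | hb
      · simp
      rw [LSeries.term_of_ne_zero (by positivity), LSeries.term_of_ne_zero ha,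
        LSeries.term_of_ne_zero hb, Nat.cast_mul, Complex.natCast_mul_natCast_cpow]
      simp only [hf, Nat.coprime_mul_iff_left, hL.map_mul_of_coprime hab ha hb]
      by_cases h1 : a.Coprime m
      · by_cases h2 : b.Coprime m
        · rw [if_pos ⟨h1, h2⟩, if_pos h1, if_pos h2]; ring
        · rw [if_neg fun h => h2 h.2, if_neg h2]; ring
      · rw [if_neg fun h => h1 h.1, if_neg h1]; ring
    have hp := EulerProduct.eulerProduct_hasProd (f := LSeries.term f s)
      (by simp [LSeries.term, hf, hL.map_one]) hmul (summable_norm_iff.mpr hsum) (by simp)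
    set c : Nat.Primes → ℂ := fun p => if (p : ℕ) ∈ m.primeFactors then q p s else 1 with hc
    have he : (fun p : Nat.Primes => ∑' e, LSeries.term f s (p ^ e)) =
        fun p : Nat.Primes => localFactor A (p : ℕ) s * c p := by
      funext p
      simp only [hc]
      -- For p dividing m only the term k = 0 survives, and 1 is the local factor times its inverse
      -- polynomial. For the other primes the local factor is unchanged.
      split_ifs with hpm
      · rw [mul_comm, hα p p.2 s hs, tsum_eq_single 0]
        · simp [LSeries.term, hf, hL.map_one]
        · intro k hk
          have : ¬ ((p : ℕ) ^ k).Coprime m := by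
            rw [Nat.coprime_pow_left_iff (Nat.pos_of_ne_zero hk), p.2.coprime_iff_not_dvd, not_not]
            exact Nat.dvd_of_mem_primeFactors hpm
          simp [LSeries.term, hf, this]
      · rw [mul_one, ← tsum_term_prime_pow A p.2]
        refine tsum_congr fun k => ?_
        have : ((p : ℕ) ^ k).Coprime m := by
          apply Nat.Coprime.pow_left
          rw [p.2.coprime_iff_not_dvd]
          exact fun h => hpm (Nat.mem_primeFactors.mpr ⟨p.2, h, hm⟩)
        rw [LSeries.term_of_ne_zero (pow_ne_zero _ p.2.ne_zero),
          LSeries.term_of_ne_zero (pow_ne_zero _ p.2.ne_zero)]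
        exact congrArg (· / _) (if_pos this)
    have hcp : HasProd c (∏ p ∈ m.primeFactors, q p s) := by
      have h1 : ∏ p ∈ m.primeFactors.subtype Nat.Prime, c p = ∏ p ∈ m.primeFactors, q p s := by
        rw [← Finset.prod_subtype_of_mem (fun p => q p s) hprime]
        refine Finset.prod_congr rfl fun p hp => ?_
        simp only [hc]
        rw [if_pos (Finset.mem_subtype.mp hp)]
      rw [← h1]
      refine hasProd_prod_of_ne_finset_one fun p hp => ?_
      simp only [hc]
      exact if_neg fun h => hp (Finset.mem_subtype.mpr h)
    rw [he] at hp
    have := hp.unique ((hL.euler_product s hs).mul hcp)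
    rw [← this]
    exact hsum.LSeriesHasSum

end IsLFunction

end

/-! ### Bounds for divisor weights -/

section

open Filter Topology

theorem two_pow_card_primeFactors_le_card_divisors {m : ℕ} (hm : m ≠ 0) :
    2 ^ m.primeFactors.card ≤ m.divisors.card := by
  rw [Nat.card_divisors hm, ← Finset.prod_const]
  refine Finset.prod_le_prod' fun p hp => ?_
  have : m.factorization p ≠ 0 := Finsupp.mem_support_iff.mp (by simpa using hp)
  omega

theorem exists_two_pow_mul_card_primeFactors_le (d : ℕ) {ε : ℝ} (hε : 0 < ε) :
    ∃ C : ℝ, 1 ≤ C ∧ ∀ m : ℕ, m ≠ 0 →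
      (2 : ℝ) ^ (d * m.primeFactors.card) ≤ C * (m : ℝ) ^ ε := by
  obtain ⟨C, hC, h⟩ := exists_card_divisors_le_mul_rpow (ε := ε / (d + 1)) (by positivity)
  refine ⟨C ^ d, one_le_pow₀ hC, fun m hm => ?_⟩
  have h1m : (1 : ℝ) ≤ m := by exact_mod_cast Nat.one_le_iff_ne_zero.mpr hm
  calc (2 : ℝ) ^ (d * m.primeFactors.card) = ((2 : ℝ) ^ m.primeFactors.card) ^ d := by
        rw [mul_comm, pow_mul]
    _ ≤ (m.divisors.card : ℝ) ^ d := by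
        gcongr; exact_mod_cast two_pow_card_primeFactors_le_card_divisors hm
    _ ≤ (C * (m : ℝ) ^ (ε / (d + 1))) ^ d := by gcongr; exact h m hm
    _ = C ^ d * (m : ℝ) ^ (ε / (d + 1) * d) := by
        rw [mul_pow, Real.rpow_mul (by positivity), Real.rpow_natCast]
    _ ≤ _ := by
        gcongr

        rw [div_mul_eq_mul_div, div_le_iff₀ (by positivity)]; nlinarith

/-- The divisor bound costs n^{ε/2}, another n^{ε/2} is borrowed, and the remaining series Σ |A(n)|²
n^{-1-ε/2} converges by the Rankin-Selberg bound with ε/4. The divisor weight comes from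
interchanging the sum over e with sums over multiples of e. -/
theorem IsLFunction.exists_sum_divisors_mul_norm_sq_div_le {A : ℕ → ℂ} {L : ℂ → ℂ} {d : ℕ}
    (hL : IsLFunction A L d) {ε : ℝ} (hε : 0 < ε) :
    ∃ C : ℝ, 1 ≤ C ∧ ∀ N : ℕ, 1 ≤ N →
      ∑ n ∈ Finset.Icc 1 N, (n.divisors.card : ℝ) * (‖A n‖ ^ 2 / n) ≤ C * (N : ℝ) ^ ε := by
  obtain ⟨C₁, hC₁, hd⟩ := exists_card_divisors_le_mul_rpow (ε := ε / 2) (by positivity)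
  have hs : LSeriesSummable (fun n => ((‖A n‖ ^ 2 : ℝ) : ℂ)) ((1 + ε / 2 : ℝ) : ℂ) := by
    refine LSeriesSummable_of_sum_norm_bigO_and_nonneg (r := 1 + ε / 4) (f := fun n => ‖A n‖ ^ 2)
      ?_ (fun _ => by positivity) (by positivity) (by rw [Complex.ofReal_re]; linarith)
    obtain ⟨C, hC⟩ := hL.rankin_selberg (ε / 4) (by positivity)
    refine Asymptotics.IsBigO.of_bound C ?_
    filter_upwards [eventually_ge_atTop 1] with n hn
    have := hC n (by exact_mod_cast hn)
    rw [Nat.floor_natCast] at this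
    rw [Real.norm_of_nonneg (Finset.sum_nonneg fun _ _ => by positivity),
      Real.norm_of_nonneg (by positivity)]
    exact this
  set S : ℝ := ∑' n, ‖LSeries.term (fun n => ((‖A n‖ ^ 2 : ℝ) : ℂ)) ((1 + ε / 2 : ℝ) : ℂ) n‖
    with hS
  have hS0 : 0 ≤ S := tsum_nonneg fun _ => norm_nonneg _
  refine ⟨C₁ * S + 1, by nlinarith, fun N hN => ?_⟩
  have hN0 : (0 : ℝ) ≤ (N : ℝ) ^ ε := by positivity
  calc ∑ n ∈ Finset.Icc 1 N, (n.divisors.card : ℝ) * (‖A n‖ ^ 2 / n)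
      ≤ ∑ n ∈ Finset.Icc 1 N, C₁ * (N : ℝ) ^ ε *
          ‖LSeries.term (fun n => ((‖A n‖ ^ 2 : ℝ) : ℂ)) ((1 + ε / 2 : ℝ) : ℂ) n‖ := by
        refine Finset.sum_le_sum fun n hn => ?_
        obtain ⟨h1, h2⟩ := Finset.mem_Icc.mp hn
        have hn0 : (0 : ℝ) < n := by exact_mod_cast h1
        have hnN : (n : ℝ) ≤ N := by exact_mod_cast h2
        rw [LSeries.term_of_ne_zero (by omega), norm_div, Complex.norm_natCast_cpow_of_pos h1,
          Complex.ofReal_re, Complex.norm_real, Real.norm_of_nonneg (by positivity),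
          Real.rpow_add hn0, Real.rpow_one]
        calc (n.divisors.card : ℝ) * (‖A n‖ ^ 2 / n)
            ≤ C₁ * (n : ℝ) ^ (ε / 2) * (‖A n‖ ^ 2 / n) := by gcongr; exact hd n (by omega)
          _ = C₁ * ((n : ℝ) ^ (ε / 2) * (n : ℝ) ^ (ε / 2)) *
              (‖A n‖ ^ 2 / (n * (n : ℝ) ^ (ε / 2))) := by field_simp
          _ = C₁ * (n : ℝ) ^ ε * (‖A n‖ ^ 2 / (n * (n : ℝ) ^ (ε / 2))) := by
              rw [← Real.rpow_add hn0, add_halves]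
          _ ≤ _ := by gcongr
    _ = C₁ * (N : ℝ) ^ ε * ∑ n ∈ Finset.Icc 1 N,
          ‖LSeries.term (fun n => ((‖A n‖ ^ 2 : ℝ) : ℂ)) ((1 + ε / 2 : ℝ) : ℂ) n‖ := by
        rw [Finset.mul_sum]
    _ ≤ C₁ * (N : ℝ) ^ ε * S := by
        gcongr
        exact Summable.sum_le_tsum _ (fun _ _ => norm_nonneg _) hs.norm
    _ ≤ _ := by nlinarith

end

/-! ### The Cauchy weight and the mean value theorem for Dirichlet polynomials -/

section

open MeasureTheory Complex FourierTransform

/-- Fourier inversion on `ℝ` with the kernel `e^{iwv}`. -/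
theorem integral_cexp_mul_of_fourier_eq {f g : ℝ → ℂ} (hc : Continuous f) (hf : Integrable f)
    (hg : Integrable g) (h : ∀ w : ℝ, ∫ v : ℝ, cexp (-(w * v * I)) * f v = g w) (v : ℝ) :
    ∫ w : ℝ, cexp (w * v * I) * g w = 2 * Real.pi * f v := by
  have hpi : (0 : ℝ) < 2 * Real.pi := by positivity
  have hF : 𝓕 f = fun w => g (w * (2 * Real.pi)) := by
    funext w
    rw [Real.fourier_real_eq_integral_exp_smul, ← h]
    refine integral_congr_ae (Filter.Eventually.of_forall fun x => ?_)
    simp only [smul_eq_mul]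
    congr 2
    push_cast; ring
  have hFi : Integrable (𝓕 f) := by
    rw [hF]; exact hg.comp_mul_right' hpi.ne'
  have hinv := congrFun (hc.fourierInv_fourier_eq hf hFi) v
  rw [Real.fourierInv_eq', hF] at hinv
  rw [← hinv]
  have := Measure.integral_comp_mul_right (fun w : ℝ => cexp (w * v * I) * g w) (2 * Real.pi)
  rw [abs_of_pos (by positivity), Complex.real_smul] at this
  have h2 : ∫ w : ℝ, cexp (w * v * I) * g w = 2 * Real.pi *
      ∫ w : ℝ, cexp ((w * (2 * Real.pi) : ℝ) * v * I) * g (w * (2 * Real.pi)) := by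
    have hpc : (2 * Real.pi : ℂ) ≠ 0 := by exact_mod_cast hpi.ne'
    rw [this, ofReal_inv, ofReal_mul, ofReal_ofNat, mul_inv_cancel_left₀ hpc]
  rw [h2]
  congr 1
  refine integral_congr_ae (Filter.Eventually.of_forall fun w => ?_)
  simp only [smul_eq_mul, RCLike.inner_apply, conj_trivial]
  congr 2
  push_cast; ring

theorem integrable_cexp_mul_exp_neg_mul_abs {a : ℝ} (ha : 0 < a) (w : ℝ) :
    Integrable fun v : ℝ => cexp (-(w * v * I)) * ((Real.exp (-a * |v|) : ℝ) : ℂ) := by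
  rw [← integrableOn_univ, ← Set.Iic_union_Ioi (a := (0 : ℝ))]
  refine IntegrableOn.union ?_ ?_
  · refine (integrableOn_exp_mul_complex_Iic (a := a - w * I) (by simpa using ha) 0).congr_fun
      (fun v hv => ?_) measurableSet_Iic
    simp only
    rw [abs_of_nonpos hv, ofReal_exp, ← Complex.exp_add]
    congr 1; push_cast; ring
  · refine (integrableOn_exp_mul_complex_Ioi (a := -a - w * I) (by simpa using ha) 0).congr_fun
      (fun v hv => ?_) measurableSet_Ioi
    simp only
    rw [abs_of_pos hv, ofReal_exp, ← Complex.exp_add]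
    congr 1; push_cast; ring

theorem integral_cexp_mul_exp_neg_mul_abs {a : ℝ} (ha : 0 < a) (w : ℝ) :
    ∫ v : ℝ, cexp (-(w * v * I)) * ((Real.exp (-a * |v|) : ℝ) : ℂ) =
      ((2 * a / (a ^ 2 + w ^ 2) : ℝ) : ℂ) := by
  rw [← setIntegral_univ, ← Set.Iic_union_Ioi (a := (0 : ℝ)),
    setIntegral_union (by simp) measurableSet_Ioi
      (integrable_cexp_mul_exp_neg_mul_abs ha w).integrableOn
      (integrable_cexp_mul_exp_neg_mul_abs ha w).integrableOn]
  have e1 : ∫ v : ℝ in Set.Iic 0, cexp (-(w * v * I)) * ((Real.exp (-a * |v|) : ℝ) : ℂ) =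
      1 / (a - w * I) := by
    have := integral_exp_mul_complex_Iic (a := a - w * I) (by simpa using ha) 0
    rw [ofReal_zero, mul_zero, Complex.exp_zero] at this
    rw [← this]
    refine setIntegral_congr_fun measurableSet_Iic fun v hv => ?_
    rw [abs_of_nonpos hv, ofReal_exp, ← Complex.exp_add]
    congr 1; push_cast; ring
  have e2 : ∫ v : ℝ in Set.Ioi 0, cexp (-(w * v * I)) * ((Real.exp (-a * |v|) : ℝ) : ℂ) =
      1 / (a + w * I) := by
    have := integral_exp_mul_complex_Ioi (a := -a - w * I) (by simpa using ha) 0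
    rw [ofReal_zero, mul_zero, Complex.exp_zero, neg_div, ← div_neg] at this
    have h3 : -(-(a : ℂ) - w * I) = a + w * I := by ring
    rw [h3] at this
    rw [← this]
    refine setIntegral_congr_fun measurableSet_Ioi fun v hv => ?_
    rw [abs_of_pos hv, ofReal_exp, ← Complex.exp_add]
    congr 1; push_cast; ring
  rw [e1, e2]
  have h1 : (a : ℂ) - w * I ≠ 0 := fun h => ha.ne' (by simpa using congrArg re h)
  have h2 : (a : ℂ) + w * I ≠ 0 := fun h => ha.ne' (by simpa using congrArg re h)
  have h3 : ((a : ℂ) - w * I) * (a + w * I) = a ^ 2 + w ^ 2 := by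
    ring_nf; rw [I_sq]; ring
  push_cast
  rw [← h3]
  field_simp
  ring

theorem integrable_inv_sq_add_sq {a : ℝ} (ha : 0 < a) :
    Integrable fun t : ℝ => 1 / (a ^ 2 + t ^ 2) := by
  have h := (integrable_inv_one_add_sq.comp_div ha.ne').const_mul (1 / a ^ 2)
  refine h.congr (Filter.Eventually.of_forall fun t => ?_)
  simp only
  field_simp

/-- Fourier inversion of the elementary transform of exp(-a|v|). The Cauchy weight is used because
its transform is positive and exponentially decaying, which makes mean values explicit quadratic
forms. -/
theorem integral_cexp_div_sq_add_sq {a : ℝ} (ha : 0 < a) (y : ℝ) :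
    ∫ t : ℝ, cexp (t * y * I) / ((a ^ 2 + t ^ 2 : ℝ) : ℂ) =
      ((Real.pi / a * Real.exp (-a * |y|) : ℝ) : ℂ) := by
  have hi := integral_cexp_mul_of_fourier_eq (f := fun v => ((Real.exp (-a * |v|) : ℝ) : ℂ))
    (by fun_prop) (by simpa using integrable_cexp_mul_exp_neg_mul_abs ha 0)
    (by
      have := ((integrable_inv_sq_add_sq ha).const_mul (2 * a)).ofReal (𝕜 := ℂ)
      refine this.congr (Filter.Eventually.of_forall fun t => ?_)
      simp only
      rw [mul_one_div]; rfl)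
    (integral_cexp_mul_exp_neg_mul_abs ha) y
  have ha' : (a : ℂ) ≠ 0 := by exact_mod_cast ha.ne'
  have : ∫ t : ℝ, cexp (t * y * I) / ((a ^ 2 + t ^ 2 : ℝ) : ℂ) = (1 / (2 * a)) *
      ∫ t : ℝ, cexp (t * y * I) * ((2 * a / (a ^ 2 + t ^ 2) : ℝ) : ℂ) := by
    rw [← integral_const_mul]
    refine integral_congr_ae (Filter.Eventually.of_forall fun t => ?_)
    simp only
    push_cast
    field_simp
  rw [this, hi]
  push_cast
  field_simp

theorem integrable_div_sq_add_sq {a : ℝ} (ha : 0 < a) {f : ℝ → ℂ} (hf : Continuous f) {C : ℝ}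
    (hC : ∀ t, ‖f t‖ ≤ C) : Integrable fun t : ℝ => f t / ((a ^ 2 + t ^ 2 : ℝ) : ℂ) := by
  refine ((integrable_inv_sq_add_sq ha).const_mul C).mono' ?_ (Filter.Eventually.of_forall fun t => ?_)
  · refine (hf.div (by fun_prop) fun t => ?_).aestronglyMeasurable
    have : a ^ 2 + t ^ 2 ≠ 0 := by positivity
    exact_mod_cast this
  · rw [norm_div, norm_real, Real.norm_of_nonneg (by positivity), mul_one_div]
    gcongr
    exact hC t

/-- The mean value of an exponential polynomial against the Cauchy weight, as a quadratic form. -/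
theorem integral_norm_sq_expPoly_div {ι : Type*} (s : Finset ι) (b : ι → ℂ) (l : ι → ℝ) {a : ℝ}
    (ha : 0 < a) :
    ((∫ t : ℝ, ‖∑ i ∈ s, b i * cexp (-(t * l i * I))‖ ^ 2 / (a ^ 2 + t ^ 2) : ℝ) : ℂ) =
      ∑ i ∈ s, ∑ j ∈ s, b i * (starRingEnd ℂ) (b j) *
        ((Real.pi / a * Real.exp (-a * |l i - l j|) : ℝ) : ℂ) := by
  have hint : ∀ i j, Integrable fun t : ℝ => b i * (starRingEnd ℂ) (b j) *
      (cexp (t * (l j - l i : ℝ) * I) / ((a ^ 2 + t ^ 2 : ℝ) : ℂ)) := by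
    intro i j
    refine Integrable.const_mul (integrable_div_sq_add_sq ha (C := 1) (by fun_prop) fun t => ?_) _
    rw [← ofReal_mul, norm_exp_ofReal_mul_I]
  rw [← integral_complex_ofReal]
  have he : ∀ t : ℝ, ((‖∑ i ∈ s, b i * cexp (-(t * l i * I))‖ ^ 2 / (a ^ 2 + t ^ 2) : ℝ) : ℂ) =
      ∑ i ∈ s, ∑ j ∈ s, b i * (starRingEnd ℂ) (b j) *
      (cexp (t * (l j - l i : ℝ) * I) / ((a ^ 2 + t ^ 2 : ℝ) : ℂ)) := by
    intro t
    rw [ofReal_div, ofReal_pow, ← mul_conj', map_sum, Finset.sum_mul_sum, Finset.sum_div]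
    refine Finset.sum_congr rfl fun i _ => ?_
    rw [Finset.sum_div]
    refine Finset.sum_congr rfl fun j _ => ?_
    rw [map_mul, ← exp_conj]
    have : (starRingEnd ℂ) (-(t * l j * I)) = t * l j * I := by simp
    rw [this, ← mul_div_assoc]
    congr 1
    have h2 : cexp (t * (l j - l i : ℝ) * I) = cexp (-(t * l i * I)) * cexp (t * l j * I) := by
      rw [← Complex.exp_add]; congr 1; push_cast; ring
    rw [h2]; ring
  simp_rw [he]
  rw [integral_finsetSum _ fun i _ => integrable_finsetSum _ fun j _ => hint i j]
  refine Finset.sum_congr rfl fun i _ => ?_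
  rw [integral_finsetSum _ fun j _ => hint i j]
  refine Finset.sum_congr rfl fun j _ => ?_
  rw [integral_const_mul, integral_cexp_div_sq_add_sq ha, abs_sub_comm]

/-- Telescoping: each term is at most the decrease of exp(-rh)/r over one step, because r + 1 ≤ exp
r. -/
theorem sum_exp_neg_mul_Icc_le {r : ℝ} (hr : 0 < r) (n : ℕ) :
    ∑ h ∈ Finset.Icc 1 n, Real.exp (-r * h) ≤ 1 / r := by
  have key : ∑ h ∈ Finset.Icc 1 n, Real.exp (-r * h) ≤ (1 - Real.exp (-r * n)) / r := by
    induction n with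
    | zero => simp
    | succ n ih =>
      rw [Finset.sum_Icc_succ_top (by omega)]
      have h1 : Real.exp (-r * n) = Real.exp (-r * (n + 1 : ℕ)) * Real.exp r := by
        rw [← Real.exp_add]; congr 1; push_cast; ring
      have h2 : r + 1 ≤ Real.exp r := Real.add_one_le_exp r
      have h3 := Real.exp_pos (-r * (n + 1 : ℕ))
      calc _ ≤ (1 - Real.exp (-r * n)) / r + Real.exp (-r * (n + 1 : ℕ)) := by gcongr
        _ ≤ _ := by
          rw [div_add' _ _ _ hr.ne']
          gcongr
          rw [h1]
          nlinarith
  refine key.trans ?_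
  gcongr
  linarith [Real.exp_pos (-r * n)]

theorem sum_exp_neg_mul_le_of_injOn {r : ℝ} (hr : 0 < r) {ι : Type*} (S : Finset ι) (f : ι → ℝ)
    (g : ι → ℕ) (hg : Set.InjOn g S) (h0 : ∀ i ∈ S, g i ≠ 0) (hf : ∀ i ∈ S, f i = g i) :
    ∑ i ∈ S, Real.exp (-r * f i) ≤ 1 / r := by
  classical
  calc ∑ i ∈ S, Real.exp (-r * f i) = ∑ h ∈ S.image g, Real.exp (-r * h) := by
        rw [Finset.sum_image hg]
        exact Finset.sum_congr rfl fun i hi => by rw [hf i hi]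
    _ ≤ ∑ h ∈ Finset.Icc 1 (S.sup g), Real.exp (-r * h) := by
        refine Finset.sum_le_sum_of_subset_of_nonneg (fun h hh => ?_) fun _ _ _ => (Real.exp_pos _).le
        obtain ⟨i, hi, rfl⟩ := Finset.mem_image.mp hh
        exact Finset.mem_Icc.mpr ⟨Nat.pos_of_ne_zero (h0 i hi), Finset.le_sup hi⟩
    _ ≤ _ := sum_exp_neg_mul_Icc_le hr _

theorem sum_exp_neg_mul_abs_sub_le {r : ℝ} (hr : 0 < r) (N m : ℕ) :
    ∑ n ∈ Finset.Icc 1 N, Real.exp (-r * |(m : ℝ) - n|) ≤ 1 + 2 / r := by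
  have h1 : ∑ n ∈ (Finset.Icc 1 N).filter (m < ·), Real.exp (-r * |(m : ℝ) - n|) ≤ 1 / r := by
    refine sum_exp_neg_mul_le_of_injOn hr _ _ (fun n => n - m) (fun a ha b hb hab => ?_)
      (fun n hn => ?_) fun n hn => ?_
    · have := (Finset.mem_filter.mp ha).2; have := (Finset.mem_filter.mp hb).2
      simp only at hab; omega
    · have := (Finset.mem_filter.mp hn).2; omega
    · have := (Finset.mem_filter.mp hn).2
      have h' : (m : ℝ) < n := by exact_mod_cast this
      rw [Nat.cast_sub this.le, abs_sub_comm, abs_of_nonneg (by linarith)]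
  have h2 : ∑ n ∈ (Finset.Icc 1 N).filter (¬ m < ·), Real.exp (-r * |(m : ℝ) - n|) ≤ 1 + 1 / r := by
    rw [← Finset.sum_filter_add_sum_filter_not _ (fun n => n = m)]
    gcongr
    · refine (Finset.sum_le_card_nsmul _ _ 1 fun n _ => ?_).trans ?_
      · rw [Real.exp_le_one_iff]; nlinarith [abs_nonneg ((m : ℝ) - n)]
      · rw [nsmul_eq_mul, mul_one, Nat.cast_le_one, Finset.card_le_one]
        intro a ha b hb
        rw [(Finset.mem_filter.mp ha).2, (Finset.mem_filter.mp hb).2]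
    · refine sum_exp_neg_mul_le_of_injOn hr _ _ (fun n => m - n) (fun a ha b hb hab => ?_)
        (fun n hn => ?_) fun n hn => ?_
      · simp only [Finset.coe_filter, Finset.mem_filter, Set.mem_ofPred_eq] at ha hb
        simp only at hab; omega
      · simp only [Finset.mem_filter] at hn; omega
      · simp only [Finset.mem_filter] at hn
        have h3 : n ≤ m := by omega
        have h' : (n : ℝ) ≤ m := by exact_mod_cast h3
        rw [Nat.cast_sub h3, abs_of_nonneg (by linarith)]
  rw [← Finset.sum_filter_add_sum_filter_not _ (fun n => m < n)]
  calc _ ≤ 1 / r + (1 + 1 / r) := add_le_add h1 h2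
    _ = _ := by ring

/-- Converts decay in log n - log m into decay in (n - m)/N, so that a row of the quadratic form
becomes a geometric-type sum over integers. -/
theorem abs_sub_div_le_abs_log_sub_log {x y N : ℝ} (hx : 0 < x) (hy : 0 < y) (hxN : x ≤ N)
    (hyN : y ≤ N) : |x - y| / N ≤ |Real.log x - Real.log y| := by
  wlog h : y ≤ x generalizing x y
  · rw [abs_sub_comm, abs_sub_comm (Real.log x)]
    exact this hy hx hyN hxN (le_of_not_ge h)
  rw [abs_of_nonneg (by linarith), abs_of_nonneg (by linarith [Real.log_le_log hy h]),
    ← Real.log_div hx.ne' hy.ne']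
  calc (x - y) / N ≤ (x - y) / x := by
        apply div_le_div_of_nonneg_left _ hx hxN; linarith
    _ = 1 - (x / y)⁻¹ := by rw [inv_div]; field_simp
    _ ≤ _ := Real.one_sub_inv_le_log_of_pos (by positivity)

/-- Mean value theorem for Dirichlet polynomials against the Cauchy weight; frequencies may be
repeated up to `D` times. -/
theorem integral_norm_sq_dirichletPoly_div_le {ι : Type*} (s : Finset ι) (b : ι → ℂ) (ν : ι → ℕ)
    {a : ℝ} (ha : 0 < a) {N : ℕ} (hN : 1 ≤ N) (hν : ∀ i ∈ s, 1 ≤ ν i ∧ ν i ≤ N) {D : ℝ}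
    (hD : ∀ n ∈ Finset.Icc 1 N, ((s.filter fun i => ν i = n).card : ℝ) ≤ D) :
    ∫ t : ℝ, ‖∑ i ∈ s, b i * cexp (-(t * Real.log (ν i) * I))‖ ^ 2 / (a ^ 2 + t ^ 2) ≤
      Real.pi / a * (D * (1 + 2 * N / a)) * ∑ i ∈ s, ‖b i‖ ^ 2 := by
  have hN0 : (0 : ℝ) < N := by exact_mod_cast hN
  have hD0 : 0 ≤ D := le_trans (Nat.cast_nonneg _) (hD 1 (Finset.mem_Icc.mpr ⟨le_rfl, hN⟩))
  set E : ι → ι → ℝ := fun i j => Real.exp (-a * |Real.log (ν i) - Real.log (ν j)|) with hE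
  have hE0 : ∀ i j, 0 ≤ E i j := fun i j => (Real.exp_pos _).le
  -- Schur test: the kernel is positive and symmetric, so 2|b_i b_j| ≤ |b_i|² + |b_j|² reduces the
  -- form to a bound for its row sums. Grouping the row by the value of ν costs the multiplicity D.
  have hrow : ∀ i ∈ s, ∑ j ∈ s, E i j ≤ D * (1 + 2 * N / a) := by
    intro i hi
    calc ∑ j ∈ s, E i j ≤ ∑ j ∈ s, Real.exp (-(a / N) * |(ν i : ℝ) - ν j|) := by
          refine Finset.sum_le_sum fun j hj => Real.exp_le_exp.mpr ?_
          have := abs_sub_div_le_abs_log_sub_log (x := ν i) (y := ν j) (N := N)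
            (by exact_mod_cast (hν i hi).1) (by exact_mod_cast (hν j hj).1)
            (by exact_mod_cast (hν i hi).2) (by exact_mod_cast (hν j hj).2)
          calc _ ≤ -a * (|(ν i : ℝ) - ν j| / N) := by
                rw [neg_mul, neg_mul]; gcongr
            _ = _ := by ring
      _ = ∑ n ∈ Finset.Icc 1 N, ∑ j ∈ s.filter (fun j => ν j = n),
            Real.exp (-(a / N) * |(ν i : ℝ) - ν j|) :=
          (Finset.sum_fiberwise_of_maps_to (fun j hj => Finset.mem_Icc.mpr (hν j hj)) _).symm
      _ ≤ ∑ n ∈ Finset.Icc 1 N, D * Real.exp (-(a / N) * |(ν i : ℝ) - n|) := by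
          refine Finset.sum_le_sum fun n hn => ?_
          rw [Finset.sum_congr rfl fun j hj => by rw [(Finset.mem_filter.mp hj).2],
            Finset.sum_const, nsmul_eq_mul]
          gcongr
          exact hD n hn
      _ = D * ∑ n ∈ Finset.Icc 1 N, Real.exp (-(a / N) * |(ν i : ℝ) - n|) := by
          rw [Finset.mul_sum]
      _ ≤ D * (1 + 2 / (a / N)) := by
          gcongr
          exact sum_exp_neg_mul_abs_sub_le (by positivity) N (ν i)
      _ = _ := by rw [div_div_eq_mul_div]
  have hquad := integral_norm_sq_expPoly_div s b (fun i => Real.log (ν i)) ha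
  have hsymm : ∀ i j, E i j = E j i := fun i j => by simp only [hE]; rw [abs_sub_comm]
  calc _ ≤ ‖((∫ t : ℝ, ‖∑ i ∈ s, b i * cexp (-(t * Real.log (ν i) * I))‖ ^ 2 /
          (a ^ 2 + t ^ 2) : ℝ) : ℂ)‖ := by rw [norm_real]; exact Real.le_norm_self _
    _ ≤ ∑ i ∈ s, ∑ j ∈ s, Real.pi / a * ((‖b i‖ ^ 2 * E i j + ‖b j‖ ^ 2 * E i j) / 2) := by
        rw [hquad]
        refine (norm_sum_le _ _).trans (Finset.sum_le_sum fun i _ => (norm_sum_le _ _).trans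
          (Finset.sum_le_sum fun j _ => ?_))
        rw [norm_mul, norm_mul, RCLike.norm_conj, norm_real, Real.norm_of_nonneg (by positivity)]
        have h1 : ‖b i‖ * ‖b j‖ ≤ (‖b i‖ ^ 2 + ‖b j‖ ^ 2) / 2 := by
          nlinarith [sq_nonneg (‖b i‖ - ‖b j‖)]
        calc _ ≤ (‖b i‖ ^ 2 + ‖b j‖ ^ 2) / 2 * (Real.pi / a * E i j) := by
              simp only [hE]; gcongr
          _ = _ := by ring
    _ = Real.pi / a * ∑ i ∈ s, ‖b i‖ ^ 2 * ∑ j ∈ s, E i j := by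
        have e1 : ∑ i ∈ s, ∑ j ∈ s, ‖b j‖ ^ 2 * E i j = ∑ i ∈ s, ∑ j ∈ s, ‖b i‖ ^ 2 * E i j := by
          rw [Finset.sum_comm]
          simp_rw [hsymm]
        simp_rw [← Finset.mul_sum, ← Finset.sum_div, Finset.sum_add_distrib]
        rw [e1]
        simp_rw [← Finset.mul_sum]
        ring
    _ ≤ Real.pi / a * ∑ i ∈ s, ‖b i‖ ^ 2 * (D * (1 + 2 * N / a)) := by
        gcongr with i hi
        exact hrow i hi
    _ = _ := by rw [← Finset.sum_mul]; ring

end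

/-! ### From short windows to the Cauchy-weighted mean square -/

section

open MeasureTheory Complex

/-- The truncated power `(ν/y)^c` for `ν ≤ y`, and `0` for `y < ν`. -/
noncomputable def truncPow (c ν y : ℝ) : ℝ := if ν ≤ y then (ν / y) ^ c else 0

theorem truncPow_nonneg {c ν y : ℝ} (hν : 0 < ν) : 0 ≤ truncPow c ν y := by
  unfold truncPow
  split_ifs with h
  · have : 0 < y := hν.trans_le h
    positivity
  · exact le_rfl

theorem truncPow_le_one {c ν y : ℝ} (hc : 0 < c) (hν : 0 < ν) : truncPow c ν y ≤ 1 := by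
  unfold truncPow
  split_ifs with h
  · have : 0 < y := hν.trans_le h
    exact Real.rpow_le_one (by positivity) ((div_le_one this).mpr h) hc.le
  · exact zero_le_one

theorem measurable_truncPow (c ν : ℝ) : Measurable (truncPow c ν) := by
  unfold truncPow
  exact Measurable.ite measurableSet_Ici (by fun_prop) measurable_const

theorem integral_div_rpow_div {c ν a b : ℝ} (hc : 0 < c) (hν : 0 < ν) (ha : 0 < a) (hab : a ≤ b) :
    ∫ y in a..b, (ν / y) ^ c / y = ((ν / a) ^ c - (ν / b) ^ c) / c := by
  have hpos : ∀ y ∈ Set.uIcc a b, 0 < y := fun y hy => by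
    rw [Set.uIcc_of_le hab] at hy; exact ha.trans_le hy.1
  have hd : ∀ y ∈ Set.uIcc a b, HasDerivAt (fun y => -(ν / y) ^ c / c) ((ν / y) ^ c / y) y := by
    intro y hy
    have hy0 := hpos y hy
    have h1 : HasDerivAt (fun y => ν / y) (-ν / y ^ 2) y := by
      have := (hasDerivAt_const y ν).fun_div (hasDerivAt_id y) hy0.ne'
      simpa using this
    have h2 := ((h1.rpow_const (p := c) (Or.inl (by positivity))).neg).div_const c
    refine h2.congr_deriv ?_
    rw [Real.rpow_sub_one (by positivity)]
    field_simp
  rw [intervalIntegral.integral_eq_sub_of_hasDerivAt hd]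
  · ring
  · refine ContinuousOn.intervalIntegrable fun y hy => ?_
    have hy0 := hpos y hy
    refine ContinuousAt.continuousWithinAt ?_
    have h1 : ContinuousAt (fun y => ν / y) y := continuousAt_const.div continuousAt_id hy0.ne'
    exact (h1.rpow_const (Or.inl (by positivity))).div continuousAt_id hy0.ne'

theorem intervalIntegrable_truncPow_div {c ν x y : ℝ} (hc : 0 < c) (hν : 0 < ν) (hx : 0 < x)
    (hxy : x ≤ y) : IntervalIntegrable (fun u => truncPow c ν u / u) volume x y := by
  rw [intervalIntegrable_iff_integrableOn_Ioc_of_le hxy]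
  refine Measure.integrableOn_of_bounded (M := 1 / x) (by simp) ?_ ?_
  · exact ((measurable_truncPow c ν).div measurable_id).aestronglyMeasurable
  · filter_upwards [ae_restrict_mem measurableSet_Ioc] with u hu
    have hu0 : 0 < u := hx.trans hu.1
    rw [Real.norm_of_nonneg (div_nonneg (truncPow_nonneg hν) hu0.le)]
    exact div_le_div₀ zero_le_one (truncPow_le_one hc hν) hx hu.1.le

/-- The indicator function of a window, recovered from the truncated power. -/
theorem indicator_eq_truncPow {c ν x H : ℝ} (hc : 0 < c) (hν : 0 < ν) (hx : 0 < x) (hH : 0 ≤ H) :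
    (if x < ν ∧ ν ≤ x + H then (1 : ℝ) else 0) =
      truncPow c ν (x + H) - truncPow c ν x + c * ∫ y in x..x + H, truncPow c ν y / y := by
  have hle : x ≤ x + H := by linarith
  rcases le_or_gt ν x with h1 | h1
  · have : ∫ y in x..x + H, truncPow c ν y / y = ∫ y in x..x + H, (ν / y) ^ c / y := by
      refine intervalIntegral.integral_congr fun y hy => ?_
      rw [Set.uIcc_of_le hle] at hy
      simp only [truncPow, if_pos (h1.trans hy.1)]
    rw [this, integral_div_rpow_div hc hν hx hle, if_neg (by simp [h1]), truncPow, truncPow,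
      if_pos (by linarith), if_pos h1]
    field_simp; ring
  rcases le_or_gt ν (x + H) with h2 | h2
  · have e1 : ∫ y in x..ν, truncPow c ν y / y = 0 := by
      rw [intervalIntegral.integral_of_le h1.le, integral_Ioc_eq_integral_Ioo]
      refine setIntegral_eq_zero_of_forall_eq_zero fun y hy => ?_
      simp [truncPow, not_le.mpr hy.2]
    have e2 : ∫ y in ν..x + H, truncPow c ν y / y = ∫ y in ν..x + H, (ν / y) ^ c / y := by
      refine intervalIntegral.integral_congr fun y hy => ?_
      rw [Set.uIcc_of_le h2] at hy
      simp only [truncPow, if_pos hy.1]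
    rw [← intervalIntegral.integral_add_adjacent_intervals
      (intervalIntegrable_truncPow_div hc hν hx h1.le) (intervalIntegrable_truncPow_div hc hν hν h2),
      e1, e2, integral_div_rpow_div hc hν hν h2, if_pos ⟨h1, h2⟩, truncPow, truncPow, if_pos h2,
      if_neg (not_le.mpr h1), div_self hν.ne', Real.one_rpow]
    field_simp; ring
  · have e1 : ∫ y in x..x + H, truncPow c ν y / y = 0 := by
      rw [intervalIntegral.integral_of_le hle]
      refine setIntegral_eq_zero_of_forall_eq_zero fun y hy => ?_
      simp [truncPow, not_le.mpr (hy.2.trans_lt h2)]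
    rw [e1, if_neg (by simp [h2]), truncPow, truncPow, if_neg (not_le.mpr h2),
      if_neg (not_le.mpr h1)]
    ring

/-- The integrand is (νμ)^c y^{-2c-2} beyond max(ν, μ) and zero before it. Up to the factor 2π and
the square roots, the value is the kernel of `integral_cexp_div_sq_add_sq` at a = c + 1/2. -/
theorem integrableOn_truncPow_mul {c ν μ : ℝ} (hc : 0 < c) (hν : 0 < ν) (hμ : 0 < μ) :
    IntegrableOn (fun y => truncPow c ν y * truncPow c μ y / y ^ 2) (Set.Ioi 0) ∧
    ∫ y in Set.Ioi 0, truncPow c ν y * truncPow c μ y / y ^ 2 =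
      (Real.sqrt ν)⁻¹ * (Real.sqrt μ)⁻¹ *
        (Real.exp (-(c + 1 / 2) * |Real.log ν - Real.log μ|) / (2 * (c + 1 / 2))) := by
  wlog h : μ ≤ ν generalizing ν μ
  · have := this hμ hν (le_of_not_ge h)
    simp_rw [mul_comm (truncPow c ν _)]
    rw [abs_sub_comm, mul_comm (√ν)⁻¹]
    exact this
  have heq : Set.EqOn (fun y => truncPow c ν y * truncPow c μ y / y ^ 2)
      (Set.indicator (Set.Ici ν) fun y => (ν * μ) ^ c * y ^ (-2 * c - 2)) (Set.Ioi 0) := by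
    intro y hy
    have hy0 : (0 : ℝ) < y := hy
    by_cases hνy : ν ≤ y
    · rw [Set.indicator_of_mem (by exact hνy)]
      simp only [truncPow, if_pos hνy, if_pos (h.trans hνy)]
      rw [Real.div_rpow hν.le hy0.le, Real.div_rpow hμ.le hy0.le, Real.mul_rpow hν.le hμ.le,
        Real.rpow_sub hy0, neg_mul, Real.rpow_neg hy0.le, two_mul, Real.rpow_add hy0,
        Real.rpow_two]
      field_simp
    · rw [Set.indicator_of_notMem (by exact hνy)]
      simp [truncPow, hνy]
  have hsub : Set.Ici ν ⊆ Set.Ioi 0 := fun y hy => hν.trans_le hy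
  have hexp : -2 * c - 2 < -1 := by linarith
  refine ⟨?_, ?_⟩
  · rw [integrableOn_congr_fun heq measurableSet_Ioi]
    refine Integrable.integrableOn ?_
    rw [integrable_indicator_iff measurableSet_Ici, integrableOn_Ici_iff_integrableOn_Ioi]
    exact (integrableOn_Ioi_rpow_of_lt hexp hν).const_mul _
  · rw [setIntegral_congr_fun measurableSet_Ioi heq, setIntegral_indicator measurableSet_Ici,
      Set.inter_eq_self_of_subset_right hsub, integral_Ici_eq_integral_Ioi, integral_const_mul,
      integral_Ioi_rpow_of_lt hexp hν, abs_of_nonneg (by linarith [Real.log_le_log hμ h]),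
      Real.mul_rpow hν.le hμ.le, Real.rpow_def_of_pos hν, Real.rpow_def_of_pos hμ,
      Real.rpow_def_of_pos hν, Real.sqrt_eq_rpow, Real.sqrt_eq_rpow, Real.rpow_def_of_pos hν,
      Real.rpow_def_of_pos hμ, ← Real.exp_neg, ← Real.exp_neg]
    have h3 : -2 * c - 2 + 1 = -(2 * (c + 1 / 2)) := by ring
    rw [h3, neg_div_neg_eq, ← mul_div_assoc, ← mul_div_assoc, ← Real.exp_add, ← Real.exp_add,
      ← Real.exp_add, ← Real.exp_add]
    congr 2
    ring

/-- Nonnegativity of the variance of f about its mean m. -/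
theorem sq_intervalIntegral_le {f : ℝ → ℝ} {a b : ℝ} (hab : a ≤ b)
    (hf : IntervalIntegrable f volume a b) (hf2 : IntervalIntegrable (fun x => f x ^ 2) volume a b) :
    (∫ x in a..b, f x) ^ 2 ≤ (b - a) * ∫ x in a..b, f x ^ 2 := by
  rcases hab.eq_or_lt with rfl | hlt
  · simp
  set m : ℝ := (∫ x in a..b, f x) / (b - a) with hm
  have hba : 0 < b - a := by linarith
  have h0 : 0 ≤ ∫ x in a..b, (f x - m) ^ 2 :=
    intervalIntegral.integral_nonneg hab fun _ _ => sq_nonneg _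
  have h1 : ∫ x in a..b, (f x - m) ^ 2 =
      (∫ x in a..b, f x ^ 2) - 2 * m * (∫ x in a..b, f x) + m ^ 2 * (b - a) := by
    have : ∀ x, (f x - m) ^ 2 = f x ^ 2 - 2 * m * f x + m ^ 2 := fun x => by ring
    simp_rw [this]
    rw [intervalIntegral.integral_add (hf2.sub (hf.const_mul _)) (by simp),
      intervalIntegral.integral_sub hf2 (hf.const_mul _), intervalIntegral.integral_const_mul,
      intervalIntegral.integral_const, smul_eq_mul]
    ring
  have h2 : ∫ x in a..b, f x = m * (b - a) := by rw [hm]; field_simp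
  rw [h1, h2] at h0
  rw [h2]
  nlinarith

/-- Integrating a nonnegative function over a sliding window. -/
theorem integral_sliding_window_le {q : ℝ → ℝ} (hq : Integrable q) (hq0 : ∀ y, 0 ≤ q y) {X Y H : ℝ}
    (hXY : X ≤ Y) (hH : 0 ≤ H) :
    ∫ x in X..Y, ∫ y in x..x + H, q y ≤ H * ∫ y, q y := by
  set Q : ℝ → ℝ := fun x => ∫ y in X..x, q y with hQ
  have hii : ∀ a b, IntervalIntegrable q volume a b := fun a b => hq.intervalIntegrable
  have hQc : Continuous Q := intervalIntegral.continuous_primitive (fun a b => hii a b) X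
  have hQi : ∀ a b, IntervalIntegrable Q volume a b := fun a b => hQc.intervalIntegrable a b
  have h1 : ∀ x, ∫ y in x..x + H, q y = Q (x + H) - Q x := fun x => by
    rw [hQ]; simp only
    rw [intervalIntegral.integral_interval_sub_left (hii _ _) (hii _ _)]
  have hQs : Continuous fun x => Q (x + H) := hQc.comp (by fun_prop)
  simp_rw [h1]
  rw [intervalIntegral.integral_sub (hQs.intervalIntegrable _ _) (hQi _ _),
    intervalIntegral.integral_comp_add_right Q]
  -- The integral of Q(x + H) - Q(x) telescopes to two end strips: the one at X is subtracted and
  -- nonnegative, the one at Y is at most H times the total mass.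
  have h2 : ∫ x in X..Y, Q x = (∫ x in X..X + H, Q x) + (∫ x in X + H..Y + H, Q x) -
      ∫ x in Y..Y + H, Q x := by
    rw [intervalIntegral.integral_add_adjacent_intervals (hQi _ _) (hQi _ _),
      ← intervalIntegral.integral_add_adjacent_intervals (hQi X Y) (hQi Y (Y + H))]
    ring
  have h3 : 0 ≤ ∫ x in X..X + H, Q x := by
    refine intervalIntegral.integral_nonneg (by linarith) fun x hx => ?_
    exact intervalIntegral.integral_nonneg hx.1 fun _ _ => hq0 _
  have h4 : ∫ x in Y..Y + H, Q x ≤ H * ∫ y, q y := by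
    calc ∫ x in Y..Y + H, Q x ≤ ∫ x in Y..Y + H, ∫ y, q y := by
          refine intervalIntegral.integral_mono_on (by linarith) (hQi _ _) (by simp) fun x hx => ?_
          rw [hQ]; simp only
          rw [intervalIntegral.integral_of_le (by linarith [hx.1])]
          exact setIntegral_le_integral hq (Filter.Eventually.of_forall hq0)
      _ = _ := by rw [intervalIntegral.integral_const, smul_eq_mul]; ring
  linarith

/-- The sum of `β i` over the frequencies `ν i` in the window `[x, x + H]`. -/
noncomputable def windowSum {ι : Type*} (s : Finset ι) (ν : ι → ℝ) (β : ι → ℂ) (H x : ℝ) : ℂ :=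
  ∑ i ∈ s, if x ≤ ν i ∧ ν i ≤ x + H then β i else 0

theorem measurable_windowSum {ι : Type*} (s : Finset ι) (ν : ι → ℝ) (β : ι → ℂ) (H : ℝ) :
    Measurable (windowSum s ν β H) := by
  unfold windowSum
  refine Finset.measurable_fun_sum _ fun i _ => Measurable.ite ?_ measurable_const measurable_const
  have : {x : ℝ | x ≤ ν i ∧ ν i ≤ x + H} = Set.Icc (ν i - H) (ν i) := by
    ext x; simp only [Set.mem_ofPred_eq, Set.mem_Icc]
    constructor <;> rintro ⟨h1, h2⟩ <;> constructor <;> linarith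
  rw [this]
  exact measurableSet_Icc

theorem norm_windowSum_le {ι : Type*} (s : Finset ι) (ν : ι → ℝ) (β : ι → ℂ) (H x : ℝ) :
    ‖windowSum s ν β H x‖ ≤ ∑ i ∈ s, ‖β i‖ := by
  refine (norm_sum_le _ _).trans (Finset.sum_le_sum fun i _ => ?_)
  split_ifs
  · exact le_rfl
  · rw [norm_zero]; exact norm_nonneg _

theorem intervalIntegrable_norm_windowSum_sq {ι : Type*} (s : Finset ι) (ν : ι → ℝ) (β : ι → ℂ)
    (H a b : ℝ) : IntervalIntegrable (fun x => ‖windowSum s ν β H x‖ ^ 2) volume a b := by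
  rw [intervalIntegrable_iff]
  refine Measure.integrableOn_of_bounded (M := (∑ i ∈ s, ‖β i‖) ^ 2) (by simp)
    ((measurable_windowSum s ν β H).norm.pow_const 2).aestronglyMeasurable
    (Filter.Eventually.of_forall fun x => ?_)
  rw [Real.norm_of_nonneg (by positivity)]
  gcongr
  exact norm_windowSum_le s ν β H x

theorem ofReal_normSq_sum_eq {ι : Type*} (s : Finset ι) (β : ι → ℂ) (τ : ι → ℝ) :
    ((‖∑ i ∈ s, β i * (τ i : ℂ)‖ ^ 2 : ℝ) : ℂ) =
      ∑ i ∈ s, ∑ j ∈ s, β i * (starRingEnd ℂ) (β j) * ((τ i * τ j : ℝ) : ℂ) := by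
  rw [ofReal_pow, ← mul_conj', map_sum, Finset.sum_mul_sum]
  refine Finset.sum_congr rfl fun i _ => Finset.sum_congr rfl fun j _ => ?_
  rw [map_mul, conj_ofReal]
  push_cast; ring

/-- Plancherel's identity for the Mellin transform. For finite sums it follows by expanding both
squares, since the two quadratic forms have the same kernel. -/
theorem integral_normSq_truncPow_sum {ι : Type*} (s : Finset ι) (ν : ι → ℝ) (β : ι → ℂ)
    (hν : ∀ i ∈ s, 0 < ν i) {c : ℝ} (hc : 0 < c) :
    IntegrableOn (fun y => ‖∑ i ∈ s, β i * (truncPow c (ν i) y : ℂ)‖ ^ 2 / y ^ 2) (Set.Ioi 0) ∧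
    ∫ y in Set.Ioi 0, ‖∑ i ∈ s, β i * (truncPow c (ν i) y : ℂ)‖ ^ 2 / y ^ 2 =
      1 / (2 * Real.pi) * ∫ t : ℝ, ‖∑ i ∈ s, β i * ((√(ν i))⁻¹ : ℝ) *
        cexp (-(t * Real.log (ν i) * I))‖ ^ 2 / ((c + 1 / 2) ^ 2 + t ^ 2) := by
  have hint : ∀ i ∈ s, ∀ j ∈ s, IntegrableOn (fun y => β i * (starRingEnd ℂ) (β j) *
      ((truncPow c (ν i) y * truncPow c (ν j) y / y ^ 2 : ℝ) : ℂ)) (Set.Ioi 0) :=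
    fun i hi j hj => ((integrableOn_truncPow_mul hc (hν i hi) (hν j hj)).1.ofReal (𝕜 := ℂ)).const_mul _
  have he : ∀ y : ℝ, ((‖∑ i ∈ s, β i * (truncPow c (ν i) y : ℂ)‖ ^ 2 / y ^ 2 : ℝ) : ℂ) =
      ∑ i ∈ s, ∑ j ∈ s, β i * (starRingEnd ℂ) (β j) *
      ((truncPow c (ν i) y * truncPow c (ν j) y / y ^ 2 : ℝ) : ℂ) := by
    intro y
    rw [ofReal_div, ofReal_normSq_sum_eq, Finset.sum_div]
    refine Finset.sum_congr rfl fun i _ => ?_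
    rw [Finset.sum_div]
    refine Finset.sum_congr rfl fun j _ => ?_
    push_cast; ring
  have hI : IntegrableOn (fun y => ((‖∑ i ∈ s, β i * (truncPow c (ν i) y : ℂ)‖ ^ 2 / y ^ 2 : ℝ) : ℂ))
      (Set.Ioi 0) := by
    simp_rw [he]
    exact integrable_finsetSum _ fun i hi => integrable_finsetSum _ fun j hj => hint i hi j hj
  refine ⟨?_, ?_⟩
  · exact hI.re.congr (Filter.Eventually.of_forall fun y => ofReal_re _)
  · have hq := integral_norm_sq_expPoly_div s (fun i => β i * ((√(ν i))⁻¹ : ℝ))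
      (fun i => Real.log (ν i)) (a := c + 1 / 2) (by positivity)
    rw [← ofReal_inj, ofReal_mul, hq, ← integral_complex_ofReal]
    simp_rw [he]
    rw [integral_finsetSum _ fun i hi => integrable_finsetSum _ fun j hj => hint i hi j hj,
      Finset.mul_sum]
    refine Finset.sum_congr rfl fun i hi => ?_
    rw [integral_finsetSum _ fun j hj => hint i hi j hj, Finset.mul_sum]
    refine Finset.sum_congr rfl fun j hj => ?_
    rw [integral_const_mul, integral_complex_ofReal,
      (integrableOn_truncPow_mul hc (hν i hi) (hν j hj)).2, map_mul, conj_ofReal]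
    have hpi : (Real.pi : ℂ) ≠ 0 := by exact_mod_cast Real.pi_ne_zero
    have hc' : ((c + 1 / 2 : ℝ) : ℂ) ≠ 0 := by
      have : c + 1 / 2 ≠ 0 := by positivity
      exact_mod_cast this
    simp only [ofReal_mul, ofReal_div, ofReal_one, ofReal_ofNat]
    field_simp

/-- The mean square of short window sums is controlled by the mean square of the generating
exponential polynomial against a Cauchy weight at scale `X / H`. -/
theorem integral_normSq_windowSum_le {ι : Type*} (s : Finset ι) (ν : ι → ℝ) (β : ι → ℂ)
    (hν : ∀ i ∈ s, 0 < ν i) {X H : ℝ} (hX : 0 < X) (hH : 0 < H) :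
    ∫ x in X..2 * X, ‖windowSum s ν β H x‖ ^ 2 ≤
      3 * ((2 * X + H) ^ 2 + (2 * X) ^ 2 + X ^ 2) * (1 / (2 * Real.pi) *
        ∫ t : ℝ, ‖∑ i ∈ s, β i * ((√(ν i))⁻¹ : ℝ) *
        cexp (-(t * Real.log (ν i) * I))‖ ^ 2 / ((X / H + 1 / 2) ^ 2 + t ^ 2)) := by
  set c : ℝ := X / H with hc
  have hc0 : 0 < c := by positivity
  set g : ℝ → ℂ := fun y => ∑ i ∈ s, β i * (truncPow c (ν i) y : ℂ) with hg
  obtain ⟨hqi, hqe⟩ := integral_normSq_truncPow_sum s ν β hν hc0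
  rw [← hqe]
  set q : ℝ → ℝ := (Set.Ioi 0).indicator fun y => ‖g y‖ ^ 2 / y ^ 2 with hq
  have hqI : Integrable q := (integrable_indicator_iff measurableSet_Ioi).mpr hqi
  have hq0 : ∀ y, 0 ≤ q y := fun y => Set.indicator_nonneg (fun _ _ => by positivity) y
  have hqpos : ∀ y, 0 < y → q y = ‖g y‖ ^ 2 / y ^ 2 := fun y hy => Set.indicator_of_mem hy _
  have hJ : ∫ y in Set.Ioi 0, ‖g y‖ ^ 2 / y ^ 2 = ∫ y, q y := (integral_indicator measurableSet_Ioi).symm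
  change _ ≤ _ * ∫ y in Set.Ioi 0, ‖g y‖ ^ 2 / y ^ 2
  rw [hJ]
  have hgm : Measurable g := Finset.measurable_fun_sum _ fun i _ =>
    (Complex.measurable_ofReal.comp (measurable_truncPow c (ν i))).const_mul _
  have hgb : ∀ y, ‖g y‖ ≤ ∑ i ∈ s, ‖β i‖ := fun y => by
    refine (norm_sum_le _ _).trans (Finset.sum_le_sum fun i hi => ?_)
    rw [norm_mul, norm_real, Real.norm_of_nonneg (truncPow_nonneg (hν i hi))]
    exact mul_le_of_le_one_right (norm_nonneg _) (truncPow_le_one hc0 (hν i hi))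
  -- The points x = ν_i are left out because there the closed window differs from the half-open one
  -- of `indicator_eq_truncPow`. They form a finite, hence null, set.
  have hpt : ∀ x ∈ Set.Icc X (2 * X), x ∉ s.image ν → ‖windowSum s ν β H x‖ ^ 2 ≤
      3 * ((2 * X + H) ^ 2 * q (x + H) + (2 * X) ^ 2 * q x + X ^ 2 / H * ∫ y in x..x + H, q y) := by
    intro x hx hxν
    have hx0 : 0 < x := hX.trans_le hx.1
    have hle : x ≤ x + H := by linarith
    have hrepr : windowSum s ν β H x = g (x + H) - g x + c * ∫ y in x..x + H, g y / y := by
      have e1 : ∫ y in x..x + H, g y / y =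
          ∑ i ∈ s, β i * ((∫ y in x..x + H, truncPow c (ν i) y / y : ℝ) : ℂ) := by
        have : ∀ y : ℝ, g y / y = ∑ i ∈ s, β i * ((truncPow c (ν i) y / y : ℝ) : ℂ) := fun y => by
          simp only [hg]
          rw [Finset.sum_div]
          refine Finset.sum_congr rfl fun i _ => ?_
          push_cast; ring
        simp_rw [this]
        have hτ : ∀ i ∈ s, IntervalIntegrable (fun y => ((truncPow c (ν i) y / y : ℝ) : ℂ))
            volume x (x + H) := fun i hi =>
          have h := intervalIntegrable_truncPow_div hc0 (hν i hi) hx0 hle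
          ⟨h.1.ofReal, h.2.ofReal⟩
        rw [intervalIntegral.integral_finsetSum fun i hi => (hτ i hi).const_mul _]
        refine Finset.sum_congr rfl fun i _ => ?_
        rw [intervalIntegral.integral_const_mul, intervalIntegral.integral_ofReal]
      rw [e1]
      simp only [hg, windowSum]
      rw [Finset.mul_sum, ← Finset.sum_sub_distrib, ← Finset.sum_add_distrib]
      refine Finset.sum_congr rfl fun i hi => ?_
      have h := indicator_eq_truncPow hc0 (hν i hi) hx0 hH.le
      have hne : x ≠ ν i := fun h => hxν (Finset.mem_image.mpr ⟨i, hi, h.symm⟩)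
      have hiff : (x ≤ ν i ∧ ν i ≤ x + H) ↔ (x < ν i ∧ ν i ≤ x + H) := by
        rw [hne.le_iff_lt]
      have h' := congrArg (fun r : ℝ => β i * (r : ℂ)) h
      simp only [ofReal_add, ofReal_sub, ofReal_mul] at h'
      simp only [hiff]
      calc _ = β i * ((if x < ν i ∧ ν i ≤ x + H then (1 : ℝ) else 0 : ℝ) : ℂ) := by
            split_ifs <;> simp
        _ = _ := by rw [h']; ring
    have hfi : IntervalIntegrable (fun y => ‖g y‖ / y) volume x (x + H) := by
      rw [intervalIntegrable_iff_integrableOn_Ioc_of_le hle]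
      refine Measure.integrableOn_of_bounded (M := (∑ i ∈ s, ‖β i‖) / x) (by simp)
        (hgm.norm.div measurable_id).aestronglyMeasurable ?_
      filter_upwards [ae_restrict_mem measurableSet_Ioc] with y hy
      have hy0 : 0 < y := hx0.trans hy.1
      rw [Real.norm_of_nonneg (by positivity)]
      exact div_le_div₀ (Finset.sum_nonneg fun _ _ => norm_nonneg _) (hgb y) hx0 hy.1.le
    have hcs : ‖∫ y in x..x + H, g y / y‖ ^ 2 ≤ H * ∫ y in x..x + H, q y := by
      have e2 : ∀ y ∈ Set.uIcc x (x + H), q y = (‖g y‖ / y) ^ 2 := fun y hy => by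
        rw [Set.uIcc_of_le hle] at hy
        rw [hqpos y (hx0.trans_le hy.1), div_pow]
      have hsq : IntervalIntegrable (fun y => (‖g y‖ / y) ^ 2) volume x (x + H) :=
        (hqI.intervalIntegrable (a := x) (b := x + H)).congr
          (fun y hy => e2 y (Set.uIoc_subset_uIcc hy))
      calc ‖∫ y in x..x + H, g y / y‖ ^ 2 ≤ (∫ y in x..x + H, ‖g y‖ / y) ^ 2 := by
            gcongr
            refine (intervalIntegral.norm_integral_le_integral_norm hle).trans_eq ?_
            refine intervalIntegral.integral_congr fun y hy => ?_
            rw [Set.uIcc_of_le hle] at hy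
            rw [norm_div, norm_real, Real.norm_of_nonneg (hx0.le.trans hy.1)]
        _ ≤ (x + H - x) * ∫ y in x..x + H, (‖g y‖ / y) ^ 2 := sq_intervalIntegral_le hle hfi hsq
        _ = _ := by
            rw [add_sub_cancel_left, intervalIntegral.integral_congr e2]
    have hsq : ∀ y, 0 < y → ‖g y‖ ^ 2 = y ^ 2 * q y := fun y hy => by
      rw [hqpos y hy]; field_simp
    have htri : ‖windowSum s ν β H x‖ ≤ ‖g (x + H)‖ + ‖g x‖ + c * ‖∫ y in x..x + H, g y / y‖ := by
      rw [hrepr]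
      refine (norm_add_le _ _).trans (add_le_add (norm_sub_le _ _) ?_)
      rw [norm_mul, norm_real, Real.norm_of_nonneg hc0.le]
    have h3 : ∀ u v w : ℝ, (u + v + w) ^ 2 ≤ 3 * (u ^ 2 + v ^ 2 + w ^ 2) := fun u v w => by
      nlinarith [sq_nonneg (u - v), sq_nonneg (v - w), sq_nonneg (u - w)]
    calc ‖windowSum s ν β H x‖ ^ 2
        ≤ (‖g (x + H)‖ + ‖g x‖ + c * ‖∫ y in x..x + H, g y / y‖) ^ 2 := by gcongr
      _ ≤ 3 * (‖g (x + H)‖ ^ 2 + ‖g x‖ ^ 2 + (c * ‖∫ y in x..x + H, g y / y‖) ^ 2) := h3 _ _ _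
      _ ≤ _ := by
        rw [hsq x hx0, hsq (x + H) (by linarith), mul_pow]
        have t1 : (x + H) ^ 2 * q (x + H) ≤ (2 * X + H) ^ 2 * q (x + H) := by
          have := hq0 (x + H); have := hx.2; gcongr
        have t2 : x ^ 2 * q x ≤ (2 * X) ^ 2 * q x := by
          have := hq0 x; have := hx.2; gcongr
        -- The choice c = X/H balances the three terms: Cauchy-Schwarz leaves c²H = X²/H, and
        -- averaging over the sliding window returns the factor H, so each term contributes a
        -- multiple of X² times the mass of q when H ≪ X.
        have t3 : c ^ 2 * ‖∫ y in x..x + H, g y / y‖ ^ 2 ≤ X ^ 2 / H * ∫ y in x..x + H, q y := by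
          calc _ ≤ c ^ 2 * (H * ∫ y in x..x + H, q y) := by gcongr
            _ = _ := by rw [hc]; field_simp
        linarith
  have hJ0 : 0 ≤ ∫ y, q y := integral_nonneg hq0
  have hsub : ∀ a b : ℝ, a ≤ b → ∫ y in a..b, q y ≤ ∫ y, q y := fun a b hab => by
    rw [intervalIntegral.integral_of_le hab]
    exact setIntegral_le_integral hqI (Filter.Eventually.of_forall hq0)
  have hX2 : X ≤ 2 * X := by linarith
  have hwin : Continuous fun x => ∫ y in x..x + H, q y := by
    have hii : ∀ a b, IntervalIntegrable q volume a b := fun a b => hqI.intervalIntegrable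
    have hQc := intervalIntegral.continuous_primitive (μ := volume) (fun a b => hii a b) X
    have : (fun x => ∫ y in x..x + H, q y) =
        fun x => (∫ y in X..x + H, q y) - ∫ y in X..x, q y := by
      funext x
      rw [intervalIntegral.integral_interval_sub_left (hii _ _) (hii _ _)]
    rw [this]
    exact (hQc.comp (by fun_prop : Continuous fun x : ℝ => x + H)).sub hQc
  have i1 : IntervalIntegrable (fun x => (2 * X + H) ^ 2 * q (x + H)) volume X (2 * X) :=
    ((hqI.comp_add_right H).intervalIntegrable).const_mul _
  have i2 : IntervalIntegrable (fun x => (2 * X) ^ 2 * q x) volume X (2 * X) :=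
    hqI.intervalIntegrable.const_mul _
  have i3 : IntervalIntegrable (fun x => X ^ 2 / H * ∫ y in x..x + H, q y) volume X (2 * X) :=
    (hwin.intervalIntegrable _ _).const_mul _
  calc ∫ x in X..2 * X, ‖windowSum s ν β H x‖ ^ 2
      ≤ ∫ x in X..2 * X, 3 * ((2 * X + H) ^ 2 * q (x + H) + (2 * X) ^ 2 * q x +
          X ^ 2 / H * ∫ y in x..x + H, q y) := by
        refine intervalIntegral.integral_mono_ae_restrict hX2
          (intervalIntegrable_norm_windowSum_sq s ν β H _ _) (((i1.add i2).add i3).const_mul 3) ?_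
        have hfin : ∀ᵐ x : ℝ, x ∉ s.image ν := by
          have := (s.image ν).finite_toSet.measure_zero (volume : Measure ℝ)
          rw [measure_eq_zero_iff_ae_notMem] at this
          exact this
        filter_upwards [ae_restrict_mem measurableSet_Icc, ae_restrict_of_ae hfin] with x hx hx2
        exact hpt x hx hx2
    _ = 3 * ((2 * X + H) ^ 2 * (∫ x in X..2 * X, q (x + H)) + (2 * X) ^ 2 * (∫ x in X..2 * X, q x) +
          X ^ 2 / H * ∫ x in X..2 * X, ∫ y in x..x + H, q y) := by
        rw [intervalIntegral.integral_const_mul, intervalIntegral.integral_add (i1.add i2) i3,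
          intervalIntegral.integral_add i1 i2, intervalIntegral.integral_const_mul,
          intervalIntegral.integral_const_mul, intervalIntegral.integral_const_mul]
    _ ≤ 3 * ((2 * X + H) ^ 2 * (∫ y, q y) + (2 * X) ^ 2 * (∫ y, q y) +
          X ^ 2 / H * (H * ∫ y, q y)) := by
        gcongr
        · rw [intervalIntegral.integral_comp_add_right q]
          exact hsub _ _ (by linarith)
        · exact hsub _ _ hX2
        · exact integral_sliding_window_le hqI hq0 hX2 hH.le
    _ = _ := by field_simp

end

/-! ### Two-sided Laplace transform and contour shift -/

section

open MeasureTheory Complex Filter Topology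

/-- The two-sided Laplace transform. -/
noncomputable def twoSidedLaplace (φ : ℝ → ℂ) (w : ℂ) : ℂ := ∫ v : ℝ, φ v * cexp (w * v)

section Laplace

variable {φ : ℝ → ℂ} {R : ℝ}

theorem hasCompactSupport_of_forall_lt_abs (hs : ∀ v, R < |v| → φ v = 0) : HasCompactSupport φ := by
  refine HasCompactSupport.intro (isCompact_Icc (a := -R) (b := R)) fun v hv => hs v ?_
  by_contra! h
  exact hv (abs_le.mp h)

theorem integrable_mul_cexp (hc : Continuous φ) (hs : ∀ v, R < |v| → φ v = 0) (w : ℂ) :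
    Integrable fun v : ℝ => φ v * cexp (w * v) :=
  (hc.mul (by fun_prop)).integrable_of_hasCompactSupport
    (hasCompactSupport_of_forall_lt_abs hs).mul_right

theorem norm_twoSidedLaplace_le (hc : Continuous φ) (hs : ∀ v, R < |v| → φ v = 0) (w : ℂ) :
    ‖twoSidedLaplace φ w‖ ≤ (∫ v, ‖φ v‖) * Real.exp (R * |w.re|) := by
  have hφ : Integrable φ := by simpa using integrable_mul_cexp hc hs 0
  rw [← integral_mul_const]
  refine norm_integral_le_of_norm_le (hφ.norm.mul_const _) (Eventually.of_forall fun v => ?_)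
  by_cases hv : R < |v|
  · simp [hs v hv]
  · rw [norm_mul, norm_exp]
    gcongr
    rw [re_mul_ofReal]
    calc w.re * v ≤ |w.re * v| := le_abs_self _
      _ = |v| * |w.re| := by rw [abs_mul, mul_comm]
      _ ≤ _ := by gcongr; exact not_lt.mp hv

/-- Integration by parts. Iterating it gives decay faster than any power of |w| in vertical strips.
-/
theorem mul_twoSidedLaplace (hd : ContDiff ℝ 1 φ) (hs : ∀ v, R < |v| → φ v = 0)
    (hs' : ∀ v, R < |v| → deriv φ v = 0) (w : ℂ) :
    w * twoSidedLaplace φ w = -twoSidedLaplace (deriv φ) w := by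
  have hc' : Continuous (deriv φ) := hd.continuous_deriv le_rfl
  have h := integral_mul_deriv_eq_deriv_mul_of_integrable (u := φ) (u' := deriv φ)
    (v := fun v : ℝ => cexp (w * v)) (v' := fun v : ℝ => w * cexp (w * v))
    (fun x _ => (hd.differentiable one_ne_zero x).hasDerivAt)
    (fun x _ => by
      have h1 : HasDerivAt (fun v : ℝ => w * (v : ℂ)) w x := by
        simpa using (hasDerivAt_id x).ofReal_comp.const_mul w
      simpa [mul_comm] using h1.cexp)
    (by
      refine ((integrable_mul_cexp hd.continuous hs w).const_mul w).congr
        (Eventually.of_forall fun v => ?_)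
      simp only [Pi.mul_apply]; ring)
    (integrable_mul_cexp hc' hs' w) (integrable_mul_cexp hd.continuous hs w)
  rw [twoSidedLaplace, ← integral_const_mul]
  rw [twoSidedLaplace, ← h]
  exact integral_congr_ae (Eventually.of_forall fun v => by simp only; ring)

theorem deriv_eq_zero_of_forall_lt_abs (hs : ∀ v, R < |v| → φ v = 0) :
    ∀ v, R < |v| → deriv φ v = 0 := by
  intro v hv
  have : φ =ᶠ[𝓝 v] fun _ => 0 := by
    filter_upwards [(isOpen_lt continuous_const continuous_abs).mem_nhds hv] with u hu
    exact hs u hu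
  rw [this.deriv_eq]; simp

theorem exists_norm_pow_mul_twoSidedLaplace_le (J : ℕ) (hd : ContDiff ℝ (⊤ : ℕ∞) φ)
    (hs : ∀ v, R < |v| → φ v = 0) :
    ∃ C : ℝ, 0 ≤ C ∧ ∀ w : ℂ, ‖w‖ ^ J * ‖twoSidedLaplace φ w‖ ≤ C * Real.exp (R * |w.re|) := by
  induction J generalizing φ with
  | zero =>
    refine ⟨∫ v, ‖φ v‖, integral_nonneg fun _ => norm_nonneg _, fun w => ?_⟩
    simpa using norm_twoSidedLaplace_le hd.continuous hs w
  | succ J ih =>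
    have hs' := deriv_eq_zero_of_forall_lt_abs hs
    obtain ⟨C, hC, h⟩ := ih (φ := deriv φ) (hd.iterate_deriv 1) hs'
    refine ⟨C, hC, fun w => ?_⟩
    rw [pow_succ, mul_assoc, ← norm_mul, mul_twoSidedLaplace (hd.of_le (by exact_mod_cast le_top)) hs hs' w,
      norm_neg]
    exact h w

theorem exists_norm_twoSidedLaplace_le (J : ℕ) (hd : ContDiff ℝ (⊤ : ℕ∞) φ)
    (hs : ∀ v, R < |v| → φ v = 0) :
    ∃ C : ℝ, 0 ≤ C ∧ ∀ w : ℂ,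
      ‖twoSidedLaplace φ w‖ ≤ C * Real.exp (R * |w.re|) / (1 + |w.im|) ^ J := by
  obtain ⟨C₀, hC₀, h₀⟩ := exists_norm_pow_mul_twoSidedLaplace_le 0 hd hs
  obtain ⟨C₁, hC₁, h₁⟩ := exists_norm_pow_mul_twoSidedLaplace_le J hd hs
  refine ⟨2 ^ (J - 1) * (C₀ + C₁), by positivity, fun w => ?_⟩
  rw [le_div_iff₀ (by positivity)]
  have h0 := h₀ w
  rw [pow_zero, one_mul] at h0
  calc ‖twoSidedLaplace φ w‖ * (1 + |w.im|) ^ J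
      ≤ ‖twoSidedLaplace φ w‖ * (2 ^ (J - 1) * (1 ^ J + ‖w‖ ^ J)) := by
        gcongr
        refine (add_pow_le zero_le_one (abs_nonneg _) J).trans ?_
        gcongr
        exact abs_im_le_norm w
    _ = 2 ^ (J - 1) * (‖twoSidedLaplace φ w‖ + ‖w‖ ^ J * ‖twoSidedLaplace φ w‖) := by
        rw [one_pow]; ring
    _ ≤ 2 ^ (J - 1) * (C₀ * Real.exp (R * |w.re|) + C₁ * Real.exp (R * |w.re|)) := by
        exact mul_le_mul_of_nonneg_left (add_le_add h0 (h₁ w)) (by positivity)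
    _ = _ := by ring

theorem differentiable_twoSidedLaplace (hc : Continuous φ) (hs : ∀ v, R < |v| → φ v = 0) :
    Differentiable ℂ (twoSidedLaplace φ) := by
  intro w
  have hφ : Integrable φ := by simpa using integrable_mul_cexp hc hs 0
  have h := hasDerivAt_integral_of_dominated_loc_of_deriv_le (μ := volume) (x₀ := w)
    (s := Metric.ball w 1)
    (F := fun (z : ℂ) (v : ℝ) => φ v * cexp (z * v))
    (F' := fun (z : ℂ) (v : ℝ) => φ v * (cexp (z * v) * v))
    (bound := fun v => ‖φ v‖ * (Real.exp ((‖w‖ + 1) * |R|) * |R|))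
    (Metric.ball_mem_nhds w one_pos)
    (Eventually.of_forall fun z => (hc.mul (by fun_prop)).aestronglyMeasurable)
    (integrable_mul_cexp hc hs w)
    (hc.mul (by fun_prop)).aestronglyMeasurable
    (Eventually.of_forall fun v z hz => ?_)
    (hφ.norm.mul_const _)
    (Eventually.of_forall fun v z _ => ?_)
  · exact h.2.differentiableAt
  · by_cases hv : R < |v|
    · simp [hs v hv]
    · have hvR : |v| ≤ |R| := (not_lt.mp hv).trans (le_abs_self R)
      rw [norm_mul, norm_mul, norm_exp, norm_real, Real.norm_eq_abs, re_mul_ofReal]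
      have hz' : ‖z‖ ≤ ‖w‖ + 1 := by
        have := mem_ball_iff_norm.mp hz
        calc ‖z‖ = ‖w + (z - w)‖ := by ring_nf
          _ ≤ ‖w‖ + ‖z - w‖ := norm_add_le _ _
          _ ≤ _ := by linarith
      have hexp : z.re * v ≤ (‖w‖ + 1) * |R| :=
        calc z.re * v ≤ |z.re| * |v| := (le_abs_self _).trans_eq (abs_mul _ _)
          _ ≤ _ := mul_le_mul ((abs_re_le_norm z).trans hz') hvR (abs_nonneg _) (by positivity)
      exact mul_le_mul_of_nonneg_left (mul_le_mul (Real.exp_le_exp.mpr hexp) hvR (abs_nonneg _)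
        (Real.exp_pos _).le) (norm_nonneg _)
  · have h1 : HasDerivAt (fun z : ℂ => z * (v : ℂ)) v z := by
      simpa using (hasDerivAt_id z).mul_const (v : ℂ)
    exact (h1.cexp).const_mul _

/-- Laplace inversion along the vertical line with abscissa `c`. -/
theorem integral_twoSidedLaplace_mul_cexp (hd : ContDiff ℝ (⊤ : ℕ∞) φ)
    (hs : ∀ v, R < |v| → φ v = 0) (c v : ℝ) :
    ∫ y : ℝ, twoSidedLaplace φ (c + y * I) * cexp (-((c + y * I) * v)) = 2 * Real.pi * φ v := by
  obtain ⟨C, hC, hb⟩ := exists_norm_twoSidedLaplace_le 2 hd hs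
  have hcont : Continuous (twoSidedLaplace φ) :=
    (differentiable_twoSidedLaplace hd.continuous hs).continuous
  have hg : Integrable fun y : ℝ => twoSidedLaplace φ (c - y * I) := by
    refine (integrable_inv_one_add_sq.const_mul (C * Real.exp (R * |c|))).mono'
      (hcont.comp (by fun_prop)).aestronglyMeasurable (Eventually.of_forall fun y => ?_)
    refine (hb _).trans ?_
    simp only [sub_re, ofReal_re, mul_re, I_re, mul_zero, ofReal_im, I_im, mul_one, sub_zero,
      sub_im, mul_im, add_zero, zero_sub, abs_neg]
    rw [div_eq_mul_inv]
    gcongr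
    nlinarith [abs_nonneg y, sq_abs y]
  have h := integral_cexp_mul_of_fourier_eq (f := fun v => φ v * cexp (c * v))
    (hd.continuous.mul (by fun_prop)) (integrable_mul_cexp hd.continuous hs c) hg (fun w => by
      rw [twoSidedLaplace]
      refine integral_congr_ae (Eventually.of_forall fun x => ?_)
      simp only
      rw [mul_left_comm, ← Complex.exp_add]
      congr 2; ring) v
  rw [← integral_neg_eq_self] at h
  have h2 : ∫ y : ℝ, twoSidedLaplace φ (c + y * I) * cexp (-((c + y * I) * v)) =
      (∫ x : ℝ, cexp ((-x : ℝ) * v * I) * twoSidedLaplace φ (c - (-x : ℝ) * I)) *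
        cexp (-(c * v)) := by
    rw [← integral_mul_const]
    refine integral_congr_ae (Eventually.of_forall fun x => ?_)
    simp only
    rw [mul_right_comm, ← Complex.exp_add, mul_comm (cexp _)]
    congr 2
    · push_cast; ring
    · push_cast; ring
  rw [h2, h, mul_assoc, mul_assoc, mul_assoc, ← Complex.exp_add]
  simp [mul_assoc]

end Laplace

/-- Shifting a vertical line of integration. -/
theorem integral_vertical_line_eq {h : ℂ → ℂ} (hd : Differentiable ℂ h) {c C : ℝ} (hc : 0 ≤ c)
    (hb : ∀ x ∈ Set.Icc 0 c, ∀ y : ℝ, ‖h (x + y * I)‖ ≤ C / (1 + y ^ 2)) :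
    ∫ y : ℝ, h (y * I) = ∫ y : ℝ, h (c + y * I) := by
  have hint : ∀ x ∈ Set.Icc 0 c, Integrable fun y : ℝ => h (x + y * I) := fun x hx =>
    (integrable_inv_one_add_sq.const_mul C).mono'
      (hd.continuous.comp (by fun_prop)).aestronglyMeasurable
      (Eventually.of_forall fun y => (hb x hx y).trans_eq (div_eq_mul_inv _ _))
  have i0 : Integrable fun y : ℝ => h (y * I) := by
    simpa using hint 0 ⟨le_rfl, hc⟩
  have ic := hint c ⟨hc, le_rfl⟩
  have hC : 0 ≤ C := by
    have := (norm_nonneg _).trans (hb 0 ⟨le_rfl, hc⟩ 0)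
    simpa using this
  have t0 := intervalIntegral_tendsto_integral i0 tendsto_neg_atTop_atBot tendsto_id
  have tc := intervalIntegral_tendsto_integral ic tendsto_neg_atTop_atBot tendsto_id
  have hrect : ∀ T : ℝ, 0 ≤ T → ‖(∫ y in -T..T, h (c + y * I)) - ∫ y in -T..T, h (y * I)‖ ≤
      2 * (C / (1 + T ^ 2) * c) := by
    intro T hT
    have := integral_boundary_rect_eq_zero_of_differentiableOn h (-T * I) (c + T * I)
      hd.differentiableOn
    simp only [mul_re, neg_re, ofReal_re, I_re, mul_zero, neg_im, ofReal_im, neg_zero, I_im,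
      mul_one, sub_self, add_re, add_zero, mul_im, add_im, zero_add, ofReal_zero, ofReal_neg,
      smul_eq_mul] at this
    have n1 : ∀ T : ℝ, ‖∫ x in (0 : ℝ)..c, h (x + T * I)‖ ≤ C / (1 + T ^ 2) * c := by
      intro T
      have := intervalIntegral.norm_integral_le_of_norm_le_const (a := 0) (b := c)
        (f := fun x : ℝ => h (x + T * I)) (C := C / (1 + T ^ 2)) fun x hx => by
          rw [Set.uIoc_of_le hc] at hx
          exact hb x ⟨hx.1.le, hx.2⟩ T
      simpa [abs_of_nonneg hc] using this
    have e : (∫ y in -T..T, h (c + y * I)) - ∫ y in -T..T, h (y * I) =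
        I * ((∫ x in (0 : ℝ)..c, h (x + (-T : ℝ) * I)) - ∫ x in (0 : ℝ)..c, h (x + T * I)) := by
      push_cast
      linear_combination (-I) * this + ((∫ y in -T..T, h (c + y * I)) - ∫ y in -T..T, h (y * I)) * I_sq
    rw [e, norm_mul, norm_I, one_mul]
    refine (norm_sub_le _ _).trans ?_
    have h1 := n1 T
    have h2 := n1 (-T)
    rw [neg_sq] at h2
    linarith
  have tz : Tendsto (fun T : ℝ => 2 * (C / (1 + T ^ 2) * c)) atTop (𝓝 0) := by
    have h1 : Tendsto (fun T : ℝ => 1 + T ^ 2) atTop atTop :=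
      tendsto_atTop_add_const_left _ _ (tendsto_pow_atTop two_ne_zero)
    have := ((tendsto_const_nhds (x := C)).div_atTop h1).mul_const c |>.const_mul 2
    simpa using this
  have h0 : Tendsto (fun T : ℝ => (∫ y in -T..T, h (c + y * I)) - ∫ y in -T..T, h (y * I)) atTop
      (𝓝 0) := by
    refine squeeze_zero_norm' ?_ tz
    filter_upwards [eventually_ge_atTop 0] with T hT using hrect T hT
  exact (sub_eq_zero.mp (tendsto_nhds_unique (tc.sub t0) h0)).symm

end

/-! ### Growth of L and smooth sums on the critical line -/

section

open MeasureTheory Complex Filter Topology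

theorem rpow_le_factorial_mul_exp {x a : ℝ} (hx : 1 ≤ x) :
    x ^ a ≤ (⌈a⌉₊.factorial : ℝ) * Real.exp x := by
  calc x ^ a ≤ x ^ (⌈a⌉₊ : ℝ) := Real.rpow_le_rpow_of_exponent_le hx (Nat.le_ceil a)
    _ = x ^ ⌈a⌉₊ := Real.rpow_natCast _ _
    _ ≤ _ := by
      have := Real.pow_div_factorial_le_exp x (by linarith) ⌈a⌉₊
      rwa [div_le_iff₀' (by positivity)] at this

/-- An `L`-function has polynomial growth in the strip `1/2 ≤ Re s ≤ 2`. -/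
theorem IsLFunction.exists_norm_le_strip {A : ℕ → ℂ} {L : ℂ → ℂ} {d : ℕ} (hL : IsLFunction A L d)
    {θ : ℝ} (hθ : IsSubconvexityExponent L θ) :
    ∃ (C : ℝ) (J : ℕ), 0 ≤ C ∧ ∀ s : ℂ, 1 / 2 ≤ s.re → s.re ≤ 2 → ‖L s‖ ≤ C * (1 + |s.im|) ^ J := by
  obtain ⟨C₁, hC₁⟩ := hθ.2 1 one_pos
  obtain ⟨a, C₂, hC₂⟩ := hL.finite_order
  set J : ℕ := ⌈θ + 1⌉₊ with hJ
  have hJθ : θ + 1 ≤ J := Nat.le_ceil _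
  have hC₁0 : 0 ≤ C₁ := by simpa using (norm_nonneg _).trans (hC₁ 0)
  have hC₂0 : 0 ≤ C₂ := by
    have := (norm_nonneg _).trans (hC₂ 0)
    exact nonneg_of_mul_nonneg_left this (Real.exp_pos _)
  set B : ℝ := ∑' n, ‖LSeries.term A 2 n‖ with hB
  have hB0 : 0 ≤ B := tsum_nonneg fun _ => norm_nonneg _
  -- Division by (s + 1)^J with J ≥ θ + 1 makes the function bounded on both edges of the strip.
  -- Since Re(s + 1) ≥ 3/2 there, the denominator never drops below 1 in modulus.
  set F : ℂ → ℂ := fun s => L s / (s + 1) ^ J with hF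
  have hne : ∀ s : ℂ, 1 / 2 ≤ s.re → s + 1 ≠ 0 := fun s hs h => by
    have := congrArg re h
    simp at this; linarith
  have hone : ∀ s : ℂ, 1 / 2 ≤ s.re → 1 ≤ ‖s + 1‖ := fun s hs => by
    calc (1 : ℝ) ≤ (s + 1).re := by simp; linarith
      _ ≤ _ := re_le_norm _
  have hFle : ∀ s : ℂ, 1 / 2 ≤ s.re → ‖F s‖ ≤ ‖L s‖ := fun s hs => by
    rw [hF]; simp only
    rw [norm_div, norm_pow]
    exact div_le_self (norm_nonneg _) (one_le_pow₀ (hone s hs))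
  have hbound : ∀ s : ℂ, 1 / 2 ≤ s.re → s.re ≤ 2 → ‖F s‖ ≤ max (C₁ * 2 ^ J) B := by
    intro s hs1 hs2
    refine PhragmenLindelof.vertical_strip (a := 1 / 2) (b := 2) (f := F) (C := max (C₁ * 2 ^ J) B)
      ?_ ?_ ?_ ?_ hs1 hs2
    · have hcl : closure (re ⁻¹' Set.Ioo (1 / 2 : ℝ) 2) ⊆ {s : ℂ | 1 / 2 ≤ s.re} :=
        closure_minimal (fun z hz => hz.1.le) (isClosed_le continuous_const continuous_re)
      refine DifferentiableOn.diffContOnCl fun z hz => ?_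
      refine DifferentiableAt.differentiableWithinAt ?_
      exact (hL.entire z).div (by fun_prop) (pow_ne_zero _ (hne z (hcl hz)))
    -- The strip has width 3/2, so growth exp(B exp(c|Im z|)) with c < 2π/3 is admissible. Here c =
    -- 1, which dominates exp(|z|^a) for any finite order a.
    · refine ⟨1, by
        rw [lt_div_iff₀ (by norm_num)]; linarith [Real.pi_gt_three],
        (⌈a⌉₊.factorial : ℝ) * Real.exp 2, ?_⟩
      refine Asymptotics.IsBigO.of_bound (C₂ * Real.exp ((1 / 2) ^ (-|a|))) ?_
      rw [eventually_inf_principal]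
      refine Eventually.of_forall fun z hz => ?_
      have hz1 : 1 / 2 ≤ z.re := hz.1.le
      have hzn : ‖z‖ ≤ 2 + |z.im| := by
        refine (norm_le_abs_re_add_abs_im z).trans ?_
        rw [abs_of_nonneg (by linarith)]
        have := hz.2.le
        gcongr
      rw [Real.norm_of_nonneg (Real.exp_pos _).le, mul_assoc, ← Real.exp_add]
      refine (hFle z hz1).trans ((hC₂ z).trans ?_)
      gcongr
      rw [one_mul, mul_assoc, ← Real.exp_add]
      -- The exponent a may be negative, so |z| ≤ 1 is treated apart. There |z| ≥ Re z ≥ 1/2 keeps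
      -- |z|^a bounded.
      rcases le_total 1 ‖z‖ with h1 | h1
      · have h2 := rpow_le_factorial_mul_exp (a := a) h1
        have h3 : (0 : ℝ) ≤ (1 / 2) ^ (-|a|) := by positivity
        have h4 : Real.exp ‖z‖ ≤ Real.exp (2 + |z.im|) := Real.exp_le_exp.mpr hzn
        calc ‖z‖ ^ a ≤ (⌈a⌉₊.factorial : ℝ) * Real.exp (2 + |z.im|) := h2.trans (by gcongr)
          _ ≤ _ := by linarith
      · have hz2 : 1 / 2 ≤ ‖z‖ := hz1.trans (re_le_norm z)
        calc ‖z‖ ^ a ≤ ‖z‖ ^ (-|a|) :=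
              Real.rpow_le_rpow_of_exponent_ge (by linarith) h1 (neg_abs_le a)
          _ ≤ (1 / 2) ^ (-|a|) :=
              Real.rpow_le_rpow_of_nonpos (by norm_num) hz2 (by simp)
          _ ≤ _ := by
              have : 0 ≤ (⌈a⌉₊.factorial : ℝ) * Real.exp (2 + |z.im|) := by positivity
              linarith
    · intro z hz
      refine le_trans ?_ (le_max_left _ _)
      have hz' : z = 1 / 2 + (z.im : ℂ) * I := by
        apply Complex.ext <;> simp [hz]
      have h1 : ‖L z‖ ≤ C₁ * (1 + |z.im|) ^ (θ + 1) := by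
        have := hC₁ z.im; rwa [← hz'] at this
      have h2 : (1 + |z.im|) / 2 ≤ ‖z + 1‖ := by
        have e1 : (3 : ℝ) / 2 ≤ ‖z + 1‖ := by
          calc (3 : ℝ) / 2 = (z + 1).re := by simp [hz]; norm_num
            _ ≤ _ := re_le_norm _
        have e2 : |z.im| ≤ ‖z + 1‖ := by simpa using abs_im_le_norm (z + 1)
        linarith
      rw [hF]; simp only
      rw [norm_div, norm_pow, div_le_iff₀ (pow_pos (by linarith [hone z (by rw [hz])]) _)]
      calc ‖L z‖ ≤ C₁ * (1 + |z.im|) ^ (J : ℝ) := by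
            refine h1.trans ?_
            gcongr
            linarith [abs_nonneg z.im]
        _ = C₁ * 2 ^ J * ((1 + |z.im|) / 2) ^ J := by
            rw [Real.rpow_natCast, div_pow]; field_simp
        _ ≤ _ := by gcongr
    · intro z hz
      refine le_trans (hFle z (by rw [hz]; norm_num)) (le_trans ?_ (le_max_right _ _))
      have hz1 : 1 < z.re := by rw [hz]; norm_num
      have hs2 : LSeriesSummable A 2 := hL.lseriesSummable (by norm_num)
      rw [← (hL.dirichlet_series z hz1).LSeries_eq]
      have hn : ∀ n, ‖LSeries.term A z n‖ = ‖LSeries.term A 2 n‖ := fun n => by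
        simp only [LSeries.norm_term_eq, hz]; simp
      calc ‖LSeries A z‖ ≤ ∑' n, ‖LSeries.term A z n‖ :=
            norm_tsum_le_tsum_norm (by simpa only [hn] using hs2.norm)
        _ = B := tsum_congr hn
  refine ⟨max (C₁ * 2 ^ J) B * 3 ^ J, J, by positivity, fun s hs1 hs2 => ?_⟩
  have h := hbound s hs1 hs2
  rw [hF] at h; simp only at h
  rw [norm_div, norm_pow, div_le_iff₀ (pow_pos (by linarith [hone s hs1]) _)] at h
  calc ‖L s‖ ≤ max (C₁ * 2 ^ J) B * ‖s + 1‖ ^ J := h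
    _ ≤ max (C₁ * 2 ^ J) B * (3 * (1 + |s.im|)) ^ J := by
      gcongr
      refine (norm_le_abs_re_add_abs_im _).trans ?_
      simp only [add_re, one_re, add_im, one_im, add_zero]
      rw [abs_of_nonneg (by linarith)]
      linarith [abs_nonneg s.im]
    _ = _ := by rw [mul_pow]; ring

/-- Bound on the critical line for smoothly truncated Dirichlet series of an entire function. -/
theorem exists_norm_tsum_smooth_le {φ : ℝ → ℂ} {R : ℝ} (hd : ContDiff ℝ (⊤ : ℕ∞) φ)
    (hs : ∀ v, R < |v| → φ v = 0) {β : ℝ} (hβ : 0 ≤ β) :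
    ∃ C : ℝ, 0 ≤ C ∧ ∀ (f : ℂ → ℂ) (a : ℕ → ℂ) (B ℓ : ℝ), 1 ≤ ℓ → Differentiable ℂ f →
      (∃ (C' : ℝ) (J : ℕ), 0 ≤ C' ∧ ∀ s : ℂ, 1 / 2 ≤ s.re → s.re ≤ 2 →
        ‖f s‖ ≤ C' * (1 + |s.im|) ^ J) →
      (∀ s : ℂ, 1 < s.re → LSeriesHasSum a s (f s)) →
      (∀ t : ℝ, ‖f (1 / 2 + t * I)‖ ≤ B * (1 + |t|) ^ β) →
      ∀ (t : ℝ) (K : ℕ), (∀ k : ℕ, K < k → φ (Real.log k / ℓ) = 0) →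
        ‖∑ k ∈ Finset.Icc 1 K, φ (Real.log k / ℓ) * LSeries.term a (1 / 2 + t * I) k‖ ≤
          C * (B * (1 + |t|) ^ β) := by
  -- Decay of order ⌈β⌉ absorbs the growth (1 + |y|)^β of f along the line, and two more powers make
  -- the integral converge.
  set n : ℕ := ⌈β⌉₊ + 2 with hn
  obtain ⟨C₀, hC₀, hb₀⟩ := exists_norm_twoSidedLaplace_le n hd hs
  refine ⟨C₀, hC₀, ?_⟩
  rintro f a B ℓ hℓ hf ⟨C', J, hC', hgrow⟩ hser hline t K hK
  have hℓ0 : 0 < ℓ := by linarith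
  have hℓc : (ℓ : ℂ) ≠ 0 := by exact_mod_cast hℓ0.ne'
  have hB : 0 ≤ B := by simpa using (norm_nonneg _).trans (hline 0)
  set Φ := twoSidedLaplace φ with hΦ
  have hΦd : Differentiable ℂ Φ := differentiable_twoSidedLaplace hd.continuous hs
  set s₀ : ℂ := 1 / 2 + t * I with hs₀
  -- With w = c + iy the argument s₀ + w/ℓ lies on the line Re s = 2.
  set c : ℝ := 3 / 2 * ℓ with hc
  have hc0 : 0 ≤ c := by positivity
  set h : ℂ → ℂ := fun w => Φ w * f (s₀ + w / ℓ) with hh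
  have hhd : Differentiable ℂ h := hΦd.mul (hf.comp (by fun_prop))
  -- the generating integral on the line of absolute convergence
  have hseries : HasSum (fun k : ℕ => ∫ y : ℝ, Φ (c + y * I) *
      LSeries.term a (s₀ + (c + y * I) / ℓ) k) (∫ y : ℝ, h (c + y * I)) := by
    have hre : ∀ y : ℝ, (s₀ + (c + y * I) / ℓ).re = 2 := fun y => by
      rw [hs₀, add_re, div_ofReal_re]
      simp only [add_re, one_re, div_ofNat_re, mul_re, ofReal_re, I_re, mul_zero, ofReal_im, I_im,
        mul_one, sub_self, add_zero, hc]
      field_simp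
      norm_num
    have hnt : ∀ (y : ℝ) (k : ℕ),
        ‖LSeries.term a (s₀ + (c + y * I) / ℓ) k‖ = ‖LSeries.term a 2 k‖ := fun y k => by
      simp only [LSeries.norm_term_eq, hre]; simp
    have hΦi : Integrable fun y : ℝ => Φ (c + y * I) := by
      obtain ⟨C, hC, hb⟩ := exists_norm_twoSidedLaplace_le 2 hd hs
      refine (integrable_inv_one_add_sq.const_mul (C * Real.exp (R * |c|))).mono'
        (hΦd.continuous.comp (by fun_prop)).aestronglyMeasurable (Eventually.of_forall fun y => ?_)
      refine (hb _).trans ?_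
      simp only [add_re, ofReal_re, mul_re, I_re, mul_zero, ofReal_im, I_im, mul_one, sub_self,
        add_zero, add_im, mul_im, zero_add]
      rw [div_eq_mul_inv]
      gcongr
      nlinarith [abs_nonneg y, sq_abs y]
    have h2 : LSeriesSummable a 2 := (hser 2 (by norm_num)).LSeriesSummable
    have hmeas : ∀ k, Continuous fun y : ℝ => LSeries.term a (s₀ + (c + y * I) / ℓ) k := by
      intro k
      rcases eq_or_ne k 0 with rfl | hk
      · simp only [LSeries.term_zero]; exact continuous_const
      have hk0 : (k : ℂ) ≠ 0 := by exact_mod_cast hk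
      simp only [LSeries.term_of_ne_zero hk]
      refine continuous_const.div ?_ fun y => by simp [cpow_eq_zero_iff, hk]
      exact Continuous.const_cpow (by fun_prop) (Or.inl hk0)
    have hsum := hasSum_integral_of_summable_integral_norm (μ := volume)
      (F := fun (k : ℕ) (y : ℝ) => Φ (c + y * I) * LSeries.term a (s₀ + (c + y * I) / ℓ) k)
      (fun k => by
        refine (hΦi.norm.mul_const ‖LSeries.term a 2 k‖).mono'
          (hΦi.aestronglyMeasurable.mul (hmeas k).aestronglyMeasurable)
          (Eventually.of_forall fun y => ?_)
        rw [norm_mul, hnt])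
      (by
        simp_rw [norm_mul, hnt, integral_mul_const]
        exact h2.norm.mul_left _)
    have he : ∀ y : ℝ, h (c + y * I) =
        ∑' k, Φ (c + y * I) * LSeries.term a (s₀ + (c + y * I) / ℓ) k := fun y => by
      rw [tsum_mul_left, hh]
      simp only
      rw [← (hser (s₀ + (c + y * I) / ℓ) (by rw [hre]; norm_num)).LSeries_eq, LSeries]
    simp_rw [he]
    exact hsum
  -- Laplace inversion at v = log k / ℓ: the factor k^{-w/ℓ} is exp(-wv), so integrating the k-th
  -- term restores the weight φ.
  have hterm : ∀ k : ℕ, ∫ y : ℝ, Φ (c + y * I) * LSeries.term a (s₀ + (c + y * I) / ℓ) k =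
      2 * Real.pi * (φ (Real.log k / ℓ) * LSeries.term a s₀ k) := by
    intro k
    rcases eq_or_ne k 0 with rfl | hk
    · simp
    have hk0 : (k : ℂ) ≠ 0 := by exact_mod_cast hk
    rw [← mul_assoc, ← integral_twoSidedLaplace_mul_cexp hd hs c, ← integral_mul_const]
    refine integral_congr_ae (Eventually.of_forall fun y => ?_)
    simp only
    rw [mul_assoc]
    congr 1
    rw [LSeries.term_of_ne_zero hk, LSeries.term_of_ne_zero hk, cpow_add _ _ hk0,
      cpow_def_of_ne_zero hk0 ((c + y * I) / ℓ), Complex.exp_neg, ← natCast_log]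
    have : ((Real.log k / ℓ : ℝ) : ℂ) = Real.log k / ℓ := by push_cast; rfl
    rw [this, show (c + y * I) * (Real.log k / ℓ) = (Real.log k : ℂ) * ((c + y * I) / ℓ) by ring]
    have := Complex.exp_ne_zero ((Real.log k : ℂ) * ((c + y * I) / ℓ))
    field_simp
  have hfin : HasSum (fun k : ℕ => 2 * Real.pi * (φ (Real.log k / ℓ) * LSeries.term a s₀ k))
      (∑ k ∈ Finset.Icc 1 K, 2 * Real.pi * (φ (Real.log k / ℓ) * LSeries.term a s₀ k)) := by
    refine hasSum_sum_of_ne_finset_zero fun k hk => ?_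
    rcases eq_or_ne k 0 with rfl | hk0
    · simp
    · rw [hK k (by
        by_contra! h
        exact hk (Finset.mem_Icc.mpr ⟨Nat.pos_of_ne_zero hk0, h⟩))]
      simp
  simp_rw [hterm] at hseries
  have heq := hfin.unique hseries
  rw [← Finset.mul_sum] at heq
  -- shift to the critical line
  have hshift : ∫ y : ℝ, h (y * I) = ∫ y : ℝ, h (c + y * I) := by
    -- J + 2 powers of decay beat the polynomial growth of f in the strip. This constant may depend
    -- on t and ℓ, since it only justifies the shift and does not enter the final bound.
    obtain ⟨C₁, hC₁, hb₁⟩ := exists_norm_twoSidedLaplace_le (J + 2) hd hs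
    refine integral_vertical_line_eq hhd hc0
      (C := C₁ * Real.exp (|R| * c) * (C' * (1 + |t|) ^ J)) fun x hx y => ?_
    have hre : (s₀ + (x + y * I) / ℓ).re = 1 / 2 + x / ℓ := by
      rw [hs₀, add_re, div_ofReal_re]
      simp
    have him : (s₀ + (x + y * I) / ℓ).im = t + y / ℓ := by
      rw [hs₀, add_im, div_ofReal_im]
      simp
    have hx1 : 0 ≤ x / ℓ := div_nonneg hx.1 hℓ0.le
    have hx2 : x / ℓ ≤ 3 / 2 := by rw [div_le_iff₀ hℓ0]; exact hx.2
    have hf1 := hgrow (s₀ + (x + y * I) / ℓ) (by rw [hre]; linarith) (by rw [hre]; linarith)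
    rw [him] at hf1
    have hyl : |y / ℓ| ≤ |y| := by
      rw [abs_div, abs_of_pos hℓ0]; exact div_le_self (abs_nonneg _) hℓ
    have hf2 : 1 + |t + y / ℓ| ≤ (1 + |t|) * (1 + |y|) := by
      have := abs_add_le t (y / ℓ)
      nlinarith [abs_nonneg t, abs_nonneg y]
    have hΦ1 := hb₁ (x + y * I)
    simp only [add_re, ofReal_re, mul_re, I_re, mul_zero, ofReal_im, I_im, mul_one, sub_self,
      add_zero, add_im, mul_im, zero_add] at hΦ1
    have hy1 : 1 + y ^ 2 ≤ (1 + |y|) ^ 2 := by nlinarith [abs_nonneg y, sq_abs y]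
    have hexp : R * |x| ≤ |R| * c := by
      rw [abs_of_nonneg hx.1]
      exact mul_le_mul (le_abs_self R) hx.2 hx.1 (abs_nonneg R)
    rw [hh]; simp only
    rw [norm_mul]
    calc ‖Φ (x + y * I)‖ * ‖f (s₀ + (x + y * I) / ℓ)‖
        ≤ (C₁ * Real.exp (|R| * c) / (1 + |y|) ^ (J + 2)) *
          (C' * ((1 + |t|) * (1 + |y|)) ^ J) := by
          refine mul_le_mul (hΦ1.trans ?_) (hf1.trans ?_) (norm_nonneg _) (by positivity)
          · gcongr
          · gcongr
      _ = C₁ * Real.exp (|R| * c) * (C' * (1 + |t|) ^ J) / (1 + |y|) ^ 2 := by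
          rw [mul_pow, pow_add]; field_simp
      _ ≤ _ := by gcongr
  rw [← hshift] at heq
  have hpi : (0 : ℝ) < 2 * Real.pi := by positivity
  have hfinal : ‖∫ y : ℝ, h (y * I)‖ ≤ ∫ y : ℝ, C₀ * (B * (1 + |t|) ^ β) * (1 + y ^ 2)⁻¹ := by
    refine norm_integral_le_of_norm_le (integrable_inv_one_add_sq.const_mul _)
      (Eventually.of_forall fun y => ?_)
    have hΦ1 := hb₀ (y * I)
    simp only [mul_re, ofReal_re, I_re, mul_zero, ofReal_im, I_im, mul_one, sub_self, abs_zero,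
      Real.exp_zero, mul_im, add_zero] at hΦ1
    have harg : s₀ + (y * I) / ℓ = 1 / 2 + ((t + y / ℓ : ℝ) : ℂ) * I := by
      rw [hs₀]; push_cast; ring
    have hyl : |y / ℓ| ≤ |y| := by
      rw [abs_div, abs_of_pos hℓ0]; exact div_le_self (abs_nonneg _) hℓ
    -- Submultiplicativity together with ℓ ≥ 1 makes the bound on the critical line uniform in ℓ.
    have hf2 : 1 + |t + y / ℓ| ≤ (1 + |t|) * (1 + |y|) := by
      have := abs_add_le t (y / ℓ)
      nlinarith [abs_nonneg t, abs_nonneg y]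
    have hy1 : 1 + y ^ 2 ≤ (1 + |y|) ^ 2 := by nlinarith [abs_nonneg y, sq_abs y]
    have hy2 : (1 + |y|) ^ β ≤ (1 + |y|) ^ ⌈β⌉₊ := by
      rw [← Real.rpow_natCast]
      exact Real.rpow_le_rpow_of_exponent_le (by linarith [abs_nonneg y]) (Nat.le_ceil β)
    rw [hh]; simp only
    rw [norm_mul, harg]
    calc ‖Φ (y * I)‖ * ‖f (1 / 2 + ((t + y / ℓ : ℝ) : ℂ) * I)‖
        ≤ (C₀ / (1 + |y|) ^ n) * (B * ((1 + |t|) ^ β * (1 + |y|) ^ ⌈β⌉₊)) := by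
          refine mul_le_mul hΦ1 ((hline _).trans ?_) (norm_nonneg _) (by positivity)
          gcongr
          calc (1 + |t + y / ℓ|) ^ β ≤ ((1 + |t|) * (1 + |y|)) ^ β := by gcongr
            _ = (1 + |t|) ^ β * (1 + |y|) ^ β := Real.mul_rpow (by positivity) (by positivity)
            _ ≤ _ := by gcongr
      _ = C₀ * (B * (1 + |t|) ^ β) * ((1 + |y|) ^ 2)⁻¹ := by
          rw [hn, pow_add]; field_simp
      _ ≤ _ := by gcongr
  rw [integral_const_mul, integral_univ_inv_one_add_sq] at hfinal
  have : ‖∑ k ∈ Finset.Icc 1 K, φ (Real.log k / ℓ) * LSeries.term a s₀ k‖ * (2 * Real.pi) ≤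
      C₀ * (B * (1 + |t|) ^ β) * Real.pi := by
    calc _ = ‖(2 * Real.pi : ℂ) * ∑ k ∈ Finset.Icc 1 K, φ (Real.log k / ℓ) *
          LSeries.term a s₀ k‖ := by
          rw [norm_mul, mul_comm]
          congr 1
          rw [← ofReal_ofNat, ← ofReal_mul, norm_real, Real.norm_of_nonneg hpi.le]
      _ ≤ _ := by rw [heq]; exact hfinal
  have hnn := norm_nonneg (∑ k ∈ Finset.Icc 1 K, φ (Real.log k / ℓ) * LSeries.term a s₀ k)
  have hpos := Real.pi_pos
  nlinarith

end

/-! ### Coprime smooth sums and Möbius separation -/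

section

open MeasureTheory Complex

/-- The character `n ↦ n^{-1/2-it}`. -/
noncomputable def critChar (t : ℝ) (n : ℕ) : ℂ := ((√(n : ℝ))⁻¹ : ℝ) * cexp (-(t * Real.log n * I))

theorem norm_critChar (t : ℝ) (n : ℕ) : ‖critChar t n‖ = (√(n : ℝ))⁻¹ := by
  rw [critChar, norm_mul, norm_real, Real.norm_of_nonneg (by positivity), ← ofReal_mul, ← neg_mul,
    ← ofReal_neg, norm_exp_ofReal_mul_I, mul_one]

theorem norm_critChar_sq (t : ℝ) (n : ℕ) : ‖critChar t n‖ ^ 2 = (n : ℝ)⁻¹ := by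
  rw [norm_critChar, inv_pow, Real.sq_sqrt (Nat.cast_nonneg n)]

theorem critChar_mul (t : ℝ) {m n : ℕ} (hm : m ≠ 0) (hn : n ≠ 0) :
    critChar t (m * n) = critChar t m * critChar t n := by
  simp only [critChar]
  rw [Nat.cast_mul, Real.sqrt_mul (Nat.cast_nonneg m),
    Real.log_mul (by exact_mod_cast hm) (by exact_mod_cast hn), mul_inv, mul_mul_mul_comm,
    ← Complex.exp_add]
  push_cast
  congr 2
  ring

theorem critChar_eq_cpow (t : ℝ) {n : ℕ} (hn : n ≠ 0) :
    critChar t n = ((n : ℂ) ^ (1 / 2 + t * I : ℂ))⁻¹ := by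
  have hn0 : (n : ℂ) ≠ 0 := by exact_mod_cast hn
  rw [critChar, cpow_add _ _ hn0, mul_inv, cpow_def_of_ne_zero hn0 (t * I), ← Complex.exp_neg,
    ← natCast_log]
  congr 1
  · rw [Real.sqrt_eq_rpow, ofReal_inv, ofReal_cpow (Nat.cast_nonneg n)]
    push_cast; rfl
  · congr 1; ring

theorem continuous_critChar (n : ℕ) : Continuous fun t => critChar t n := by
  unfold critChar; fun_prop

/-- Apply `exists_norm_tsum_smooth_le` to L times the finite product of inverse local factors at the
primes dividing m. That product is at most 2^{dω(m)} ≪ m^ε on Re s ≥ 1/2, so the coprimality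
condition is nearly free and the bound is uniform in m. -/
theorem IsLFunction.exists_norm_coprime_smooth_sum_le {A : ℕ → ℂ} {L : ℂ → ℂ} {d : ℕ}
    (hL : IsLFunction A L d) {θ : ℝ} (hθ : IsSubconvexityExponent L θ) {φ : ℝ → ℂ} {R : ℝ}
    (hd : ContDiff ℝ (⊤ : ℕ∞) φ) (hs : ∀ v, R < |v| → φ v = 0) {ε : ℝ} (hε : 0 < ε) :
    ∃ C : ℝ, 0 ≤ C ∧ ∀ (m : ℕ) (ℓ t : ℝ) (K : ℕ), m ≠ 0 → 1 ≤ ℓ →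
      (∀ k : ℕ, K < k → φ (Real.log k / ℓ) = 0) →
      ‖∑ k ∈ Finset.Icc 1 K, if m.Coprime k then A k * φ (Real.log k / ℓ) * critChar t k else 0‖ ≤
        C * ((m : ℝ) ^ ε * (1 + |t|) ^ (θ + ε)) := by
  obtain ⟨C₁, hC₁, h₁⟩ := exists_norm_tsum_smooth_le hd hs (β := θ + ε) (by linarith [hθ.1])
  obtain ⟨C₂, hC₂, h₂⟩ := exists_two_pow_mul_card_primeFactors_le d hε
  obtain ⟨C₃, h₃⟩ := hθ.2 ε hε
  obtain ⟨C₄, J, hC₄, h₄⟩ := hL.exists_norm_le_strip hθ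
  have hC₃ : 0 ≤ C₃ := by simpa using (norm_nonneg _).trans (h₃ 0)
  refine ⟨C₁ * (C₃ * C₂), by positivity, fun m ℓ t K hm hℓ hK => ?_⟩
  obtain ⟨g, hgd, hgb, hgs⟩ := hL.exists_coprime_lseries hm
  set G : ℝ := (2 : ℝ) ^ (d * m.primeFactors.card) with hG
  have h := h₁ (fun s => L s * g s) (fun k => if k.Coprime m then A k else 0) (C₃ * G) ℓ hℓ
    (hL.entire.mul hgd)
    ⟨C₄ * G, J, by positivity, fun s h1 h2 => by
      rw [norm_mul, mul_right_comm]
      exact mul_le_mul (h₄ s h1 h2) (hgb s h1) (norm_nonneg _) (by positivity)⟩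
    hgs
    (fun t => by
      rw [norm_mul, mul_right_comm]
      exact mul_le_mul (h₃ t) (hgb _ (by simp)) (norm_nonneg _) (by positivity)) t K hK
  calc _ = ‖∑ k ∈ Finset.Icc 1 K, φ (Real.log k / ℓ) *
        LSeries.term (fun k => if k.Coprime m then A k else 0) (1 / 2 + t * I) k‖ := by
        congr 1
        refine Finset.sum_congr rfl fun k hk => ?_
        have hk0 : k ≠ 0 := by have := (Finset.mem_Icc.mp hk).1; omega
        rw [LSeries.term_of_ne_zero hk0, critChar_eq_cpow t hk0]
        simp only [Nat.coprime_comm (n := k)]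
        split_ifs
        · ring
        · simp
    _ ≤ _ := h
    _ ≤ C₁ * (C₃ * (C₂ * (m : ℝ) ^ ε) * (1 + |t|) ^ (θ + ε)) := by
        gcongr
        exact h₂ m hm
    _ = _ := by ring

open ArithmeticFunction in
theorem sum_moebius_filter_dvd_eq {m k N : ℕ} (hm : m ≠ 0) (hmN : m ≤ N) :
    ∑ e ∈ Finset.Icc 1 N, (if e ∣ m ∧ e ∣ k then ((moebius e : ℤ) : ℂ) else 0) =
      if m.Coprime k then 1 else 0 := by
  have hg : m.gcd k ≠ 0 := fun h => hm (Nat.eq_zero_of_gcd_eq_zero_left h)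
  have h1 : ∑ e ∈ Finset.Icc 1 N, (if e ∣ m ∧ e ∣ k then ((moebius e : ℤ) : ℂ) else 0) =
      ∑ e ∈ (m.gcd k).divisors, ((moebius e : ℤ) : ℂ) := by
    rw [← Finset.sum_filter]
    refine Finset.sum_congr ?_ fun _ _ => rfl
    ext e
    simp only [Finset.mem_filter, Finset.mem_Icc, Nat.mem_divisors, Nat.dvd_gcd_iff]
    constructor
    · rintro ⟨_, h⟩; exact ⟨h, hg⟩
    · rintro ⟨h, _⟩
      exact ⟨⟨Nat.pos_of_dvd_of_pos h.1 (Nat.pos_of_ne_zero hm),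
        (Nat.le_of_dvd (Nat.pos_of_ne_zero hm) h.1).trans hmN⟩, h⟩
  rw [h1]
  have h2 : ∑ e ∈ (m.gcd k).divisors, moebius e = if m.gcd k = 1 then 1 else 0 := by
    rw [← coe_mul_zeta_apply, moebius_mul_coe_zeta, one_apply]
  rw [← Int.cast_sum, h2]
  simp only [Nat.Coprime]
  split_ifs <;> simp

theorem norm_sum_mul_sq_le {ι : Type*} (s : Finset ι) (f g : ι → ℂ) :
    ‖∑ i ∈ s, f i * g i‖ ^ 2 ≤ (∑ i ∈ s, ‖f i‖ ^ 2) * ∑ i ∈ s, ‖g i‖ ^ 2 := by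
  calc ‖∑ i ∈ s, f i * g i‖ ^ 2 ≤ (∑ i ∈ s, ‖f i‖ * ‖g i‖) ^ 2 := by
        gcongr
        refine (norm_sum_le _ _).trans_eq ?_
        simp_rw [norm_mul]
    _ ≤ _ := Finset.sum_mul_sq_le_sq_mul_sq _ _ _

/-- Separating a coprimality condition by Möbius inversion and Cauchy-Schwarz. -/
theorem norm_sum_coprime_sq_le (S T : Finset ℕ) (u v : ℕ → ℂ) {N : ℕ}
    (hS : ∀ m ∈ S, m ≠ 0 ∧ m ≤ N) :
    ‖∑ m ∈ S, ∑ k ∈ T, if m.Coprime k then u m * v k else 0‖ ^ 2 ≤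
      (∑ e ∈ Finset.Icc 1 N, ‖∑ m ∈ S with e ∣ m, u m‖ ^ 2) *
        ∑ e ∈ Finset.Icc 1 N, ‖∑ k ∈ T with e ∣ k, v k‖ ^ 2 := by
  have h : ∑ m ∈ S, ∑ k ∈ T, (if m.Coprime k then u m * v k else 0) =
      ∑ e ∈ Finset.Icc 1 N, (((ArithmeticFunction.moebius e : ℤ) : ℂ) * ∑ m ∈ S with e ∣ m, u m) *
        ∑ k ∈ T with e ∣ k, v k := by
    have h1 : ∀ e : ℕ, (((ArithmeticFunction.moebius e : ℤ) : ℂ) * ∑ m ∈ S with e ∣ m, u m) *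
        ∑ k ∈ T with e ∣ k, v k = ∑ m ∈ S, ∑ k ∈ T, ((ArithmeticFunction.moebius e : ℤ) : ℂ) *
          ((if e ∣ m then u m else 0) * (if e ∣ k then v k else 0)) := fun e => by
      rw [Finset.sum_filter, Finset.sum_filter, mul_assoc, Finset.sum_mul_sum]
      simp only [Finset.mul_sum]
    simp only [h1]
    symm
    rw [Finset.sum_comm]
    refine Finset.sum_congr rfl fun m hm => ?_
    rw [Finset.sum_comm]
    refine Finset.sum_congr rfl fun k _ => ?_
    symm
    have := sum_moebius_filter_dvd_eq (k := k) (hS m hm).1 (hS m hm).2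
    calc _ = (if m.Coprime k then (1 : ℂ) else 0) * (u m * v k) := by split_ifs <;> simp
      _ = _ := by
        rw [← this, Finset.sum_mul]
        refine Finset.sum_congr rfl fun e _ => ?_
        by_cases h1 : e ∣ m <;> by_cases h2 : e ∣ k <;> simp [h1, h2]
  rw [h]
  refine (norm_sum_mul_sq_le _ _ _).trans ?_
  gcongr with e
  rw [norm_mul]
  refine mul_le_of_le_one_left (norm_nonneg _) ?_
  rw [norm_intCast]
  exact_mod_cast ArithmeticFunction.abs_moebius_le_one

theorem card_filter_dvd_le (S : Finset ℕ) {N e : ℕ} (hS : ∀ m ∈ S, m ≠ 0 ∧ m ≤ N) :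
    ((S.filter (e ∣ ·)).card : ℝ) ≤ N / e := by
  have h : (S.filter (e ∣ ·)).card ≤ N / e := by
    rw [← Nat.Ioc_filter_dvd_card_eq_div]
    refine Finset.card_le_card fun m hm => ?_
    obtain ⟨h1, h2⟩ := Finset.mem_filter.mp hm
    exact Finset.mem_filter.mpr ⟨Finset.mem_Ioc.mpr ⟨Nat.pos_of_ne_zero (hS m h1).1, (hS m h1).2⟩, h2⟩
  calc ((S.filter (e ∣ ·)).card : ℝ) ≤ ((N / e : ℕ) : ℝ) := by exact_mod_cast h
    _ ≤ _ := Nat.cast_div_le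

theorem sum_sum_filter_dvd_le (E S : Finset ℕ) (f : ℕ → ℝ) (hf : ∀ m ∈ S, 0 ≤ f m)
    (hS : ∀ m ∈ S, m ≠ 0) :
    ∑ e ∈ E, ∑ m ∈ S with e ∣ m, f m ≤ ∑ m ∈ S, (m.divisors.card : ℝ) * f m := by
  simp_rw [Finset.sum_filter]
  rw [Finset.sum_comm]
  refine Finset.sum_le_sum fun m hm => ?_
  rw [← Finset.sum_filter, Finset.sum_const, nsmul_eq_mul]
  have := hf m hm
  gcongr
  intro e he
  exact Nat.mem_divisors.mpr ⟨(Finset.mem_filter.mp he).2, hS m hm⟩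

/-- Cauchy-Schwarz over the at most N/e ≤ N/r multiples of e, then an interchange of sums that
produces the divisor function. The factor 1/r is the saving for large e. -/
theorem sum_norm_sq_filter_dvd_le (S E : Finset ℕ) (u : ℕ → ℂ) {N : ℕ} {r : ℝ} (hr : 0 < r)
    (hS : ∀ m ∈ S, m ≠ 0 ∧ m ≤ N) (hE : ∀ e ∈ E, r ≤ e) :
    ∑ e ∈ E, ‖∑ m ∈ S with e ∣ m, u m‖ ^ 2 ≤
      N / r * ∑ m ∈ S, (m.divisors.card : ℝ) * ‖u m‖ ^ 2 := by
  calc ∑ e ∈ E, ‖∑ m ∈ S with e ∣ m, u m‖ ^ 2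
      ≤ ∑ e ∈ E, N / r * ∑ m ∈ S with e ∣ m, ‖u m‖ ^ 2 := by
        refine Finset.sum_le_sum fun e he => ?_
        have h := norm_sum_mul_sq_le (S.filter (e ∣ ·)) (fun _ => 1) u
        simp only [one_mul, norm_one, one_pow, Finset.sum_const, nsmul_eq_mul, mul_one] at h
        refine h.trans ?_
        gcongr
        refine (card_filter_dvd_le S hS).trans ?_
        gcongr
        exact hE e he
    _ = N / r * ∑ e ∈ E, ∑ m ∈ S with e ∣ m, ‖u m‖ ^ 2 := by rw [Finset.mul_sum]
    _ ≤ _ := by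
        gcongr
        exact sum_sum_filter_dvd_le E S _ (fun _ _ => by positivity) fun m hm => (hS m hm).1

end

/-! ### Mean values, large values and the bilinear mean square -/

section

open MeasureTheory Complex

theorem mul_critChar (z : ℂ) (t : ℝ) (n : ℕ) :
    z * critChar t n = z * ((√(n : ℝ))⁻¹ : ℝ) * cexp (-(t * Real.log n * I)) := by
  rw [critChar, ← mul_assoc]

theorem norm_mul_inv_sqrt_sq (z : ℂ) (n : ℕ) : ‖z * ((√(n : ℝ))⁻¹ : ℝ)‖ ^ 2 = ‖z‖ ^ 2 / n := by
  rw [norm_mul, norm_real, Real.norm_of_nonneg (by positivity), mul_pow, inv_pow,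
    Real.sq_sqrt (Nat.cast_nonneg n), div_eq_mul_inv]

theorem norm_mul_critChar_sq (z : ℂ) (t : ℝ) (n : ℕ) : ‖z * critChar t n‖ ^ 2 = ‖z‖ ^ 2 / n := by
  rw [norm_mul, mul_pow, norm_critChar_sq, div_eq_mul_inv]

theorem norm_sum_critChar_le (S : Finset ℕ) (b : ℕ → ℂ) (t : ℝ) :
    ‖∑ k ∈ S, b k * critChar t k‖ ≤ ∑ k ∈ S, ‖b k‖ * (√(k : ℝ))⁻¹ := by
  refine (norm_sum_le _ _).trans_eq (Finset.sum_congr rfl fun k _ => ?_)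
  rw [norm_mul, norm_critChar]

theorem continuous_sum_critChar (S : Finset ℕ) (b : ℕ → ℂ) :
    Continuous fun t => ∑ k ∈ S, b k * critChar t k :=
  continuous_finsetSum _ fun k _ => continuous_const.mul (continuous_critChar k)

theorem measurableSet_large_values (S : Finset ℕ) (b : ℕ → ℂ) (T W : ℝ) :
    MeasurableSet {t : ℝ | |t| ≤ T ∧ W < ‖∑ m ∈ S, b m * critChar t m‖ ^ 2} := by
  have hc : Continuous fun t : ℝ => ‖∑ m ∈ S, b m * critChar t m‖ ^ 2 := by
    have := continuous_sum_critChar S b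
    fun_prop
  exact (isClosed_le continuous_abs continuous_const).measurableSet.inter
    (isOpen_lt continuous_const hc).measurableSet

theorem integrable_real_div_sq_add_sq {a : ℝ} (ha : 0 < a) {f : ℝ → ℝ} (hf : Continuous f) {C : ℝ}
    (hC : ∀ t, |f t| ≤ C) : Integrable fun t : ℝ => f t / (a ^ 2 + t ^ 2) := by
  refine ((integrable_inv_sq_add_sq ha).const_mul C).mono' ?_ (Filter.Eventually.of_forall fun t => ?_)
  · exact (hf.div (by fun_prop) fun t => by positivity).aestronglyMeasurable
  · rw [norm_div, Real.norm_eq_abs, Real.norm_of_nonneg (by positivity), mul_one_div]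
    gcongr
    exact hC t

theorem integrable_norm_sum_critChar_pow_div (S : Finset ℕ) (b : ℕ → ℂ) (j : ℕ) {a : ℝ}
    (ha : 0 < a) :
    Integrable fun t : ℝ => ‖∑ k ∈ S, b k * critChar t k‖ ^ j / (a ^ 2 + t ^ 2) := by
  refine integrable_real_div_sq_add_sq ha (C := (∑ k ∈ S, ‖b k‖ * (√(k : ℝ))⁻¹) ^ j)
    ((continuous_sum_critChar S b).norm.pow j) fun t => ?_
  rw [abs_of_nonneg (by positivity)]
  gcongr
  exact norm_sum_critChar_le S b t

/-- The mean value theorem for each e separately, with simple frequencies (D = 1). Summing over e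
costs only the number of divisors of k. -/
theorem integral_sum_norm_sq_filter_dvd_le (E T : Finset ℕ) (b : ℕ → ℂ) {K : ℕ} (hK : 1 ≤ K)
    (hT : ∀ k ∈ T, 1 ≤ k ∧ k ≤ K) {a : ℝ} (ha : 0 < a) :
    Integrable (fun t : ℝ => (∑ e ∈ E, ‖∑ k ∈ T with e ∣ k, b k * critChar t k‖ ^ 2) /
      (a ^ 2 + t ^ 2)) ∧
    ∫ t : ℝ, (∑ e ∈ E, ‖∑ k ∈ T with e ∣ k, b k * critChar t k‖ ^ 2) / (a ^ 2 + t ^ 2) ≤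
      Real.pi / a * (1 + 2 * K / a) * ∑ k ∈ T, (k.divisors.card : ℝ) * (‖b k‖ ^ 2 / k) := by
  have hi : ∀ e ∈ E, Integrable fun t : ℝ =>
      ‖∑ k ∈ T with e ∣ k, b k * critChar t k‖ ^ 2 / (a ^ 2 + t ^ 2) :=
    fun e _ => integrable_norm_sum_critChar_pow_div _ b 2 ha
  simp_rw [Finset.sum_div]
  refine ⟨integrable_finsetSum _ hi, ?_⟩
  rw [integral_finsetSum _ hi]
  calc _ ≤ ∑ e ∈ E, Real.pi / a * (1 + 2 * K / a) * ∑ k ∈ T with e ∣ k, ‖b k‖ ^ 2 / k := by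
        refine Finset.sum_le_sum fun e _ => ?_
        have h := integral_norm_sq_dirichletPoly_div_le (T.filter (e ∣ ·))
          (fun k => b k * ((√(k : ℝ))⁻¹ : ℝ)) id ha hK
          (fun k hk => hT k (Finset.mem_filter.mp hk).1) (D := 1) (fun n _ => by
            rw [Nat.cast_le_one, Finset.card_le_one]
            intro x hx y hy
            have h1 := (Finset.mem_filter.mp hx).2
            have h2 := (Finset.mem_filter.mp hy).2
            simp only [id] at h1 h2
            rw [h1, h2])
        simp only [id, norm_mul_inv_sqrt_sq, one_mul] at h
        simp only [mul_critChar]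
        exact h
    _ = Real.pi / a * (1 + 2 * K / a) * ∑ e ∈ E, ∑ k ∈ T with e ∣ k, ‖b k‖ ^ 2 / k := by
        rw [Finset.mul_sum]
    _ ≤ _ := by
        gcongr
        exact sum_sum_filter_dvd_le E T _ (fun _ _ => by positivity) fun m hm => by
          have := (hT m hm).1; omega

/-- Every factor in a factorization of n is a divisor of n. This bounds the multiplicity of
frequencies in a k-th power. -/
theorem card_piFinset_prod_eq_le (S : Finset ℕ) (k : ℕ) {n : ℕ} (hn : n ≠ 0) :
    ((Fintype.piFinset fun _ : Fin k => S).filter fun τ => ∏ i, τ i = n).card ≤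
      n.divisors.card ^ k := by
  calc _ ≤ (Fintype.piFinset fun _ : Fin k => n.divisors).card := by
        refine Finset.card_le_card fun τ hτ => ?_
        obtain ⟨_, h2⟩ := Finset.mem_filter.mp hτ
        rw [Fintype.mem_piFinset]
        intro i
        rw [Nat.mem_divisors]
        exact ⟨h2 ▸ Finset.dvd_prod_of_mem τ (Finset.mem_univ i), hn⟩
    _ = _ := by simp [Fintype.card_piFinset]

/-- Mean value of a power of a Dirichlet polynomial. -/
theorem integral_norm_sum_pow_div_le (S : Finset ℕ) (b : ℕ → ℂ) {N : ℕ} (hN : 1 ≤ N)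
    (hS : ∀ m ∈ S, m ≠ 0 ∧ m ≤ N) (k : ℕ) {D : ℝ}
    (hD : ∀ n : ℕ, n ≠ 0 → n ≤ N ^ k → (n.divisors.card : ℝ) ^ k ≤ D) {T : ℝ} (hT : 0 < T) :
    ∫ t : ℝ, ‖∑ m ∈ S, b m * critChar t m‖ ^ (2 * k) / (T ^ 2 + t ^ 2) ≤
      Real.pi / T * (D * (1 + 2 * (N : ℝ) ^ k / T)) * (∑ m ∈ S, ‖b m‖ ^ 2 / m) ^ k := by
  have hpos : ∀ τ ∈ Fintype.piFinset (fun _ : Fin k => S), ∀ i, τ i ≠ 0 ∧ τ i ≤ N :=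
    fun τ hτ i => hS _ (Fintype.mem_piFinset.mp hτ i)
  have h := integral_norm_sq_dirichletPoly_div_le (Fintype.piFinset fun _ : Fin k => S)
    (fun τ => ∏ i, (b (τ i) * ((√(τ i : ℝ))⁻¹ : ℝ))) (fun τ => ∏ i, τ i) hT
    (N := N ^ k) (Nat.one_le_pow _ _ hN) (fun τ hτ => by
      refine ⟨Nat.one_le_iff_ne_zero.mpr (Finset.prod_ne_zero_iff.mpr fun i _ => (hpos τ hτ i).1), ?_⟩
      calc ∏ i, τ i ≤ ∏ _i : Fin k, N := Finset.prod_le_prod' fun i _ => (hpos τ hτ i).2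
        _ = _ := by simp) (D := D) (fun n hn => by
      obtain ⟨h1, h2⟩ := Finset.mem_Icc.mp hn
      refine le_trans ?_ (hD n (by omega) h2)
      exact_mod_cast card_piFinset_prod_eq_le S k (by omega : n ≠ 0))
  have e1 : ∑ τ ∈ Fintype.piFinset (fun _ : Fin k => S),
      ‖∏ i, (b (τ i) * ((√(τ i : ℝ))⁻¹ : ℝ))‖ ^ 2 = (∑ m ∈ S, ‖b m‖ ^ 2 / m) ^ k := by
    calc _ = ∑ τ ∈ Fintype.piFinset (fun _ : Fin k => S), ∏ i, (‖b (τ i)‖ ^ 2 / (τ i : ℝ)) := by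
          refine Finset.sum_congr rfl fun τ _ => ?_
          rw [norm_prod, ← Finset.prod_pow]
          simp_rw [norm_mul_inv_sqrt_sq]
      _ = ∏ _i : Fin k, ∑ m ∈ S, ‖b m‖ ^ 2 / m :=
          (Finset.prod_univ_sum (fun _ => S) fun _ m => ‖b m‖ ^ 2 / (m : ℝ)).symm
      _ = _ := by simp
  have e2 : ∀ t : ℝ, ∑ τ ∈ Fintype.piFinset (fun _ : Fin k => S),
      (∏ i, (b (τ i) * ((√(τ i : ℝ))⁻¹ : ℝ))) * cexp (-(t * Real.log (∏ i, τ i : ℕ) * I)) =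
        (∑ m ∈ S, b m * critChar t m) ^ k := by
    intro t
    calc _ = ∑ τ ∈ Fintype.piFinset (fun _ : Fin k => S), ∏ i, (b (τ i) * critChar t (τ i)) := by
          refine Finset.sum_congr rfl fun τ hτ => ?_
          simp_rw [mul_critChar]
          rw [Finset.prod_mul_distrib (g := fun i => cexp _), ← Complex.exp_sum]
          congr 2
          rw [Nat.cast_prod, Real.log_prod fun i _ => by exact_mod_cast (hpos τ hτ i).1]
          push_cast
          rw [Finset.sum_neg_distrib, Finset.mul_sum, Finset.sum_mul]
      _ = ∏ _i : Fin k, ∑ m ∈ S, b m * critChar t m :=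
          (Finset.prod_univ_sum (fun _ => S) fun _ m => b m * critChar t m).symm
      _ = _ := by simp
  rw [e1] at h
  simp_rw [e2] at h
  simp_rw [norm_pow] at h
  push_cast at h
  calc _ = ∫ t : ℝ, (‖∑ m ∈ S, b m * critChar t m‖ ^ k) ^ 2 / (T ^ 2 + t ^ 2) := by
        simp_rw [← pow_mul, mul_comm k 2]
    _ ≤ _ := h

/-- Measure of the set of large values of a Dirichlet polynomial. -/
theorem volume_large_values_le (S : Finset ℕ) (b : ℕ → ℂ) {N : ℕ} (hN : 1 ≤ N)
    (hS : ∀ m ∈ S, m ≠ 0 ∧ m ≤ N) (k : ℕ) {D : ℝ}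
    (hD : ∀ n : ℕ, n ≠ 0 → n ≤ N ^ k → (n.divisors.card : ℝ) ^ k ≤ D) {T W : ℝ} (hT : 0 < T)
    (hW : 0 < W) :
    volume.real {t : ℝ | |t| ≤ T ∧ W < ‖∑ m ∈ S, b m * critChar t m‖ ^ 2} ≤
      2 * Real.pi * D * (T + 2 * (N : ℝ) ^ k) * ((∑ m ∈ S, ‖b m‖ ^ 2 / m) / W) ^ k := by
  set U : Set ℝ := {t : ℝ | |t| ≤ T ∧ W < ‖∑ m ∈ S, b m * critChar t m‖ ^ 2} with hU
  have hUm : MeasurableSet U := measurableSet_large_values S b T W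
  have hUfin : volume U < ⊤ := by
    refine lt_of_le_of_lt (measure_mono (t := Set.Icc (-T) T) fun t ht => abs_le.mp ht.1) ?_
    simp
  have hi := integrable_norm_sum_critChar_pow_div S b (2 * k) hT
  have h1 : volume.real U * (W ^ k / (2 * T ^ 2)) ≤
      ∫ t : ℝ, ‖∑ m ∈ S, b m * critChar t m‖ ^ (2 * k) / (T ^ 2 + t ^ 2) := by
    calc volume.real U * (W ^ k / (2 * T ^ 2)) = ∫ _t in U, W ^ k / (2 * T ^ 2) := by
          rw [setIntegral_const, smul_eq_mul]
      _ ≤ ∫ t in U, ‖∑ m ∈ S, b m * critChar t m‖ ^ (2 * k) / (T ^ 2 + t ^ 2) := by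
          refine setIntegral_mono_on (integrableOn_const hUfin.ne) hi.integrableOn hUm
            fun t ht => ?_
          rw [pow_mul]
          -- On |t| ≤ T the Cauchy weight at scale T is at least 1/(2T²), so the weighted moment
          -- controls the measure.
          have h2 : t ^ 2 ≤ T ^ 2 := sq_le_sq' (abs_le.mp ht.1).1 (abs_le.mp ht.1).2
          have h3 := ht.2.le
          exact div_le_div₀ (by positivity) (by gcongr) (by positivity) (by linarith)
      _ ≤ _ := setIntegral_le_integral hi (Filter.Eventually.of_forall fun t => by positivity)
  have h2 := h1.trans (integral_norm_sum_pow_div_le S b hN hS k hD hT)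
  rw [← le_div_iff₀ (by positivity)] at h2
  refine h2.trans_eq ?_
  rw [div_pow]
  field_simp

/-- Three ranges: U, where only the pointwise bound P is available; |t| ≤ T outside U, where Φ ≤ Φ₁;
and |t| > T, where a² + t² ≥ (T² + t²)/2 allows the weight to be replaced by the one at scale T. -/
theorem integral_div_sq_add_sq_split_le {f Φ Λ : ℝ → ℝ} (hf0 : ∀ t, 0 ≤ f t)
    (hf : ∀ t, f t ≤ Φ t * Λ t) (hΛ : ∀ t, 0 ≤ Λ t) {Φ₁ Φ₂ P T a : ℝ} (hΦ₁ : 0 ≤ Φ₁) (hP0 : 0 ≤ P)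
    (hT : 0 < T) (ha : 0 < a) {U : Set ℝ} (hU : MeasurableSet U) (hUfin : volume U < ⊤)
    (h₁ : ∀ t, t ∉ U → |t| ≤ T → Φ t ≤ Φ₁) (h₂ : ∀ t, Φ t ≤ Φ₂) (h₀ : 0 ≤ Φ₂)
    (hP : ∀ t, |t| ≤ T → f t ≤ P)
    (ia : Integrable fun t => Λ t / (a ^ 2 + t ^ 2)) (iT : Integrable fun t => Λ t / (T ^ 2 + t ^ 2)) :
    ∫ t, f t / (a ^ 2 + t ^ 2) ≤ Φ₁ * (∫ t, Λ t / (a ^ 2 + t ^ 2)) +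
      2 * Φ₂ * (∫ t, Λ t / (T ^ 2 + t ^ 2)) + P / a ^ 2 * volume.real U := by
  have iU : Integrable (U.indicator fun _ => P / a ^ 2) :=
    (integrable_indicator_iff hU).mpr (integrableOn_const hUfin.ne)
  have i1 : Integrable fun t => Φ₁ * (Λ t / (a ^ 2 + t ^ 2)) := ia.const_mul _
  have i2 : Integrable fun t => 2 * Φ₂ * (Λ t / (T ^ 2 + t ^ 2)) := iT.const_mul _
  have i12 : Integrable fun t => Φ₁ * (Λ t / (a ^ 2 + t ^ 2)) + 2 * Φ₂ * (Λ t / (T ^ 2 + t ^ 2)) :=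
    i1.add i2
  have hsum : ∫ t, (Φ₁ * (Λ t / (a ^ 2 + t ^ 2)) + 2 * Φ₂ * (Λ t / (T ^ 2 + t ^ 2)) +
      U.indicator (fun _ => P / a ^ 2) t) = Φ₁ * (∫ t, Λ t / (a ^ 2 + t ^ 2)) +
      2 * Φ₂ * (∫ t, Λ t / (T ^ 2 + t ^ 2)) + P / a ^ 2 * volume.real U := by
    rw [integral_add i12 iU, integral_add i1 i2, integral_const_mul, integral_const_mul,
      integral_indicator hU, setIntegral_const, smul_eq_mul, mul_comm (volume.real U)]
  rw [← hsum]
  refine integral_mono_of_nonneg (Filter.Eventually.of_forall fun t => by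
    have := hf0 t; positivity) (i12.add iU)
    (Filter.Eventually.of_forall fun t => ?_)
  have hΛt := hΛ t
  have hft := hf0 t
  have p1 : 0 ≤ Φ₁ * (Λ t / (a ^ 2 + t ^ 2)) := by positivity
  have p2 : 0 ≤ 2 * Φ₂ * (Λ t / (T ^ 2 + t ^ 2)) := by positivity
  have p3 : 0 ≤ U.indicator (fun _ => P / a ^ 2) t :=
    Set.indicator_nonneg (fun _ _ => by positivity) t
  simp only
  by_cases htT : |t| ≤ T
  · by_cases htU : t ∈ U
    · have : f t / (a ^ 2 + t ^ 2) ≤ U.indicator (fun _ => P / a ^ 2) t := by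
        rw [Set.indicator_of_mem htU]
        exact div_le_div₀ hP0 (hP t htT) (by positivity) (by nlinarith [sq_nonneg t])
      linarith
    · have : f t / (a ^ 2 + t ^ 2) ≤ Φ₁ * (Λ t / (a ^ 2 + t ^ 2)) := by
        rw [← mul_div_assoc]
        gcongr
        exact (hf t).trans (by gcongr; exact h₁ t htU htT)
      linarith
  · have htT' : T ^ 2 ≤ t ^ 2 := by
      rw [← sq_abs t]
      have := (not_le.mp htT).le
      gcongr
    have : f t / (a ^ 2 + t ^ 2) ≤ 2 * Φ₂ * (Λ t / (T ^ 2 + t ^ 2)) := by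
      calc f t / (a ^ 2 + t ^ 2) ≤ Φ₂ * Λ t / ((T ^ 2 + t ^ 2) / 2) := by
            refine div_le_div₀ (by positivity) ((hf t).trans (by gcongr; exact h₂ t))
              (by positivity) (by nlinarith [sq_nonneg a])
        _ = _ := by field_simp
    linarith

/-- Mean square of a bilinear Dirichlet polynomial over coprime pairs: the set where a factor is
large is short, elsewhere the mean value theorem applies. -/
theorem integral_norm_bilinear_sq_div_le (S Q : Finset ℕ) (u v : ℕ → ℂ) {N K : ℕ} (hN : 1 ≤ N)
    (hK : 1 ≤ K) (hS : ∀ m ∈ S, m ≠ 0 ∧ m ≤ N) (hQ : ∀ k ∈ Q, 1 ≤ k ∧ k ≤ K) {CN CK P T a r W D : ℝ}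
    (hCN : ∑ m ∈ S, (m.divisors.card : ℝ) * (‖u m‖ ^ 2 / m) ≤ CN)
    (hCK : ∑ k ∈ Q, (k.divisors.card : ℝ) * (‖v k‖ ^ 2 / k) ≤ CK) (j : ℕ)
    (hD : ∀ n : ℕ, n ≠ 0 → n ≤ N ^ j → (n.divisors.card : ℝ) ^ j ≤ D)
    (hT : 0 < T) (ha : 0 < a) (hr : 1 ≤ r) (hW : 0 < W) (hP0 : 0 ≤ P)
    (hP : ∀ t : ℝ, |t| ≤ T → ‖∑ m ∈ S, ∑ k ∈ Q,
      if m.Coprime k then (u m * critChar t m) * (v k * critChar t k) else 0‖ ^ 2 ≤ P) :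
    ∫ t : ℝ, ‖∑ m ∈ S, ∑ k ∈ Q,
      if m.Coprime k then (u m * critChar t m) * (v k * critChar t k) else 0‖ ^ 2 /
        (a ^ 2 + t ^ 2) ≤
      (N / r * CN + r * W) * (Real.pi / a * (1 + 2 * K / a) * CK) +
      2 * (N * CN) * (Real.pi / T * (1 + 2 * K / T) * CK) +
      P / a ^ 2 * (r * (2 * Real.pi * D * (T + 2 * (N : ℝ) ^ j) * (CN / W) ^ j)) := by
  have hCN0 : 0 ≤ CN := le_trans (Finset.sum_nonneg fun _ _ => by positivity) hCN
  have hD0 : 0 ≤ D := by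
    have h1 : 1 ≤ N ^ j := Nat.one_le_pow _ _ hN
    refine le_trans (by positivity) (hD 1 one_ne_zero h1)
  set E : Finset ℕ := Finset.Icc 1 N with hE
  set B : ℕ → ℝ → ℂ := fun e t => ∑ m ∈ S with e ∣ m, u m * critChar t m with hB
  set Ue : ℕ → Set ℝ := fun e => {t : ℝ | |t| ≤ T ∧ W < ‖B e t‖ ^ 2} with hUe
  -- Only the at most r values e < r are tested for large B_e. For e ≥ r the saving N/r is
  -- automatic.
  set E' : Finset ℕ := E.filter fun e => (e : ℝ) < r with hE'
  set U : Set ℝ := ⋃ e ∈ E', Ue e with hU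
  have hr0 : 0 < r := by linarith
  have hE'c : (E'.card : ℝ) ≤ r := by
    have : E' ⊆ Finset.Ioc 0 ⌊r⌋₊ := fun e he => by
      obtain ⟨h1, h2⟩ := Finset.mem_filter.mp he
      exact Finset.mem_Ioc.mpr ⟨(Finset.mem_Icc.mp h1).1, Nat.le_floor h2.le⟩
    calc (E'.card : ℝ) ≤ (⌊r⌋₊ : ℝ) := by
          exact_mod_cast (Finset.card_le_card this).trans_eq (by simp)
      _ ≤ r := Nat.floor_le hr0.le
  have hUem : ∀ e, MeasurableSet (Ue e) := fun e => measurableSet_large_values _ u T W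
  have hUm : MeasurableSet U := Finset.measurableSet_biUnion _ fun e _ => hUem e
  have hUfin : volume U < ⊤ := by
    refine lt_of_le_of_lt (measure_mono (t := Set.Icc (-T) T) ?_) (by simp)
    exact Set.iUnion₂_subset fun e _ t ht => abs_le.mp ht.1
  have hSe : ∀ e, ∀ m ∈ S.filter (e ∣ ·), m ≠ 0 ∧ m ≤ N := fun e m hm =>
    hS m (Finset.mem_filter.mp hm).1
  have hSe2 : ∀ e, ∑ m ∈ S with e ∣ m, ‖u m‖ ^ 2 / (m : ℝ) ≤ CN := fun e => by
    refine le_trans ?_ hCN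
    refine (Finset.sum_le_sum_of_subset_of_nonneg (Finset.filter_subset _ _)
      fun _ _ _ => by positivity).trans (Finset.sum_le_sum fun m hm => ?_)
    refine le_mul_of_one_le_left (by positivity) ?_
    have : 0 < m.divisors.card := Finset.card_pos.mpr ⟨1, Nat.one_mem_divisors.mpr (hS m hm).1⟩
    exact_mod_cast this
  have hUvol : volume.real U ≤ r * (2 * Real.pi * D * (T + 2 * (N : ℝ) ^ j) * (CN / W) ^ j) := by
    calc volume.real U ≤ ∑ e ∈ E', volume.real (Ue e) :=
          measureReal_biUnion_finset_le _ _
      _ ≤ ∑ _e ∈ E', 2 * Real.pi * D * (T + 2 * (N : ℝ) ^ j) * (CN / W) ^ j := by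
          refine Finset.sum_le_sum fun e _ => ?_
          refine (volume_large_values_le _ u hN (hSe e) j hD hT hW).trans ?_
          have := hSe2 e
          have h0 : 0 ≤ ∑ m ∈ S with e ∣ m, ‖u m‖ ^ 2 / (m : ℝ) :=
            Finset.sum_nonneg fun _ _ => by positivity
          gcongr
      _ = E'.card * (2 * Real.pi * D * (T + 2 * (N : ℝ) ^ j) * (CN / W) ^ j) := by
          rw [Finset.sum_const, nsmul_eq_mul]
      _ ≤ _ := by gcongr
  -- Used with q = r for the large e, and with q = 1 for the trivial bound Φ₂ over all e.
  have htail : ∀ (E₀ : Finset ℕ) (q : ℝ), 0 < q → (∀ e ∈ E₀, q ≤ (e : ℝ)) → ∀ t : ℝ,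
      ∑ e ∈ E₀, ‖B e t‖ ^ 2 ≤ N / q * CN := by
    intro E₀ q hq hE₀ t
    refine (sum_norm_sq_filter_dvd_le S E₀ (fun m => u m * critChar t m) hq hS hE₀).trans ?_
    simp_rw [norm_mul_critChar_sq]
    gcongr
  obtain ⟨ia, ha'⟩ := integral_sum_norm_sq_filter_dvd_le E Q v hK hQ ha
  obtain ⟨iT, hT'⟩ := integral_sum_norm_sq_filter_dvd_le E Q v hK hQ hT
  have hmain := integral_div_sq_add_sq_split_le
    (f := fun t => ‖∑ m ∈ S, ∑ k ∈ Q,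
      if m.Coprime k then (u m * critChar t m) * (v k * critChar t k) else 0‖ ^ 2)
    (Φ := fun t => ∑ e ∈ E, ‖B e t‖ ^ 2)
    (Λ := fun t => ∑ e ∈ E, ‖∑ k ∈ Q with e ∣ k, v k * critChar t k‖ ^ 2)
    (fun t => by positivity)
    (fun t => norm_sum_coprime_sq_le S Q (fun m => u m * critChar t m)
      (fun k => v k * critChar t k) hS)
    (fun t => Finset.sum_nonneg fun _ _ => by positivity)
    (Φ₁ := N / r * CN + r * W) (Φ₂ := N * CN) (P := P) (by positivity) hP0 hT ha hUm hUfin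
    (fun t htU htT => by
      rw [← Finset.sum_filter_add_sum_filter_not E (fun e : ℕ => (e : ℝ) < r), add_comm]
      refine add_le_add (htail _ r hr0 (fun e he => not_lt.mp (Finset.mem_filter.mp he).2) t) ?_
      calc ∑ e ∈ E', ‖B e t‖ ^ 2 ≤ ∑ _e ∈ E', W := by
            refine Finset.sum_le_sum fun e he => ?_
            by_contra! h
            exact htU (Set.mem_biUnion he ⟨htT, h⟩)
        _ = E'.card * W := by rw [Finset.sum_const, nsmul_eq_mul]
        _ ≤ _ := by gcongr)
    (fun t => by
      have := htail E 1 one_pos (fun e he => by exact_mod_cast (Finset.mem_Icc.mp he).1) t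
      rwa [div_one] at this)
    (by positivity) hP ia iT
  refine hmain.trans ?_
  gcongr
  · exact ha'.trans (by gcongr)
  · exact hT'.trans (by gcongr)

end

/-! ### Reduction of the short sum and the smooth cutoff -/

section

open MeasureTheory Complex

section Reduction

variable {A : ℕ → ℂ} {L : ℂ → ℂ} {d : ℕ}

/-- The pairs `(m, k)` of coprime integers with `m ∈ S`, `1 ≤ k ≤ K`. -/
def coprimePairs (S : Finset ℕ) (K : ℕ) : Finset (ℕ × ℕ) :=
  (S ×ˢ Finset.Icc 1 K).filter fun p => p.1.Coprime p.2

/-- Since w equals 1 on every k that can occur below y, the smooth weight is inserted at no cost.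
Coprimality lets A(mk) factor. -/
theorem shortSum_eq_windowSum (hL : IsLFunction A L d) {M H x y : ℝ} {K : ℕ} {w : ℕ → ℂ}
    (hxy : x + H ≤ y)
    (hw : ∀ m ∈ Finset.Ioc ⌊M⌋₊ ⌊2 * M⌋₊, ∀ k : ℕ, 1 ≤ k → (m : ℝ) * k ≤ y → k ≤ K ∧ w k = 1) :
    shortSum A M H x = windowSum (coprimePairs (Finset.Ioc ⌊M⌋₊ ⌊2 * M⌋₊) K)
      (fun p => ((p.1 * p.2 : ℕ) : ℝ)) (fun p => A p.1 * (A p.2 * w p.2)) H x := by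
  rw [shortSum, windowSum, coprimePairs, Finset.sum_filter, Finset.sum_product]
  refine Finset.sum_congr rfl fun m hm => ?_
  have hm1 : 1 ≤ m := by have := (Finset.mem_Ioc.mp hm).1; omega
  have hm1' : (1 : ℝ) ≤ m := by exact_mod_cast hm1
  simp only [← ite_and]
  rw [← Finset.sum_filter]
  refine Finset.sum_congr ?_ fun k hk => ?_
  · ext k
    simp only [Finset.mem_filter, Finset.mem_Icc, Nat.cast_mul]
    constructor
    · rintro ⟨⟨h1, _⟩, h3, h4, h5⟩
      exact ⟨⟨h1, (hw m hm k h1 (h4.trans hxy)).1⟩, h5, h3, h4⟩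
    · rintro ⟨⟨h1, _⟩, h5, h3, h4⟩
      refine ⟨⟨h1, Nat.le_floor (le_trans ?_ h4)⟩, h3, h4, h5⟩
      exact le_mul_of_one_le_left (Nat.cast_nonneg k) hm1'
  · simp only [Finset.mem_filter, Finset.mem_Icc, Nat.cast_mul] at hk
    obtain ⟨⟨h1, _⟩, h5, h3, h4⟩ := hk
    rw [(hw m hm k h1 (h4.trans hxy)).2, mul_one, hL.map_mul_of_coprime h5 (by omega) (by omega)]

theorem sum_coprimePairs_eq (S : Finset ℕ) (hS : ∀ m ∈ S, m ≠ 0) (K : ℕ) (u v : ℕ → ℂ) (t : ℝ) :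
    ∑ p ∈ coprimePairs S K, u p.1 * v p.2 * ((√((p.1 * p.2 : ℕ) : ℝ))⁻¹ : ℝ) *
      cexp (-(t * Real.log ((p.1 * p.2 : ℕ) : ℝ) * I)) =
      ∑ m ∈ S, ∑ k ∈ Finset.Icc 1 K,
        if m.Coprime k then (u m * critChar t m) * (v k * critChar t k) else 0 := by
  rw [coprimePairs, Finset.sum_filter, Finset.sum_product]
  refine Finset.sum_congr rfl fun m hm => Finset.sum_congr rfl fun k hk => ?_
  have hk0 : k ≠ 0 := by have := (Finset.mem_Icc.mp hk).1; omega
  simp only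
  rw [← mul_critChar, critChar_mul t (hS m hm) hk0]
  split_ifs
  · ring
  · rfl

theorem integral_norm_shortSum_sq_le (hL : IsLFunction A L d) {M X H : ℝ} {K : ℕ} {w : ℕ → ℂ}
    (hX : 0 < X) (hH : 0 < H)
    (hw : ∀ m ∈ Finset.Ioc ⌊M⌋₊ ⌊2 * M⌋₊, ∀ k : ℕ, 1 ≤ k → (m : ℝ) * k ≤ 2 * X + H →
      k ≤ K ∧ w k = 1) :
    ∫ x in X..2 * X, ‖shortSum A M H x‖ ^ 2 ≤
      3 * ((2 * X + H) ^ 2 + (2 * X) ^ 2 + X ^ 2) * (1 / (2 * Real.pi) *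
        ∫ t : ℝ, ‖∑ m ∈ Finset.Ioc ⌊M⌋₊ ⌊2 * M⌋₊, ∑ k ∈ Finset.Icc 1 K,
          if m.Coprime k then (A m * critChar t m) * (A k * w k * critChar t k) else 0‖ ^ 2 /
            ((X / H + 1 / 2) ^ 2 + t ^ 2)) := by
  set S := Finset.Ioc ⌊M⌋₊ ⌊2 * M⌋₊ with hS
  have hS0 : ∀ m ∈ S, m ≠ 0 := fun m hm => by have := (Finset.mem_Ioc.mp hm).1; omega
  have h := integral_normSq_windowSum_le (coprimePairs S K) (fun p => ((p.1 * p.2 : ℕ) : ℝ))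
    (fun p => A p.1 * (A p.2 * w p.2)) (fun p hp => by
      obtain ⟨h1, _⟩ := Finset.mem_filter.mp hp
      obtain ⟨h2, h3⟩ := Finset.mem_product.mp h1
      have := hS0 _ h2
      have := (Finset.mem_Icc.mp h3).1
      exact_mod_cast Nat.mul_pos (by omega) (by omega)) hX hH
  simp only [sum_coprimePairs_eq S hS0 K A (fun k => A k * w k)] at h
  refine le_trans (le_of_eq ?_) h
  refine intervalIntegral.integral_congr fun x hx => ?_
  rw [Set.uIcc_of_le (by linarith)] at hx
  rw [shortSum_eq_windowSum hL (y := 2 * X + H) (by linarith [hx.2]) hw]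

end Reduction

theorem exists_bump {δ ε : ℝ} (hδ1 : δ < 1) (hε : 0 < ε) (hεδ : ε ≤ δ) :
    ∃ φ : ℝ → ℂ, ContDiff ℝ (⊤ : ℕ∞) φ ∧ (∀ v, 2 < |v| → φ v = 0) ∧ (∀ v, ‖φ v‖ ≤ 1) ∧
      (∀ v, 0 ≤ v → v ≤ 1 - δ + ε / 2 → φ v = 1) ∧ ∀ v, 1 - δ + ε < v → φ v = 0 := by
  -- Centre and radii are chosen so that the support is [-1, 1 - δ + ε] and the plateau ends at 1 -
  -- δ + ε/2 on the right. The plateau starts at -1 + ε/2 < 0, so it covers v = 0.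
  let ψ : ContDiffBump ((ε - δ) / 2 : ℝ) :=
    { rIn := 1 - δ / 2, rOut := 1 - δ / 2 + ε / 2, rIn_pos := by linarith, rIn_lt_rOut := by linarith }
  have hr1 : ψ.rIn = 1 - δ / 2 := rfl
  have hr2 : ψ.rOut = 1 - δ / 2 + ε / 2 := rfl
  have hz : ∀ v, 1 - δ / 2 + ε / 2 ≤ |v - (ε - δ) / 2| → ((ψ v : ℝ) : ℂ) = 0 := fun v hv => by
    rw [ψ.zero_of_le_dist (by rw [Real.dist_eq, hr2]; exact hv), ofReal_zero]
  refine ⟨fun v => (ψ v : ℝ), ofRealCLM.contDiff.comp ψ.contDiff, fun v hv => hz v ?_, fun v => ?_,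
    fun v h0 h1 => ?_, fun v hv => hz v ?_⟩
  · have := abs_sub_abs_le_abs_sub v ((ε - δ) / 2)
    have h2 : |(ε - δ) / 2| ≤ 1 / 2 := abs_le.mpr ⟨by linarith, by linarith⟩
    linarith
  · rw [norm_real, Real.norm_of_nonneg ψ.nonneg]; exact ψ.le_one
  · change ((ψ v : ℝ) : ℂ) = 1
    rw [ψ.one_of_mem_closedBall, ofReal_one]
    rw [mem_closedBall_iff_norm, Real.norm_eq_abs, hr1, abs_le]
    constructor <;> linarith
  · exact le_trans (by linarith) (le_abs_self _)

end

/-! ### The mean square bound for large X -/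

section

open MeasureTheory Complex

theorem exists_card_divisors_pow_le (k : ℕ) {ε : ℝ} (hε : 0 < ε) :
    ∃ C : ℝ, 1 ≤ C ∧ ∀ (X : ℝ) (N n : ℕ), 1 ≤ X → (N : ℝ) ≤ X → n ≠ 0 → n ≤ N ^ k →
      (n.divisors.card : ℝ) ^ k ≤ C * X ^ ε := by
  obtain ⟨C, hC, h⟩ := exists_card_divisors_le_mul_rpow (ε := ε / (k * k + 1)) (by positivity)
  refine ⟨C ^ k, one_le_pow₀ hC, fun X N n hX hN hn hnN => ?_⟩
  have hX0 : 0 ≤ X := by linarith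
  have hnX : (n : ℝ) ≤ X ^ k := by
    calc (n : ℝ) ≤ (N : ℝ) ^ k := by exact_mod_cast hnN
      _ ≤ _ := by gcongr
  calc (n.divisors.card : ℝ) ^ k ≤ (C * (X ^ k) ^ (ε / (k * k + 1))) ^ k := by
        gcongr
        exact (h n hn).trans (by gcongr)
    _ = C ^ k * X ^ (ε * ((k * k) / (k * k + 1))) := by
        rw [mul_pow, ← Real.rpow_natCast, ← Real.rpow_natCast, ← Real.rpow_natCast,
          ← Real.rpow_mul hX0, ← Real.rpow_mul hX0]
        congr 2
        field_simp
    _ ≤ _ := by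
        gcongr
        refine mul_le_of_le_one_right hε.le ?_
        rw [div_le_one (by positivity)]; linarith

-- The analytic core: `integral_norm_bilinear_sq_div_le` with all parameters set to powers of X. It
-- is proved with exponent 4δ and an extra X^{-δ²/100}, both needed for the consequence.
set_option maxHeartbeats 1000000 in
theorem IsLFunction.exists_mean_square_bound {A : ℕ → ℂ} {L : ℂ → ℂ} {d : ℕ}
    (hL : IsLFunction A L d) {θ : ℝ} (hθ : IsSubconvexityExponent L θ) {δ : ℝ} (hδ0 : 0 < δ)
    (hδ1 : δ ≤ 1 / 12) {c₁ c₂ : ℝ} (hc₁ : 0 < c₁) (hc₂ : 0 < c₂) :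
    ∃ X₀ C : ℝ, 1 ≤ X₀ ∧ 0 ≤ C ∧ ∀ X H : ℝ, X₀ ≤ X → c₁ * X ^ (6 * δ) ≤ H →
      H ≤ c₂ * X ^ (1 - 6 * δ) →
      ∫ x in X..2 * X, ‖shortSum A (X ^ δ) H x‖ ^ 2 ≤
        C * (X ^ (-(δ ^ 2 / 100)) * (H ^ 2 * X ^ (1 - δ ^ 2) +
          X ^ (2 * θ * (1 + δ) + 4 * δ) * H ^ (2 - 2 * θ))) := by
  have hθ0 := hθ.1
  -- The saving X^{-ρ} must leave X^{-δ²-ε} after a loss of X^{3ε}, and ρ = 1.1 δ² ≥ δ² + 4ε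
  -- suffices.
  set ε : ℝ := δ ^ 2 / 100 with hε
  set ρ : ℝ := 11 / 10 * δ ^ 2 with hρ
  have hε0 : 0 < ε := by positivity
  have hδ2 : δ ^ 2 ≤ δ / 12 := by nlinarith
  have hεδ : ε ≤ δ / 1200 := by rw [hε]; linarith
  -- The least k with M^k ≥ X ≥ T, so the mean value theorem for the k-th power loses no more than
  -- M^k. Also kδ ≤ 1 + δ keeps the loss X^{2kρ} at size X^{O(δ)}.
  set k : ℕ := ⌈1 / δ⌉₊ with hk
  have hk1 : 1 ≤ k := Nat.one_le_iff_ne_zero.mpr (by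
    rw [hk]; exact (Nat.ceil_pos.mpr (by positivity)).ne')
  have hk1' : (1 : ℝ) ≤ k := by exact_mod_cast hk1
  have hkδ : 1 ≤ k * δ := by
    have := Nat.le_ceil (1 / δ)
    rw [← hk, div_le_iff₀ hδ0] at this
    exact this
  have hkδ2 : k * δ ≤ 1 + δ := by
    have := (Nat.ceil_lt_add_one (a := 1 / δ) (by positivity)).le
    rw [← hk] at this
    calc k * δ ≤ (1 / δ + 1) * δ := by gcongr
      _ = 1 + δ := by field_simp
  obtain ⟨φ, hφd, hφs, hφ1, hφone, hφzero⟩ := exists_bump (δ := δ) (ε := ε) (by linarith) hε0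
    (by linarith)
  obtain ⟨C₁, hC₁, hRS⟩ := hL.exists_sum_divisors_mul_norm_sq_div_le (ε := ε / k) (by positivity)
  obtain ⟨C₂, hC₂, hdiv⟩ := exists_card_divisors_pow_le k hε0
  obtain ⟨C₃, hC₃, hline⟩ := hL.exists_norm_coprime_smooth_sum_le hθ hφd hφs hε0
  -- All constants that compete with a power of X are at most G, and the threshold on X makes G ≤
  -- X^{ε/2}. The requirement X ≥ 3 ensures log X ≥ 1.
  set G : ℝ := 3 + c₂ + 1 / c₁ with hG
  have hc₁' : 0 < 1 / c₁ := by positivity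
  set CT : ℝ := 2 * Real.pi * (1 + 2 ^ (k + 1)) * C₁ ^ k * C₂ * (2 * C₁ * (C₃ * 2 ^ (θ + 1)) ^ 2)
    with hCT
  have hCT0 : 0 ≤ CT := by positivity
  refine ⟨max 3 (G ^ (2 / ε)), 3 * ((2 + c₂) ^ 2 + 5) *
    (12 * C₁ ^ 2 * (1 / c₁ + 2) + 16 * C₁ ^ 2 * (1 / c₁ + 2) + CT), le_max_of_le_left (by norm_num),
    by positivity, fun X H hX hH1 hH2 => ?_⟩
  have hX3 : 3 ≤ X := (le_max_left _ _).trans hX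
  have hX1 : 1 ≤ X := by linarith
  have hX0 : 0 < X := by linarith
  have hXn : X ≠ 0 := hX0.ne'
  have rp : ∀ a b : ℝ, X ^ a * X ^ b = X ^ (a + b) := fun a b => (Real.rpow_add hX0 a b).symm
  have mono : ∀ {a b : ℝ}, a ≤ b → X ^ a ≤ X ^ b :=
    fun h => Real.rpow_le_rpow_of_exponent_le hX1 h
  have pos : ∀ a : ℝ, 0 < X ^ a := fun a => Real.rpow_pos_of_pos hX0 a
  have one_le : ∀ {a : ℝ}, 0 ≤ a → 1 ≤ X ^ a := fun h => Real.one_le_rpow hX1 h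
  have hGX : G ≤ X ^ (ε / 2) := by
    have : G ^ (2 / ε) ≤ X := (le_max_right _ _).trans hX
    calc G = (G ^ (2 / ε)) ^ (ε / 2) := by
          rw [← Real.rpow_mul (by positivity)]
          have : 2 / ε * (ε / 2) = 1 := by field_simp
          rw [this, Real.rpow_one]
      _ ≤ _ := by gcongr
  have hGa : ∀ {a : ℝ}, ε / 2 ≤ a → G ≤ X ^ a := fun h => hGX.trans (mono h)
  have hH0 : 0 < H := lt_of_lt_of_le (mul_pos hc₁ (pos _)) hH1
  have hHX : H ≤ c₂ * X := hH2.trans (by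
    gcongr
    calc X ^ (1 - 6 * δ) ≤ X ^ (1 : ℝ) := mono (by linarith)
      _ = X := Real.rpow_one X)
  -- `H` is at most a power of `X` times `H ^ 2`
  have hHH : ∀ b : ℝ, X ^ b * H ≤ 1 / c₁ * (X ^ (b - 6 * δ) * H ^ 2) := fun b => by
    have h1 : 1 ≤ 1 / c₁ * X ^ (-(6 * δ)) * H := by
      calc (1 : ℝ) = 1 / c₁ * X ^ (-(6 * δ)) * (c₁ * X ^ (6 * δ)) := by
            rw [mul_mul_mul_comm, rp]; simp [hc₁.ne']
        _ ≤ _ := by have := pos (-(6 * δ)); gcongr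
    calc X ^ b * H ≤ X ^ b * H * (1 / c₁ * X ^ (-(6 * δ)) * H) :=
          le_mul_of_one_le_right (by have := pos b; positivity) h1
      _ = 1 / c₁ * (X ^ b * X ^ (-(6 * δ)) * H ^ 2) := by ring
      _ = _ := by rw [rp]; ring_nf
  set M : ℝ := X ^ δ with hM
  have hM1 : 1 ≤ M := one_le hδ0.le
  have hM0 : 0 < M := by linarith
  set N : ℕ := ⌊2 * M⌋₊ with hN
  have hN1 : 1 ≤ N := Nat.le_floor (by push_cast; linarith)
  have hN2 : (N : ℝ) ≤ 2 * M := Nat.floor_le (by positivity)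
  have hNX : (N : ℝ) ≤ X := by
    have h2 : (2 : ℝ) ≤ X ^ (1 - δ) := by
      have := hGa (a := 1 - δ) (by linarith)
      rw [hG] at this; linarith
    calc (N : ℝ) ≤ 2 * M := hN2
      _ ≤ X ^ (1 - δ) * X ^ δ := by gcongr
      _ = X := by rw [rp]; simp
  set K : ℕ := ⌊X ^ (1 - δ + ε)⌋₊ with hK
  have hK1 : 1 ≤ K := Nat.le_floor (by push_cast; exact one_le (by linarith))
  have hK2 : (K : ℝ) ≤ X ^ (1 - δ + ε) := Nat.floor_le (pos _).le
  have hKX : (K : ℝ) ≤ X := hK2.trans ((mono (by linarith)).trans_eq (Real.rpow_one X))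
  set S : Finset ℕ := Finset.Ioc ⌊M⌋₊ N with hS
  have hSN : ∀ m ∈ S, m ≠ 0 ∧ m ≤ N := fun m hm => by
    obtain ⟨h1, h2⟩ := Finset.mem_Ioc.mp hm
    exact ⟨by omega, h2⟩
  set ℓ : ℝ := Real.log X with hℓ
  have hℓ1 : 1 ≤ ℓ := by
    rw [hℓ, Real.le_log_iff_exp_le hX0]
    linarith [Real.exp_one_lt_d9]
  have hℓ0 : 0 < ℓ := by linarith
  set w : ℕ → ℂ := fun j => φ (Real.log j / ℓ) with hw
  -- From m > X^δ and mj ≤ (2 + c₂)X one gets j ≤ X^{1-δ+ε/2}, which is the plateau of the bump in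
  -- the variable log j / log X.
  have hwindow : ∀ m ∈ S, ∀ j : ℕ, 1 ≤ j → (m : ℝ) * j ≤ 2 * X + H → j ≤ K ∧ w j = 1 := by
    intro m hm j hj hmj
    have hj0 : (0 : ℝ) < j := by exact_mod_cast hj
    have hmM : M < m := Nat.lt_of_floor_lt (Finset.mem_Ioc.mp hm).1
    have hjX : (j : ℝ) ≤ X ^ (1 - δ + ε / 2) := by
      have h1 : M * j ≤ (2 + c₂) * X := by
        calc M * j ≤ m * j := by gcongr
          _ ≤ 2 * X + H := hmj
          _ ≤ _ := by linarith
      have h2 : (2 + c₂) * X ≤ M * X ^ (1 - δ + ε / 2) := by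
        calc (2 + c₂) * X ≤ X ^ (ε / 2) * X := by
              gcongr; rw [hG] at hGX; linarith
          _ = X ^ (ε / 2) * X ^ (1 : ℝ) := by rw [Real.rpow_one]
          _ = M * X ^ (1 - δ + ε / 2) := by rw [hM, rp, rp]; ring_nf
      exact le_of_mul_le_mul_left (h1.trans h2) hM0
    refine ⟨Nat.le_floor (hjX.trans (mono (by linarith))), hφone _ ?_ ?_⟩
    · exact div_nonneg (Real.log_natCast_nonneg j) hℓ0.le
    · rw [div_le_iff₀ hℓ0, hℓ, ← Real.log_rpow hX0]
      exact Real.log_le_log hj0 hjX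
  have hKzero : ∀ j : ℕ, K < j → φ (Real.log j / ℓ) = 0 := by
    intro j hj
    refine hφzero _ ?_
    rw [lt_div_iff₀ hℓ0, hℓ, ← Real.log_rpow hX0]
    exact Real.log_lt_log (pos _) (Nat.lt_of_floor_lt hj)
  -- The exponent is divided by k because this factor is raised to the k-th power in the large-value
  -- estimate.
  set Y : ℝ := X ^ (ε / k) with hY
  have hYε : Y ≤ X ^ ε := mono (div_le_self hε0.le hk1')
  have hY0 : 0 < Y := pos _
  have hYk : Y ^ k = X ^ ε := by
    rw [hY, ← Real.rpow_natCast, ← Real.rpow_mul hX0.le]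
    congr 1; field_simp
  have hCN : ∑ m ∈ S, (m.divisors.card : ℝ) * (‖A m‖ ^ 2 / m) ≤ C₁ * Y := by
    calc _ ≤ ∑ m ∈ Finset.Icc 1 N, (m.divisors.card : ℝ) * (‖A m‖ ^ 2 / m) :=
          Finset.sum_le_sum_of_subset_of_nonneg (fun m hm => Finset.mem_Icc.mpr
            ⟨Nat.pos_of_ne_zero (hSN m hm).1, (hSN m hm).2⟩) fun _ _ _ => by positivity
      _ ≤ C₁ * (N : ℝ) ^ (ε / k) := hRS N hN1
      _ ≤ _ := by
          gcongr
          exact Real.rpow_le_rpow (Nat.cast_nonneg _) hNX (by positivity)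
  have hCK : ∑ j ∈ Finset.Icc 1 K, (j.divisors.card : ℝ) * (‖A j * w j‖ ^ 2 / j) ≤ C₁ * X ^ ε := by
    calc _ ≤ ∑ m ∈ Finset.Icc 1 K, (m.divisors.card : ℝ) * (‖A m‖ ^ 2 / m) := by
          gcongr with m hm
          rw [norm_mul]
          exact mul_le_of_le_one_right (norm_nonneg _) (hφ1 _)
      _ ≤ C₁ * (K : ℝ) ^ (ε / k) := hRS K hK1
      _ ≤ C₁ * Y := by
          gcongr
          exact Real.rpow_le_rpow (Nat.cast_nonneg _) hKX (by positivity)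
      _ ≤ _ := by gcongr
  -- T exceeds the effective range X/H by X^δ, enough to offset the trivial bound N for the
  -- polynomial over m. The two bounds on H yield 1 ≤ T ≤ X.
  set T : ℝ := X ^ (1 + δ) / H with hT
  have hT0 : 0 < T := div_pos (pos _) hH0
  have hT1 : 1 ≤ T := by
    rw [hT, one_le_div hH0]
    calc H ≤ c₂ * X ^ (1 - 6 * δ) := hH2
      _ ≤ X ^ (7 * δ) * X ^ (1 - 6 * δ) := by
          have := hGa (a := 7 * δ) (by linarith)
          rw [hG] at this
          gcongr; linarith
      _ = _ := by rw [rp]; ring_nf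
  have hTX : T ≤ X := by
    rw [hT, div_le_iff₀ hH0]
    calc X ^ (1 + δ) = X * (X ^ (-(5 * δ)) * X ^ (6 * δ)) := by
          rw [rp, ← Real.rpow_one_add' hX0.le (by linarith)]; ring_nf
      _ ≤ X * (c₁ * X ^ (6 * δ)) := by
          gcongr
          have h1 := hGa (a := 5 * δ) (by linarith)
          rw [Real.rpow_neg hX0.le, inv_le_comm₀ (pos _) hc₁, ← one_div]
          rw [hG] at h1; linarith
      _ ≤ X * H := by gcongr
  -- Cauchy-Schwarz over m: the coefficients contribute X^ε, and the at most 2M inner sums are each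
  -- ≪ X^{2ε} T^θ.
  set P : ℝ := 2 * C₁ * (C₃ * 2 ^ (θ + 1)) ^ 2 * (X ^ (δ + 5 * ε) * T ^ (2 * θ)) with hP
  have hP0 : 0 ≤ P := by positivity
  have hPb : ∀ t : ℝ, |t| ≤ T → ‖∑ m ∈ S, ∑ j ∈ Finset.Icc 1 K,
      if m.Coprime j then (A m * critChar t m) * (A j * w j * critChar t j) else 0‖ ^ 2 ≤ P := by
    intro t ht
    have hfac : ∑ m ∈ S, ∑ j ∈ Finset.Icc 1 K,
        (if m.Coprime j then (A m * critChar t m) * (A j * w j * critChar t j) else 0) =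
        ∑ m ∈ S, (A m * critChar t m) * ∑ j ∈ Finset.Icc 1 K,
          if m.Coprime j then A j * w j * critChar t j else 0 := by
      refine Finset.sum_congr rfl fun m _ => ?_
      rw [Finset.mul_sum]
      refine Finset.sum_congr rfl fun j _ => ?_
      split_ifs <;> simp
    have hB : ∀ m ∈ S, ‖∑ j ∈ Finset.Icc 1 K,
        (if m.Coprime j then A j * w j * critChar t j else 0)‖ ^ 2 ≤
          (C₃ * 2 ^ (θ + 1) * (X ^ (2 * ε) * T ^ θ)) ^ 2 := by
      intro m hm
      gcongr
      refine (hline m ℓ t K (hSN m hm).1 hℓ1 hKzero).trans ?_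
      have hmX : (m : ℝ) ≤ X := le_trans (by exact_mod_cast (hSN m hm).2) hNX
      calc C₃ * ((m : ℝ) ^ ε * (1 + |t|) ^ (θ + ε)) ≤ C₃ * (X ^ ε * (2 * T) ^ (θ + ε)) := by
            gcongr; linarith
        _ = C₃ * (X ^ ε * (2 ^ (θ + ε) * (T ^ θ * T ^ ε))) := by
            rw [Real.mul_rpow (by norm_num) hT0.le, Real.rpow_add hT0]
        _ ≤ C₃ * (X ^ ε * (2 ^ (θ + 1) * (T ^ θ * X ^ ε))) := by
            gcongr
            · norm_num
            · linarith
        _ = C₃ * 2 ^ (θ + 1) * (X ^ ε * X ^ ε * T ^ θ) := by ring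
        _ = _ := by rw [rp]; ring_nf
    rw [hfac]
    refine (norm_sum_mul_sq_le _ _ _).trans ?_
    have h1 : ∑ m ∈ S, ‖A m * critChar t m‖ ^ 2 ≤ C₁ * X ^ ε := by
      simp_rw [norm_mul_critChar_sq]
      refine le_trans (Finset.sum_le_sum fun m hm => ?_) (hCN.trans (by gcongr))
      refine le_mul_of_one_le_left (by positivity) ?_
      have : 0 < m.divisors.card := Finset.card_pos.mpr ⟨1, Nat.one_mem_divisors.mpr (hSN m hm).1⟩
      exact_mod_cast this
    have hcard : (S.card : ℝ) ≤ 2 * M := by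
      refine le_trans ?_ hN2
      rw [hS, Nat.card_Ioc]
      exact_mod_cast Nat.sub_le _ _
    have h2 : ∑ m ∈ S, ‖∑ j ∈ Finset.Icc 1 K,
        (if m.Coprime j then A j * w j * critChar t j else 0)‖ ^ 2 ≤
          2 * M * (C₃ * 2 ^ (θ + 1) * (X ^ (2 * ε) * T ^ θ)) ^ 2 := by
      refine (Finset.sum_le_card_nsmul _ _ _ hB).trans ?_
      rw [nsmul_eq_mul]
      gcongr
    calc _ ≤ C₁ * X ^ ε * (2 * M * (C₃ * 2 ^ (θ + 1) * (X ^ (2 * ε) * T ^ θ)) ^ 2) :=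
          mul_le_mul h1 h2 (by positivity) (by positivity)
      _ = 2 * C₁ * (C₃ * 2 ^ (θ + 1)) ^ 2 *
          (X ^ ε * X ^ δ * (X ^ (2 * ε) * X ^ (2 * ε)) * (T ^ θ * T ^ θ)) := by rw [hM]; ring
      _ = P := by
          rw [rp, rp, rp, ← Real.rpow_add hT0, hP]; ring_nf
  set a : ℝ := X / H + 1 / 2 with ha
  have hXH : 0 < X / H := by positivity
  have ha0 : 0 < a := by linarith
  have hainv : 1 / a ≤ H * X ^ (-1 : ℝ) := by
    calc 1 / a ≤ 1 / (X / H) := one_div_le_one_div_of_le hXH (by linarith)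
      _ = _ := by rw [one_div_div, Real.rpow_neg_one, div_eq_mul_inv]
  -- With r = X^ρ and W = X^{δ-2ρ}, both N/r and rW are of order X^{δ-ρ}.
  have hbil := integral_norm_bilinear_sq_div_le S (Finset.Icc 1 K) A (fun j => A j * w j) hN1 hK1 hSN
    (fun j hj => Finset.mem_Icc.mp hj) hCN hCK k (fun n hn hn2 => hdiv X N n hX1 hNX hn hn2)
    hT0 ha0 (one_le (a := ρ) (by positivity)) (W := X ^ (δ - 2 * ρ)) (pos _) hP0 hPb
  have hred := integral_norm_shortSum_sq_le hL hX0 hH0 hwindow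
  set Z : ℝ := X ^ (-ε) * (H ^ 2 * X ^ (1 - δ ^ 2)) with hZ
  set Z' : ℝ := X ^ (-ε) * (X ^ (2 * θ * (1 + δ) + 4 * δ) * H ^ (2 - 2 * θ)) with hZ'
  have hZ0 : 0 ≤ Z := by have := pos (-ε); have := pos (1 - δ ^ 2); positivity
  have hpi4 : Real.pi ≤ 4 := Real.pi_le_four
  have hzb : ∀ b : ℝ, b ≤ 1 - δ ^ 2 - ε → X ^ b * H ^ 2 ≤ Z := fun b hb => by
    calc X ^ b * H ^ 2 ≤ X ^ (1 - δ ^ 2 - ε) * H ^ 2 := by gcongr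
      _ = X ^ (-ε + (1 - δ ^ 2)) * H ^ 2 := by ring_nf
      _ = Z := by rw [← rp, hZ]; ring
  -- The lower bound H ≫ X^{6δ} trades a linear term in H for a quadratic one with gain X^{-6δ}.
  -- This handles the diagonal terms of the mean values.
  have hzb1 : ∀ b : ℝ, b ≤ 1 + 6 * δ - δ ^ 2 - ε → X ^ b * H ≤ 1 / c₁ * Z := fun b hb => by
    refine (hHH b).trans ?_
    gcongr
    exact hzb _ (by linarith)
  rw [← hN, ← hS, ← ha] at hred
  clear_value ε ρ k G CT M N K S ℓ Y T P a Z Z'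
  have hX2 : X ^ 2 = X ^ (2 : ℝ) := by norm_cast
  have hNM : (N : ℝ) * (C₁ * Y) ≤ 2 * C₁ * (X ^ δ * X ^ ε) := by
    calc (N : ℝ) * (C₁ * Y) ≤ 2 * M * (C₁ * X ^ ε) := by gcongr
      _ = _ := by rw [hM]; ring
  have hterm1 : X ^ 2 * ((N / X ^ ρ * (C₁ * Y) + X ^ ρ * X ^ (δ - 2 * ρ)) *
      (Real.pi / a * (1 + 2 * K / a) * (C₁ * X ^ ε))) ≤ 12 * C₁ ^ 2 * (1 / c₁ + 2) * Z := by
    have h1 : N / X ^ ρ * (C₁ * Y) + X ^ ρ * X ^ (δ - 2 * ρ) ≤ 3 * C₁ * X ^ (δ - ρ + ε) := by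
      have e1 : N / X ^ ρ * (C₁ * Y) ≤ 2 * C₁ * X ^ (δ - ρ + ε) := by
        calc N / X ^ ρ * (C₁ * Y) = N * (C₁ * Y) * X ^ (-ρ) := by
              rw [Real.rpow_neg hX0.le]; ring
          _ ≤ 2 * C₁ * (X ^ δ * X ^ ε) * X ^ (-ρ) := by have := pos (-ρ); gcongr
          _ = 2 * C₁ * (X ^ δ * X ^ ε * X ^ (-ρ)) := by ring
          _ = _ := by rw [rp, rp]; ring_nf
      have e2 : X ^ ρ * X ^ (δ - 2 * ρ) ≤ C₁ * X ^ (δ - ρ + ε) := by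
        rw [rp]
        calc X ^ (ρ + (δ - 2 * ρ)) ≤ X ^ (δ - ρ + ε) := mono (by linarith)
          _ ≤ _ := le_mul_of_one_le_left (pos _).le hC₁
      linarith
    have h2 : Real.pi / a * (1 + 2 * K / a) ≤ 4 * (H * X ^ (-1 : ℝ)) *
        (1 + 2 * X ^ (1 - δ + ε) * (H * X ^ (-1 : ℝ))) := by
      rw [div_eq_mul_one_div Real.pi, div_eq_mul_one_div (2 * (K : ℝ))]
      gcongr
    have e1 : X ^ 2 * X ^ (δ - ρ + ε) * X ^ (-1 : ℝ) * X ^ ε = X ^ (1 + δ - ρ + 2 * ε) := by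
      rw [hX2, rp, rp, rp]; ring_nf
    have e2 : X ^ 2 * X ^ (δ - ρ + ε) * X ^ (-1 : ℝ) * X ^ ε * X ^ (1 - δ + ε) * X ^ (-1 : ℝ) =
        X ^ (1 - ρ + 3 * ε) := by
      rw [e1, rp, rp]; ring_nf
    have z1 := hzb1 (1 + δ - ρ + 2 * ε) (by rw [hρ, hε]; linarith)
    have z2 := hzb (1 - ρ + 3 * ε) (by rw [hρ, hε]; linarith)
    calc _ ≤ X ^ 2 * (3 * C₁ * X ^ (δ - ρ + ε) * (4 * (H * X ^ (-1 : ℝ)) *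
          (1 + 2 * X ^ (1 - δ + ε) * (H * X ^ (-1 : ℝ))) * (C₁ * X ^ ε))) := by
          have := pos (δ - ρ + ε)
          gcongr
      _ = 12 * C₁ ^ 2 * ((X ^ 2 * X ^ (δ - ρ + ε) * X ^ (-1 : ℝ) * X ^ ε) * H +
          2 * ((X ^ 2 * X ^ (δ - ρ + ε) * X ^ (-1 : ℝ) * X ^ ε * X ^ (1 - δ + ε) *
            X ^ (-1 : ℝ)) * H ^ 2)) := by ring
      _ ≤ 12 * C₁ ^ 2 * (1 / c₁ * Z + 2 * Z) := by rw [e2, e1]; gcongr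
      _ = _ := by ring
  -- The tail |t| > T: its off-diagonal part gains X^{-2δ} from 1/T² against the trivial bound, and
  -- its diagonal part is again covered by H ≫ X^{6δ}.
  have hterm2 : X ^ 2 * (2 * (N * (C₁ * Y)) * (Real.pi / T * (1 + 2 * K / T) * (C₁ * X ^ ε))) ≤
      16 * C₁ ^ 2 * (1 / c₁ + 2) * Z := by
    have hTinv : 1 / T = H * X ^ (-(1 + δ)) := by
      rw [hT, one_div_div, Real.rpow_neg hX0.le, div_eq_mul_inv]
    have h2 : Real.pi / T * (1 + 2 * K / T) ≤ 4 * (H * X ^ (-(1 + δ))) *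
        (1 + 2 * X ^ (1 - δ + ε) * (H * X ^ (-(1 + δ)))) := by
      have := pos (-(1 + δ))
      rw [div_eq_mul_one_div Real.pi, div_eq_mul_one_div (2 * (K : ℝ)), hTinv]
      gcongr
    have e1 : X ^ 2 * (X ^ δ * X ^ ε) * X ^ (-(1 + δ)) * X ^ ε = X ^ (1 + 2 * ε) := by
      rw [hX2, rp, rp, rp, rp]; ring_nf
    have e2 : X ^ 2 * (X ^ δ * X ^ ε) * X ^ (-(1 + δ)) * X ^ ε * X ^ (1 - δ + ε) *
        X ^ (-(1 + δ)) = X ^ (1 - 2 * δ + 3 * ε) := by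
      rw [e1, rp, rp]; ring_nf
    have z1 := hzb1 (1 + 2 * ε) (by rw [hε]; linarith)
    have z2 := hzb (1 - 2 * δ + 3 * ε) (by rw [hε]; linarith)
    calc _ ≤ X ^ 2 * (2 * (2 * C₁ * (X ^ δ * X ^ ε)) * (4 * (H * X ^ (-(1 + δ))) *
          (1 + 2 * X ^ (1 - δ + ε) * (H * X ^ (-(1 + δ)))) * (C₁ * X ^ ε))) := by
          gcongr
      _ = 16 * C₁ ^ 2 * ((X ^ 2 * (X ^ δ * X ^ ε) * X ^ (-(1 + δ)) * X ^ ε) * H +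
          2 * ((X ^ 2 * (X ^ δ * X ^ ε) * X ^ (-(1 + δ)) * X ^ ε * X ^ (1 - δ + ε) *
            X ^ (-(1 + δ))) * H ^ 2)) := by ring
      _ ≤ 16 * C₁ ^ 2 * (1 / c₁ * Z + 2 * Z) := by rw [e2, e1]; gcongr
      _ = _ := by ring
  -- The exceptional set: N^k / W^k leaves X^{2kρ}, while X²/a² ≤ H². Thus T^{2θ}H² supplies the
  -- term with θ, and the remaining exponent δ + ρ + 2kρ + 7ε is at most 4δ - ε.
  have hterm3 : X ^ 2 * (P / a ^ 2 * (X ^ ρ * (2 * Real.pi * (C₂ * X ^ ε) * (T + 2 * (N : ℝ) ^ k) *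
      (C₁ * Y / X ^ (δ - 2 * ρ)) ^ k))) ≤ CT * Z' := by
    have hMk : M ^ k = X ^ (k * δ) := by
      rw [hM, ← Real.rpow_natCast, ← Real.rpow_mul hX0.le, mul_comm]
    have h1 : T + 2 * (N : ℝ) ^ k ≤ (1 + 2 ^ (k + 1)) * X ^ (k * δ) := by
      have e1 : T ≤ X ^ (k * δ) := hTX.trans ((Real.rpow_one X).symm.trans_le (mono hkδ))
      have e2 : (N : ℝ) ^ k ≤ 2 ^ k * X ^ (k * δ) := by
        rw [← hMk, ← mul_pow]; gcongr
      rw [pow_succ]; linarith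
    have h2 : (C₁ * Y / X ^ (δ - 2 * ρ)) ^ k = C₁ ^ k * (X ^ ε * X ^ (-(k * (δ - 2 * ρ)))) := by
      rw [div_pow, mul_pow, hYk, ← Real.rpow_natCast (X ^ (δ - 2 * ρ)), ← Real.rpow_mul hX0.le,
        Real.rpow_neg hX0.le, mul_comm (δ - 2 * ρ)]
      ring
    have h3 : T ^ (2 * θ) * H ^ 2 = X ^ (2 * θ * (1 + δ)) * H ^ (2 - 2 * θ) := by
      rw [hT, Real.div_rpow (pos _).le hH0.le, ← Real.rpow_mul hX0.le, Real.rpow_sub hH0,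
        Real.rpow_two, mul_comm (1 + δ)]
      ring
    have h4 : P / a ^ 2 ≤ P * (H * X ^ (-1 : ℝ)) ^ 2 := by
      calc P / a ^ 2 = P * (1 / a) ^ 2 := by ring
        _ ≤ _ := by gcongr
    have e1 : X ^ 2 * X ^ (δ + 5 * ε) * X ^ (-1 : ℝ) * X ^ (-1 : ℝ) * X ^ ρ * X ^ ε *
        X ^ (k * δ) * X ^ ε * X ^ (-(k * (δ - 2 * ρ))) ≤ X ^ (-ε) * X ^ (4 * δ) := by
      rw [hX2, rp, rp, rp, rp, rp, rp, rp, rp, rp]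
      refine mono ?_
      have : k * δ * δ ≤ (1 + δ) * δ := by gcongr
      rw [hρ, hε]
      linarith
    calc _ ≤ X ^ 2 * (P * (H * X ^ (-1 : ℝ)) ^ 2 * (X ^ ρ * (2 * Real.pi * (C₂ * X ^ ε) *
          ((1 + 2 ^ (k + 1)) * X ^ (k * δ)) *
          (C₁ ^ k * (X ^ ε * X ^ (-(k * (δ - 2 * ρ)))))))) := by
          have := pos ρ
          rw [h2]
          have := pos (-(k * (δ - 2 * ρ)))
          gcongr
      _ = CT * ((X ^ 2 * X ^ (δ + 5 * ε) * X ^ (-1 : ℝ) * X ^ (-1 : ℝ) * X ^ ρ * X ^ ε *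
        X ^ (k * δ) * X ^ ε * X ^ (-(k * (δ - 2 * ρ)))) * (T ^ (2 * θ) * H ^ 2)) := by
          rw [hP, hCT]; ring
      _ ≤ CT * (X ^ (-ε) * X ^ (4 * δ) * (T ^ (2 * θ) * H ^ 2)) := by gcongr
      _ = CT * (X ^ (-ε) * (X ^ (2 * θ * (1 + δ)) * X ^ (4 * δ) * H ^ (2 - 2 * θ))) := by
          rw [h3]; ring
      _ = CT * Z' := by rw [rp, hZ']
  have hZ'0 : 0 ≤ Z' := by
    rw [hZ']
    have := pos (-ε); have := pos (2 * θ * (1 + δ) + 4 * δ); positivity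
  set B : ℝ := 12 * C₁ ^ 2 * (1 / c₁ + 2) + 16 * C₁ ^ 2 * (1 / c₁ + 2) with hB
  have hB0 : 0 ≤ B := by positivity
  set I : ℝ := ∫ t : ℝ, ‖∑ m ∈ S, ∑ j ∈ Finset.Icc 1 K,
      if m.Coprime j then (A m * critChar t m) * (A j * w j * critChar t j) else 0‖ ^ 2 /
        (a ^ 2 + t ^ 2) with hI
  have hI0 : 0 ≤ I := integral_nonneg fun t => by positivity
  have hXI : X ^ 2 * I ≤ (B + CT) * (Z + Z') := by
    calc X ^ 2 * I ≤ B * Z + CT * Z' := by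
          refine (mul_le_mul_of_nonneg_left hbil (by positivity)).trans ?_
          rw [hB, mul_add, mul_add, add_mul (12 * C₁ ^ 2 * (1 / c₁ + 2))]
          linarith
      _ ≤ _ := by linarith [mul_nonneg hB0 hZ'0, mul_nonneg hCT0 hZ0]
  calc _ ≤ 3 * ((2 * X + H) ^ 2 + (2 * X) ^ 2 + X ^ 2) * (1 / (2 * Real.pi) * I) := hred
    _ ≤ 3 * (((2 + c₂) * X) ^ 2 + (2 * X) ^ 2 + X ^ 2) * (1 * I) := by
        gcongr
        · linarith
        · rw [div_le_one (by positivity)]; linarith [Real.pi_gt_three]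
    _ = 3 * ((2 + c₂) ^ 2 + 5) * (X ^ 2 * I) := by ring
    _ ≤ 3 * ((2 + c₂) ^ 2 + 5) * ((B + CT) * (Z + Z')) := by gcongr
    _ = _ := by rw [hZ, hZ']; ring

end

/-! ### Small X, the second moment bound and the consequence -/

section

open MeasureTheory

theorem norm_shortSum_le (A : ℕ → ℂ) {M H x R : ℝ} (hM : 2 * M ≤ R) (hx : x + H ≤ R) :
    ‖shortSum A M H x‖ ≤
      ∑ m ∈ Finset.range (⌊R⌋₊ + 1), ∑ k ∈ Finset.range (⌊R⌋₊ + 1), ‖A (m * k)‖ := by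
  rw [shortSum]
  refine (norm_sum_le _ _).trans ((Finset.sum_le_sum fun m _ => norm_sum_le _ _).trans ?_)
  refine (Finset.sum_le_sum_of_subset_of_nonneg (fun m hm => ?_)
    fun _ _ _ => Finset.sum_nonneg fun _ _ => norm_nonneg _).trans
    (Finset.sum_le_sum fun m _ => Finset.sum_le_sum_of_subset_of_nonneg (fun k hk => ?_)
      fun _ _ _ => norm_nonneg _)
  · rw [Finset.mem_range, Nat.lt_succ_iff]
    exact (Finset.mem_Ioc.mp hm).2.trans (Nat.floor_mono hM)
  · rw [Finset.mem_range, Nat.lt_succ_iff]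
    exact (Finset.mem_Icc.mp (Finset.mem_filter.mp hk).1).2.trans (Nat.floor_mono hx)

/-- For bounded `X` the mean square of the short sums is bounded. -/
theorem exists_mean_square_le_of_le (A : ℕ → ℂ) {δ : ℝ} (hδ0 : 0 < δ) (hδ1 : δ < 1) {c₁ c₂ : ℝ}
    (hc₁ : 0 < c₁) (hc₂ : 0 < c₂) (X₁ : ℝ) :
    ∃ C : ℝ, 0 ≤ C ∧ ∀ X H : ℝ, 1 ≤ X → X ≤ X₁ → c₁ * X ^ (6 * δ) ≤ H →
      H ≤ c₂ * X ^ (1 - 6 * δ) →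
      ∫ x in X..2 * X, ‖shortSum A (X ^ δ) H x‖ ^ 2 ≤ C * (H ^ 2 * X ^ (1 - δ ^ 2)) := by
  set R : ℝ := (2 + c₂) * X₁ with hR
  set B : ℝ := ∑ m ∈ Finset.range (⌊R⌋₊ + 1), ∑ k ∈ Finset.range (⌊R⌋₊ + 1), ‖A (m * k)‖ with hB
  refine ⟨B ^ 2 * |X₁| / c₁ ^ 2, by positivity, fun X H hX hXX hH1 hH2 => ?_⟩
  have hX0 : 0 < X := by linarith
  have hle : ∀ {b : ℝ}, b ≤ 1 → X ^ b ≤ X := fun hb =>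
    (Real.rpow_le_rpow_of_exponent_le hX hb).trans_eq (Real.rpow_one X)
  have hHX : H ≤ c₂ * X₁ := hH2.trans (by gcongr; exact (hle (by linarith)).trans hXX)
  have hc₂X : 0 ≤ c₂ * X₁ := mul_nonneg hc₂.le (by linarith)
  have hM : 2 * X ^ δ ≤ R := by
    have := hle hδ1.le
    rw [hR]; linarith
  have hHc : c₁ ≤ H :=
    (le_mul_of_one_le_right hc₁.le (Real.one_le_rpow hX (by linarith))).trans hH1
  have hint : ∫ x in X..2 * X, ‖shortSum A (X ^ δ) H x‖ ^ 2 ≤ B ^ 2 * |X₁| := by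
    refine (Real.le_norm_self _).trans ((intervalIntegral.norm_integral_le_of_norm_le_const
      (C := B ^ 2) fun x hx => ?_).trans ?_)
    · rw [Set.uIoc_of_le (by linarith)] at hx
      rw [Real.norm_of_nonneg (by positivity)]
      gcongr
      refine norm_shortSum_le A hM ?_
      rw [hR]; linarith [hx.2]
    · rw [show 2 * X - X = X by ring]
      gcongr
  have h1 : 1 ≤ X ^ (1 - δ ^ 2) := Real.one_le_rpow hX (by nlinarith)
  calc _ ≤ B ^ 2 * |X₁| := hint
    _ = B ^ 2 * |X₁| / c₁ ^ 2 * (c₁ ^ 2 * 1) := by field_simp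
    _ ≤ _ := by gcongr

/-- Large X comes from `exists_mean_square_bound`, weakened to exponent 6δ. Bounded X is covered by
a trivial estimate, since H ≥ c₁ keeps the right-hand side away from zero. -/
theorem IsLFunction.exists_second_moment_bound {A : ℕ → ℂ} {L : ℂ → ℂ} {d : ℕ}
    (hL : IsLFunction A L d) {θ : ℝ} (hθ : IsSubconvexityExponent L θ) {δ : ℝ} (hδ0 : 0 < δ)
    (hδ1 : δ < 1) {c₁ c₂ : ℝ} (hc₁ : 0 < c₁) (hc₂ : 0 < c₂) :
    ∃ K : ℝ, ∀ X H : ℝ, 1 ≤ X → c₁ * X ^ (6 * δ) ≤ H → H ≤ c₂ * X ^ (1 - 6 * δ) →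
      ∫ x in X..2 * X, ‖shortSum A (X ^ δ) H x‖ ^ 2 ≤
        K * (H ^ 2 * X ^ (1 - δ ^ 2) + X ^ (2 * θ * (1 + δ) + 6 * δ) * H ^ (2 - 2 * θ)) := by
  obtain ⟨X₁, C₁, hC₁, h₁⟩ : ∃ X₁ C₁ : ℝ, 0 ≤ C₁ ∧ ∀ X H : ℝ, 1 ≤ X → X₁ ≤ X →
      c₁ * X ^ (6 * δ) ≤ H → H ≤ c₂ * X ^ (1 - 6 * δ) →
      ∫ x in X..2 * X, ‖shortSum A (X ^ δ) H x‖ ^ 2 ≤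
        C₁ * (H ^ 2 * X ^ (1 - δ ^ 2) + X ^ (2 * θ * (1 + δ) + 6 * δ) * H ^ (2 - 2 * θ)) := by
    rcases le_or_gt δ (1 / 12) with hδ | hδ
    · obtain ⟨X₀, C, -, hC, h⟩ := hL.exists_mean_square_bound hθ hδ0 hδ hc₁ hc₂
      refine ⟨X₀, C, hC, fun X H hX hX₀ hH1 hH2 => (h X H hX₀ hH1 hH2).trans ?_⟩
      have hX0 : 0 < X := by linarith
      have hH0 : 0 < H := lt_of_lt_of_le (by positivity) hH1
      refine mul_le_mul_of_nonneg_left ?_ hC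
      refine (mul_le_of_le_one_left (by positivity)
        (Real.rpow_le_one_of_one_le_of_nonpos hX (by linarith [sq_nonneg δ]))).trans ?_
      gcongr
      linarith
    -- For δ > 1/12 the two constraints on H force X^{12δ-1} ≤ c₂/c₁, so X is bounded and the claim
    -- for large X is vacuous.
    · have hδ' : 0 < 12 * δ - 1 := by linarith
      refine ⟨(c₂ / c₁) ^ (1 / (12 * δ - 1)) + 1, 0, le_rfl, fun X H hX hX₀ hH1 hH2 => ?_⟩
      have hX0 : 0 < X := by linarith
      have h1 : X ^ (12 * δ - 1) ≤ c₂ / c₁ := by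
        rw [le_div_iff₀ hc₁]
        have h := hH1.trans hH2
        have hp : 0 < X ^ (1 - 6 * δ) := Real.rpow_pos_of_pos hX0 _
        rw [show 6 * δ = (12 * δ - 1) + (1 - 6 * δ) by ring, Real.rpow_add hX0] at h
        refine le_of_mul_le_mul_right (a := X ^ (1 - 6 * δ)) ?_ hp
        calc _ = c₁ * (X ^ (12 * δ - 1) * X ^ (1 - 6 * δ)) := by ring
          _ ≤ _ := by
            refine h.trans_eq ?_
            ring_nf
      have h2 : X ≤ (c₂ / c₁) ^ (1 / (12 * δ - 1)) := by
        calc X = (X ^ (12 * δ - 1)) ^ (1 / (12 * δ - 1)) := by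
              rw [← Real.rpow_mul hX0.le, mul_one_div_cancel hδ'.ne', Real.rpow_one]
          _ ≤ _ := by gcongr
      linarith
  obtain ⟨C₂, hC₂, h₂⟩ := exists_mean_square_le_of_le A hδ0 hδ1 hc₁ hc₂ X₁
  refine ⟨C₁ + C₂, fun X H hX hH1 hH2 => ?_⟩
  have hX0 : 0 < X := by linarith
  have hH0 : 0 < H := lt_of_lt_of_le (by positivity) hH1
  have hZ1 : 0 ≤ H ^ 2 * X ^ (1 - δ ^ 2) := by positivity
  have hZ2 : 0 ≤ X ^ (2 * θ * (1 + δ) + 6 * δ) * H ^ (2 - 2 * θ) := by positivity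
  rw [add_mul]
  rcases le_total X₁ X with h | h
  · exact (h₁ X H hX h hH1 hH2).trans (le_add_of_nonneg_right (by positivity))
  · refine (h₂ X H hX h hH1 hH2).trans (le_add_of_nonneg_of_le (by positivity) ?_)
    gcongr
    linarith

/-- With trivial weight and a fixed cutoff the short sum becomes a finite sum of interval indicators
in x, from which measurability and integrability are read off. -/
theorem IsLFunction.exists_windowSum_eq {A : ℕ → ℂ} {L : ℂ → ℂ} {d : ℕ} (hL : IsLFunction A L d)
    (M H b : ℝ) : ∃ (s : Finset (ℕ × ℕ)) (ν : ℕ × ℕ → ℝ) (β : ℕ × ℕ → ℂ),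
      ∀ x ≤ b, shortSum A M H x = windowSum s ν β H x :=
  ⟨_, _, _, fun x hx => shortSum_eq_windowSum hL (y := b + H) (K := ⌊b + H⌋₊) (w := 1) (by linarith)
    fun m hm k _ hmk => ⟨Nat.le_floor (le_trans (le_mul_of_one_le_left (Nat.cast_nonneg k) (by
      have := (Finset.mem_Ioc.mp hm).1
      exact_mod_cast (show 1 ≤ m by omega))) hmk), rfl⟩⟩

/-- Chebyshev's inequality for the short sums. -/
theorem IsLFunction.le_volume_of_integral_le {A : ℕ → ℂ} {L : ℂ → ℂ} {d : ℕ}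
    (hL : IsLFunction A L d) {M H X V C : ℝ} (hX : 0 < X) (hV : 0 < V) (hC : 0 < C)
    (h : ∫ x in X..2 * X, ‖shortSum A M H x‖ ^ 2 ≤ V ^ 2 * X) :
    (1 - C ^ (-2 : ℤ)) * X ≤
      volume.real {x : ℝ | x ∈ Set.Icc X (2 * X) ∧ ‖shortSum A M H x‖ < C * V} := by
  obtain ⟨s, ν, β, hw⟩ := hL.exists_windowSum_eq M H (2 * X)
  set f : ℝ → ℝ := fun x => ‖windowSum s ν β H x‖ ^ 2 with hf
  have hle : X ≤ 2 * X := by linarith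
  have hset : {x : ℝ | x ∈ Set.Icc X (2 * X) ∧ ‖shortSum A M H x‖ < C * V} =
      Set.Icc X (2 * X) ∩ {x | ‖windowSum s ν β H x‖ < C * V} := by
    ext x
    simp only [Set.mem_ofPred_eq, Set.mem_inter_iff]
    refine and_congr_right fun hx => ?_
    rw [hw x hx.2]
  have hmeas : Measurable fun x => ‖windowSum s ν β H x‖ := (measurable_windowSum s ν β H).norm
  have hmg : MeasurableSet {x | ‖windowSum s ν β H x‖ < C * V} :=
    measurableSet_lt hmeas measurable_const
  have hint : IntegrableOn f (Set.Icc X (2 * X)) := by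
    have := intervalIntegrable_norm_windowSum_sq s ν β H X (2 * X)
    rwa [intervalIntegrable_iff_integrableOn_Icc_of_le hle] at this
  have hfI : ∫ x in Set.Icc X (2 * X), f x ≤ V ^ 2 * X := by
    refine le_trans (le_of_eq ?_) h
    rw [intervalIntegral.integral_of_le hle, integral_Icc_eq_integral_Ioc]
    refine setIntegral_congr_fun measurableSet_Ioc fun x hx => ?_
    simp only [hf]
    rw [hw x hx.2]
  have hcheb := mul_meas_ge_le_integral_of_nonneg (μ := volume.restrict (Set.Icc X (2 * X)))
    (f := f) (Filter.Eventually.of_forall fun x => by positivity) hint ((C * V) ^ 2)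
  have hbad : {x | (C * V) ^ 2 ≤ f x} = {x | ‖windowSum s ν β H x‖ < C * V}ᶜ := by
    ext x
    simp only [hf, Set.mem_ofPred_eq, Set.mem_compl_iff, not_lt]
    exact pow_le_pow_iff_left₀ (by positivity) (norm_nonneg _) two_ne_zero
  rw [hbad, measureReal_restrict_apply hmg.compl] at hcheb
  have hsplit := measureReal_inter_add_sdiff (μ := volume) (s := Set.Icc X (2 * X)) hmg
    (by simp [Real.volume_Icc])
  rw [Real.volume_real_Icc_of_le hle, Set.sdiff_eq] at hsplit
  rw [Set.inter_comm] at hcheb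
  rw [hset]
  have hb : volume.real (Set.Icc X (2 * X) ∩ {x | ‖windowSum s ν β H x‖ < C * V}ᶜ) ≤
      C ^ (-2 : ℤ) * X := by
    have h1 := hcheb.trans hfI
    rw [zpow_neg, zpow_ofNat, inv_mul_eq_div, le_div_iff₀ (by positivity)]
    refine le_of_mul_le_mul_left (a := V ^ 2) ?_ (by positivity)
    calc _ = _ := by ring
      _ ≤ _ := h1
  linarith

/-- For θ ≥ 1/2, h = 1 + δ - (1 - 6δ - 2δ²)/(2θ). If the bracket is nonnegative then h ≥ 7δ + 2δ².
Otherwise h ≥ 1 + δ, contradicting h ≤ 1 - 6δ. Combined with that hypothesis, the result also forces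
δ ≤ 1/12. -/
theorem six_mul_le_lengthExponent {θ δ : ℝ} (hδ0 : 0 < δ)
    (h : lengthExponent θ δ ≤ 1 - 6 * δ) : 6 * δ ≤ lengthExponent θ δ := by
  rw [lengthExponent] at h ⊢
  split_ifs at h ⊢ with hθ
  · have hinv : 1 / (2 * θ) ≤ 1 := by rw [div_le_one (by linarith)]; linarith
    have hinv0 : 0 < 1 / (2 * θ) := one_div_pos.mpr (by linarith)
    have he : 1 + δ - 1 / (2 * θ) + (6 * δ + 2 * δ ^ 2) / (2 * θ) =
        1 + δ - (1 - 6 * δ - 2 * δ ^ 2) * (1 / (2 * θ)) := by ring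
    rw [he] at h ⊢
    rcases le_total 0 (1 - 6 * δ - 2 * δ ^ 2) with h0 | h0
    · have := mul_le_of_le_one_right h0 hinv
      nlinarith
    · have := mul_nonpos_of_nonpos_of_nonneg h0 hinv0.le
      nlinarith
  · exact le_rfl

/-- The exponent h makes the second term no larger than the first. For θ ≥ 1/2 the comparison is 1 -
2δ - 2δ² ≤ 1 - δ². For θ < 1/2 it is 2θ(1 - 5δ) + 4δ ≤ 1 - δ, where 6δ in place of 4δ would fail
near θ = 1/2. -/
theorem rpow_mul_lengthExponent_le {θ δ X : ℝ} (hδ0 : 0 < δ) (hδ1 : δ ≤ 1 / 12)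
    (hX : 1 ≤ X) :
    X ^ (2 * θ * (1 + δ) + 4 * δ) * (X ^ lengthExponent θ δ) ^ (2 - 2 * θ) ≤
      (X ^ lengthExponent θ δ) ^ 2 * X ^ (1 - δ ^ 2) := by
  have hX0 : 0 < X := by linarith
  rw [← Real.rpow_natCast, ← Real.rpow_mul hX0.le, ← Real.rpow_mul hX0.le, ← Real.rpow_add hX0,
    ← Real.rpow_add hX0]
  refine Real.rpow_le_rpow_of_exponent_le hX ?_
  suffices 2 * θ * (1 + δ) + 4 * δ - 2 * θ * lengthExponent θ δ ≤ 1 - δ ^ 2 by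
    push_cast; linarith
  rw [lengthExponent]
  split_ifs with hθ
  · have hθ' : 0 < θ := by linarith
    have : 2 * θ * (1 + δ - 1 / (2 * θ) + (6 * δ + 2 * δ ^ 2) / (2 * θ)) =
        2 * θ * (1 + δ) - 1 + (6 * δ + 2 * δ ^ 2) := by field_simp
    rw [this]
    nlinarith
  · push Not at hθ
    nlinarith

theorem IsLFunction.exists_le_volume {A : ℕ → ℂ} {L : ℂ → ℂ} {d : ℕ} (hL : IsLFunction A L d)
    {θ : ℝ} (hθ : IsSubconvexityExponent L θ) {δ : ℝ} (hδ0 : 0 < δ)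
    (hh : lengthExponent θ δ ≤ 1 - 6 * δ) :
    ∃ X₀ : ℝ, ∀ X : ℝ, X₀ ≤ X → ∀ C : ℝ, 1 ≤ C →
      (1 - C ^ (-2 : ℤ)) * X ≤
        volume.real {x : ℝ | x ∈ Set.Icc X (2 * X) ∧
          ‖shortSum A (X ^ δ) (X ^ lengthExponent θ δ) x‖ <
            C * X ^ lengthExponent θ δ * X ^ (-(δ ^ 2 / 2))} := by
  have hh' := six_mul_le_lengthExponent hδ0 hh
  have hδ1 : δ ≤ 1 / 12 := by linarith
  obtain ⟨X₀, C₁, hX₀, hC₁, hb⟩ := hL.exists_mean_square_bound hθ hδ0 hδ1 one_pos one_pos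
  set κ : ℝ := δ ^ 2 / 100 with hκ
  have hκ0 : 0 < κ := by positivity
  -- The spare factor X^{-κ} absorbs 2C₁, so the second moment is at most V²X with V = HX^{-δ²/2}
  -- and no constant. Chebyshev then gives exactly C^{-2}, with a threshold independent of C.
  refine ⟨max X₀ ((2 * C₁) ^ (1 / κ)), fun X hX C hC => ?_⟩
  have hXX₀ : X₀ ≤ X := (le_max_left _ _).trans hX
  have hX1 : 1 ≤ X := hX₀.trans hXX₀
  have hX0 : 0 < X := by linarith
  have hCX : C₁ * (2 * X ^ (-κ)) ≤ 1 := by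
    have h1 : 2 * C₁ ≤ X ^ κ := by
      calc 2 * C₁ = ((2 * C₁) ^ (1 / κ)) ^ κ := by
            rw [← Real.rpow_mul (by positivity), one_div_mul_cancel hκ0.ne', Real.rpow_one]
        _ ≤ _ := by gcongr; exact (le_max_right _ _).trans hX
    rw [Real.rpow_neg hX0.le]
    calc _ = 2 * C₁ / X ^ κ := by ring
      _ ≤ 1 := by rw [div_le_one (by positivity)]; exact h1
  set H : ℝ := X ^ lengthExponent θ δ with hH
  have hH0 : 0 < H := by positivity
  simp_rw [mul_assoc C]
  refine hL.le_volume_of_integral_le hX0 (by positivity) (by linarith) ?_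
  refine (hb X H hXX₀ ?_ ?_).trans ?_
  · rw [one_mul]; exact Real.rpow_le_rpow_of_exponent_le hX1 hh'
  · rw [one_mul]; exact Real.rpow_le_rpow_of_exponent_le hX1 hh
  · have h2 := rpow_mul_lengthExponent_le (θ := θ) hδ0 hδ1 hX1
    calc _ ≤ C₁ * (X ^ (-κ) * (H ^ 2 * X ^ (1 - δ ^ 2) + H ^ 2 * X ^ (1 - δ ^ 2))) := by gcongr
      _ = C₁ * (2 * X ^ (-κ)) * (H ^ 2 * X ^ (1 - δ ^ 2)) := by ring
      _ ≤ 1 * (H ^ 2 * X ^ (1 - δ ^ 2)) := by gcongr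
      _ = (H * X ^ (-(δ ^ 2 / 2))) ^ 2 * X := by
          rw [mul_pow, ← Real.rpow_natCast (X ^ (-(δ ^ 2 / 2))), ← Real.rpow_mul hX0.le, one_mul,
            mul_assoc, ← Real.rpow_add_one hX0.ne']
          congr 2
          push_cast; ring

end

theorem proposition1 (A : ℕ → ℂ) (L : ℂ → ℂ) (d : ℕ) (hL : IsLFunction A L d)
    (θ : ℝ) (hθ : IsSubconvexityExponent L θ) (δ : ℝ) (hδ₀ : 0 < δ) (hδ₁ : δ < 1) :
    (∀ c₁ c₂ : ℝ, 0 < c₁ → 0 < c₂ → ∃ K : ℝ, ∀ X H : ℝ, 1 ≤ X →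
      c₁ * X ^ (6 * δ) ≤ H → H ≤ c₂ * X ^ (1 - 6 * δ) →
        ∫ x in X..(2 * X), ‖shortSum A (X ^ δ) H x‖ ^ 2 ≤
          K * (H ^ 2 * X ^ (1 - δ ^ 2)
            + X ^ (2 * θ * (1 + δ) + 6 * δ) * H ^ (2 - 2 * θ))) ∧
    (lengthExponent θ δ ≤ 1 - 6 * δ →
      ∃ X₀ : ℝ, ∀ X : ℝ, X₀ ≤ X → ∀ C : ℝ, 1 ≤ C →
        (1 - C ^ (-2 : ℤ)) * X ≤
          MeasureTheory.volume.real {x : ℝ | x ∈ Set.Icc X (2 * X) ∧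
            ‖shortSum A (X ^ δ) (X ^ lengthExponent θ δ) x‖ <
              C * X ^ lengthExponent θ δ * X ^ (-(δ ^ 2 / 2))}) :=
  ⟨fun _ _ hc₁ hc₂ => hL.exists_second_moment_bound hθ hδ₀ hδ₁ hc₁ hc₂,
    fun hh => hL.exists_le_volume hθ hδ₀ hh⟩
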